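/- Let $I=(-1,1)$, $\Lambda=(0,2\pi)$, $\Omega'=I\times\Lambda$ with points $(\rho,\phi)$, and $\omega(\rho)=(1-\rho^2)^{-1/2}$. For integers $\mu,\sigma\ge 0$ let $H^\mu(\Lambda;H^\sigma_\omega(I))$ be the space of functions $v$ on $\Omega'$ whose weak derivatives $\partial_\rho^j\partial_\phi^k v$, $0\le j\le\sigma$, $0\le k\le\mu$, taken in the sense of functions that are $2\pi$-periodic in $\phi$ (that is, against smooth test functions that are $2\pi$-periodic in $\phi$ and compactly supported in $\rho\in I$), exist and have finite norm $$\|v\|_{H^\mu(\Lambda;H^\sigma_\omega(I))}=\Big(\sum_{k=0}^{\mu}\sum_{j=0}^{\sigma}\int_\Lambda\int_I|\partial_\rho^j\partial_\phi^k v|^2\,\omega\,d\rho\,d\phi\Big)^{1/2}.$$ For functions $P_0(1,\cdot),Q_0(1,\cdot)$ on $[0,2\pi]$ let $\mathcal B$ be the set of pairs $(P,Q)$ of functions in $C^1(\overline{\Omega'})$ with $P(1,\phi)=P_0(1,\phi)$, $Q(1,\phi)=Q_0(1,\phi)$. For integers $M\ge 1$ and even $N\ge 2$, a Fourier–Chebyshev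 polynomial is a function of the form $$\sum_{j=0}^{M}\Big(\sum_{k=0}^{N/2}a_{k,j}\cos k\phi+\sum_{k=1}^{N/2-1}b_{k,j}\sin k\phi\Big)T_j(\rho),$$ where $T_j$ is the Chebyshev polynomial of the first kind; put $\rho_m=\cos(m\pi/M)$ for $0\le m\le M$ and $\phi_n=2\pi n/N$ for $0\le n\le N-1$. Let $\mathcal B^{NM}$ be the set of pairs of such polynomials that equal $(P_0(1,\phi_n),Q_0(1,\phi_n))$ at all points $(1,\phi_n)$. Let $I^{NM}v$ be the Fourier–Chebyshev polynomial with $I^{NM}v(\rho_m,\phi_n)=v(\rho_m,\phi_n)$ for all $m,n$. It exists and is unique, and $(I^{NM}P,I^{NM}Q)\in\mathcal B^{NM}$ for $(P,Q)\in\mathcal B$. **Theorem 4.2.** (i) Let $l>2$ and $s>1$ be integers. There is a constant $c>0$, independent of $P$, $Q$, $M$ and $N$, such that for all $\alpha,\beta\in\{0,1\}$ and all $(P,Q)\in\mathcal B$ with $P,Q\in H^s(\Lambda;H^l_\omega(I))$, $$\|I^{NM}P-P\|_{H^\beta(\Lambda;H^\alpha_\omega(I))}\le c\,\|P\|_*\,(M^{2\alpha-l}+N^{\beta-s}),\qquad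 \|I^{NM}Q-Q\|_{H^\beta(\Lambda;H^\alpha_\omega(I))}\le c\,\|Q\|_*\,(M^{2\alpha-l}+N^{\beta-s}),$$ where $\|v\|_*=\max\{\|v\|_{H^\beta(\Lambda;H^l_\omega(I))},\|v\|_{H^s(\Lambda;H^\alpha_\omega(I))},\|v\|_{H^s(\Lambda;H^l_\omega(I))}\}$. (ii) Let $0<\varepsilon<\gamma$, $\rho_r=2/(\gamma-\varepsilon)$, $r=\frac{\gamma+\varepsilon}2+\frac{\gamma-\varepsilon}2\rho$ and $$D(P,Q)=\frac{\rho_r}{r}\,P\,\big[P_\rho(Q_\phi+1)-P_\phi Q_\rho\big].$$ Let $l>6$ be an integer. There is a constant $c>0$, independent of $P$, $Q$, $M$ and $N$, such that for all $(P,Q)\in\mathcal B$ with $P,Q\in H^l(\Lambda;H^l_\omega(I))$, $$\|D(I^{NM}P,I^{NM}Q)-D(P,Q)\|_{C(\overline{\Omega'})}\le c\,(1+S)^2\,S\,(M^{6-l}+N^{3-l}),\qquad S=\|P\|_{H^l(\Lambda;H^l_\omega(I))}+\|Q\|_{H^l(\Lambda;H^l_\omega(I))}.$$ -/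

import Mathlib

open scoped ENNReal

noncomputable section

namespace FourierChebyshev

/-- The computational domain `Ω' = I × Λ`, `I = (-1,1)`, `Λ = (0,2π)`; points are `(ρ, φ)`. -/
def Dom : Set (ℝ × ℝ) := Set.Ioo (-1) 1 ×ˢ Set.Ioo 0 (2 * Real.pi)

/-- Its closure `[-1,1] × [0,2π]`. -/
def DomBar : Set (ℝ × ℝ) := Set.Icc (-1) 1 ×ˢ Set.Icc 0 (2 * Real.pi)

/-- The Chebyshev weight `ω(ρ) = (1 - ρ²)^(-1/2)`. -/
def chebWeight (ρ : ℝ) : ℝ := 1 / Real.sqrt (1 - ρ ^ 2)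

/-- The classical partial derivative `∂_ρ^j ∂_φ^k η` (used only for smooth `η`). -/
def mixedDeriv (j k : ℕ) (η : ℝ × ℝ → ℝ) (x : ℝ × ℝ) : ℝ :=
  iteratedDeriv j (fun ρ => iteratedDeriv k (fun φ => η (ρ, φ)) x.2) x.1

/-- Test functions: smooth, `2π`-periodic in `φ`, and vanishing for `ρ` outside a compact
subinterval of `(-1,1)`. -/
def IsTestFun (η : ℝ × ℝ → ℝ) : Prop :=
  ContDiff ℝ ((⊤ : ℕ∞) : WithTop ℕ∞) η ∧ (∀ ρ φ, η (ρ, φ + 2 * Real.pi) = η (ρ, φ)) ∧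
    ∃ a : ℝ, a < 1 ∧ ∀ ρ φ, a ≤ |ρ| → η (ρ, φ) = 0

/-- `g` is the weak derivative `∂_ρ^j ∂_φ^k v` on `Ω'`, in the sense of functions that are
`2π`-periodic in `φ` (so the periodic extension of `v` in `φ` is the one differentiated). -/
def IsWeakDeriv (j k : ℕ) (v g : ℝ × ℝ → ℝ) : Prop :=
  MeasureTheory.IntegrableOn v Dom ∧ MeasureTheory.IntegrableOn g Dom ∧
    ∀ η, IsTestFun η →
      ∫ x in Dom, v x * mixedDeriv j k η x = (-1) ^ (j + k) * ∫ x in Dom, g x * η x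

/-- `∫_Λ ∫_I |∂_ρ^j ∂_φ^k v|² ω dρ dφ`, with value `∞` if the weak derivative does not exist.
Weak derivatives are unique almost everywhere, so the infimum is over one value at most. -/
def derivSq (j k : ℕ) (v : ℝ × ℝ → ℝ) : ℝ≥0∞ :=
  ⨅ (g : ℝ × ℝ → ℝ) (_ : IsWeakDeriv j k v g),
    ∫⁻ x in Dom, ‖g x‖ₑ ^ 2 * ENNReal.ofReal (chebWeight x.1)

/-- The norm of `H^μ(Λ; H^σ_ω(I))` (`2π`-periodic in `φ`), as an extended real number. -/
def sobNorm (μ σ : ℕ) (v : ℝ × ℝ → ℝ) : ℝ≥0∞ :=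
  (∑ k ∈ Finset.range (μ + 1), ∑ j ∈ Finset.range (σ + 1), derivSq j k v) ^ (1 / 2 : ℝ)

/-- `v ∈ H^μ(Λ; H^σ_ω(I))`. -/
def MemSob (μ σ : ℕ) (v : ℝ × ℝ → ℝ) : Prop := sobNorm μ σ v < ⊤

/-- The norm `‖v‖_*`, which depends on `α`, `β`, `l`, `s`. -/
def starNorm (α β l s : ℕ) (v : ℝ × ℝ → ℝ) : ℝ≥0∞ :=
  max (sobNorm β l v) (max (sobNorm s α v) (sobNorm s l v))

/-- `(P,Q) ∈ 𝓑`: both functions are `C¹` on the closed rectangle and take the Dirichlet data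
`P₀(1,φ)`, `Q₀(1,φ)` (here functions of `φ`) on `ρ = 1`. -/
def MemB (P₀ Q₀ : ℝ → ℝ) (P Q : ℝ × ℝ → ℝ) : Prop :=
  ContDiffOn ℝ 1 P DomBar ∧ ContDiffOn ℝ 1 Q DomBar ∧
    ∀ φ ∈ Set.Icc 0 (2 * Real.pi), P (1, φ) = P₀ φ ∧ Q (1, φ) = Q₀ φ

/-- Fourier–Chebyshev polynomials (`N` even). -/
def IsFCPoly (M N : ℕ) (p : ℝ × ℝ → ℝ) : Prop :=
  ∃ a b : ℕ → ℕ → ℝ, ∀ ρ φ : ℝ, p (ρ, φ) =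
    ∑ j ∈ Finset.range (M + 1),
      (∑ k ∈ Finset.range (N / 2 + 1), a k j * Real.cos (k * φ) +
        ∑ k ∈ Finset.Ico 1 (N / 2), b k j * Real.sin (k * φ)) *
      (Polynomial.Chebyshev.T ℝ j).eval ρ

/-- The Chebyshev–Gauss–Lobatto nodes `ρ_m = cos (mπ/M)`. -/
def nodeρ (M m : ℕ) : ℝ := Real.cos (m * Real.pi / M)

/-- The Fourier nodes `φ_n = 2nπ/N`. -/
def nodeφ (N n : ℕ) : ℝ := 2 * n * Real.pi / N

/-- `(p,q) ∈ 𝓑^{NM}`. -/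
def MemBNM (M N : ℕ) (P₀ Q₀ : ℝ → ℝ) (p q : ℝ × ℝ → ℝ) : Prop :=
  IsFCPoly M N p ∧ IsFCPoly M N q ∧
    ∀ n < N, p (1, nodeφ N n) = P₀ (nodeφ N n) ∧ q (1, nodeφ N n) = Q₀ (nodeφ N n)

/-- `p` is a Fourier–Chebyshev polynomial that agrees with `v` at all nodes. -/
def IsInterpolant (M N : ℕ) (v p : ℝ × ℝ → ℝ) : Prop :=
  IsFCPoly M N p ∧
    ∀ m ≤ M, ∀ n < N, p (nodeρ M m, nodeφ N n) = v (nodeρ M m, nodeφ N n)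

open Classical in
/-- The interpolation operator `I^{NM}`, acting on each component. The value `0` is used only if
there is no interpolant. -/
def interp (M N : ℕ) (v : ℝ × ℝ → ℝ) : ℝ × ℝ → ℝ :=
  if h : ∃ p, IsInterpolant M N v p then h.choose else 0

/-- `∂_ρ v` on the closed rectangle (one-sided at the boundary). -/
def dρ (v : ℝ × ℝ → ℝ) (x : ℝ × ℝ) : ℝ := fderivWithin ℝ v DomBar x (1, 0)

/-- `∂_φ v` on the closed rectangle (one-sided at the boundary). -/
def dφ (v : ℝ × ℝ → ℝ) (x : ℝ × ℝ) : ℝ := fderivWithin ℝ v DomBar x (0, 1)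

/-- `D(P,Q) = (ρ_r / r) P [P_ρ (Q_φ + 1) - P_φ Q_ρ]`, where `ρ_r = 2/(γ-ε)` and
`r = (γ+ε)/2 + (γ-ε)/2 ρ`. -/
def detD (ε γ : ℝ) (P Q : ℝ × ℝ → ℝ) (x : ℝ × ℝ) : ℝ :=
  (2 / (γ - ε)) / ((γ + ε) / 2 + (γ - ε) / 2 * x.1) *
    P x * (dρ P x * (dφ Q x + 1) - dφ P x * dρ Q x)

/-- The norm of `C(closure Ω')`. -/
def supNorm (f : ℝ × ℝ → ℝ) : ℝ≥0∞ := ⨆ x ∈ DomBar, ‖f x‖ₑ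

end FourierChebyshev

end

open scoped ENNReal

noncomputable section

namespace FourierChebyshev

/-! ### Hartley functions and Chebyshev polynomials: derivatives, bounds, orthogonality. -/

section

open Polynomial.Chebyshev MeasureTheory

/-! Expand `P` in the functions `T_m(ρ) cas(nφ)`, `(m, n) ∈ ℤ × ℤ`, with `cas = cos + sin` and
`T_{-m} = T_m`. For the measure `ω dρ dφ` these are orthogonal up to the identification of `m` with
`-m`, and with both indices in `ℤ` the recursions for the coefficients have no exceptional cases.

Decay of coefficients. Testing weak derivatives against cut-off basis functions shows that `∂_φ`
turns the coefficient `c(m, n)` into `-n c(m, -n)`, and that `2m c(m, n) = c'(m-1, n) - c'(m+1, n)`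
when `c'` belongs to `∂_ρ` (`fcCoeff_weakDeriv_snd`, `fcCoeff_weakDeriv_fst`). Together with
Bessel's inequality this makes `(1+|m|)^l (1+|n|)^s c(m, n)` square summable, with sum controlled by
the Sobolev norm (`exists_tsum_fcCoeff_le`). For `l ≥ 3`, `s ≥ 2` the expansion is absolutely
convergent, and by completeness its sum is `P` (`hasSum_fcBasis`).

Aliasing. At the nodes `T_m` depends only on `±m` modulo `2M` and `cas(nφ)` only on `n` modulo `N`,
so interpolation replaces each basis function by its low-frequency alias (`hasSum_interp`). The
error is a series of the differences `basisErr`, which vanish unless `|m| > M` or `|n| ≥ N/2`.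

Sobolev estimate. Group the indices into alias classes. Errors from different classes are
orthogonal, and inside a class the Cauchy–Schwarz inequality costs the sum of `‖basisErr‖² /
weight²` over its unresolved indices (`integral_sum_sq_le`, `exists_sum_errClass_le`). A residue
class is so sparse that its tail has the size of its largest term up to a constant, which gives
`N^{2(k-s)}` and, without `ρ`-derivative, `M^{-2l}`. The derivatives `T_m'` are not orthogonal for
`ω`, so with one `ρ`-derivative the whole tail in `m` is summed; since `‖T_m'‖² = π|m|³`, this gives
`M^{4-2l}`, the square of `M^{2-l}`.

Determinant. The pointwise bound `|T_m'| ≤ m²` and the Cauchy–Schwarz inequality from weighted `ℓ²`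
to `ℓ¹` bound `P`, `Q` and their interpolation errors together with first derivatives
(`exists_c1Bound`). As `D` is a cubic expression in these quantities with a bounded prefactor, its
perturbation is then elementary (`abs_det_sub_le`). -/

/-- The Hartley function `cos (nφ) + sin (nφ)`, differentiated `k` times. -/
def casD : ℕ → ℤ → ℝ → ℝ
  | 0, n, φ => Real.cos (n * φ) + Real.sin (n * φ)
  | k + 1, n, φ => n * casD k (-n) φ

/-- The `j`-th derivative of the Chebyshev polynomial `T_m`. -/
def chebD (j : ℕ) (m : ℤ) (ρ : ℝ) : ℝ := (Polynomial.derivative^[j] (T ℝ m)).eval ρ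

lemma hasDerivAt_casD (k : ℕ) (n : ℤ) (φ : ℝ) : HasDerivAt (casD k n) (casD (k + 1) n φ) φ := by
  induction k generalizing n with
  | zero =>
    have h : HasDerivAt (fun x : ℝ => (n : ℝ) * x) n φ := by
      simpa using (hasDerivAt_id φ).const_mul (n : ℝ)
    have := h.cos.add h.sin
    refine this.congr_deriv ?_
    simp only [casD]
    push_cast
    rw [neg_mul (n : ℝ) φ, Real.cos_neg, Real.sin_neg]
    ring
  | succ k ih => exact (ih (-n)).const_mul (n : ℝ)

lemma continuous_casD (k : ℕ) (n : ℤ) : Continuous (casD k n) :=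
  continuous_iff_continuousAt.2 fun φ => (hasDerivAt_casD k n φ).continuousAt

lemma contDiff_casD (k : ℕ) (n : ℤ) : ContDiff ℝ ((⊤ : ℕ∞) : WithTop ℕ∞) (casD k n) := by
  induction k generalizing n with
  | zero =>
    change ContDiff ℝ _ fun φ : ℝ => Real.cos (n * φ) + Real.sin (n * φ)
    fun_prop
  | succ k ih => exact contDiff_const.mul (ih (-n))

lemma casD_periodic (k : ℕ) (n : ℤ) (φ : ℝ) : casD k n (φ + 2 * Real.pi) = casD k n φ := by
  induction k generalizing n with
  | zero =>
    simp only [casD, mul_add]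
    rw [Real.cos_add_int_mul_two_pi, Real.sin_add_int_mul_two_pi]
  | succ k ih => simp only [casD, ih]

lemma abs_casD_le (k : ℕ) (n : ℤ) (φ : ℝ) : |casD k n φ| ≤ 2 * |(n : ℝ)| ^ k := by
  induction k generalizing n with
  | zero =>
    simp only [casD, pow_zero]
    have h1 := Real.abs_cos_le_one (n * φ)
    have h2 := Real.abs_sin_le_one (n * φ)
    have := abs_add_le (Real.cos (n * φ)) (Real.sin (n * φ))
    linarith
  | succ k ih =>
    simp only [casD, abs_mul]
    have := ih (-n)
    push_cast at this
    rw [abs_neg] at this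
    calc _ ≤ |(n : ℝ)| * (2 * |(n : ℝ)| ^ k) := by gcongr
      _ = _ := by ring

lemma integral_cos_int_mul {n : ℤ} (hn : n ≠ 0) :
    ∫ φ in (0 : ℝ)..(2 * Real.pi), Real.cos (n * φ) = 0 := by
  have hn' : (n : ℝ) ≠ 0 := by exact_mod_cast hn
  rw [intervalIntegral.integral_comp_mul_left _ hn', integral_cos]
  have := Real.sin_int_mul_pi (n * 2)
  push_cast at this
  simp [← mul_assoc, this]

lemma integral_sin_int_mul (n : ℤ) :
    ∫ φ in (0 : ℝ)..(2 * Real.pi), Real.sin (n * φ) = 0 := by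
  rcases eq_or_ne n 0 with rfl | hn
  · simp
  have hn' : (n : ℝ) ≠ 0 := by exact_mod_cast hn
  rw [intervalIntegral.integral_comp_mul_left _ hn', integral_sin]
  simp [Real.cos_int_mul_two_pi]

/-- The sine always integrates to zero over a period and the cosine does so unless `n = m`. This
makes the real family indexed by `ℤ` orthogonal. -/
lemma cas_mul_cas (n m : ℤ) (φ : ℝ) :
    casD 0 n φ * casD 0 m φ =
      Real.cos ((n - m : ℤ) * φ) + Real.sin ((n + m : ℤ) * φ) := by
  simp only [casD]
  push_cast
  rw [sub_mul, add_mul (n : ℝ) m φ, Real.cos_sub, Real.sin_add]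
  ring

lemma integral_cas_mul_cas (n m : ℤ) :
    ∫ φ in (0 : ℝ)..(2 * Real.pi), casD 0 n φ * casD 0 m φ =
      if n = m then 2 * Real.pi else 0 := by
  simp_rw [cas_mul_cas]
  rw [intervalIntegral.integral_add (Continuous.intervalIntegrable (by fun_prop) _ _)
    (Continuous.intervalIntegrable (by fun_prop) _ _), integral_sin_int_mul, add_zero]
  split_ifs with h
  · subst h; simp
  · exact integral_cos_int_mul (sub_ne_zero.2 h)

/-- Differentiation sends frequency `n` to a multiple of frequency `-n`, so distinct frequencies
stay distinct. -/
lemma integral_casD_mul_casD_of_ne (k : ℕ) {n m : ℤ} (h : n ≠ m) :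
    ∫ φ in (0 : ℝ)..(2 * Real.pi), casD k n φ * casD k m φ = 0 := by
  induction k generalizing n m with
  | zero => rw [integral_cas_mul_cas, if_neg h]
  | succ k ih =>
    simp only [casD]
    have : ∀ φ, (n : ℝ) * casD k (-n) φ * (m * casD k (-m) φ) =
      (n * m) * (casD k (-n) φ * casD k (-m) φ) := fun φ => by ring
    simp_rw [this]
    rw [intervalIntegral.integral_const_mul, ih (by simpa using h), mul_zero]

lemma hasDerivAt_chebD (j : ℕ) (m : ℤ) (ρ : ℝ) : HasDerivAt (chebD j m) (chebD (j + 1) m ρ) ρ := by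
  have := (Polynomial.derivative^[j] (T ℝ m)).hasDerivAt ρ
  rwa [← Function.iterate_succ_apply' (f := Polynomial.derivative)] at this

@[fun_prop]
lemma continuous_chebD (j : ℕ) (m : ℤ) : Continuous (chebD j m) :=
  (Polynomial.derivative^[j] (T ℝ m)).continuous

lemma contDiff_chebD (j : ℕ) (m : ℤ) : ContDiff ℝ ((⊤ : ℕ∞) : WithTop ℕ∞) (chebD j m) :=
  Polynomial.contDiff_aeval (Polynomial.derivative^[j] (T ℝ m)) _

lemma chebD_neg (j : ℕ) (m : ℤ) : chebD j (-m) = chebD j m := by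
  simp [chebD, funext_iff, T_neg]

lemma chebD_natAbs (j : ℕ) (m : ℤ) : chebD j (m.natAbs : ℤ) = chebD j m := by
  simp only [chebD, funext_iff, T_natAbs, implies_true]

lemma abs_chebD_zero_le (m : ℤ) {ρ : ℝ} (h : ρ ∈ Set.Icc (-1 : ℝ) 1) : |chebD 0 m ρ| ≤ 1 :=
  abs_eval_T_real_le_one m (abs_le.2 h)

/-- The derivative of `T_m` is largest in modulus at `ρ = 1`, where it equals `m²`. -/
lemma abs_chebD_one_le (m : ℤ) {ρ : ℝ} (h : ρ ∈ Set.Icc (-1 : ℝ) 1) :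
    |chebD 1 m ρ| ≤ |(m : ℝ)| ^ 2 := by
  have := abs_iterate_derivative_T_real_le m 1 (abs_le.2 h)
  simp only [Function.iterate_one, derivative_T_eval_one] at this
  simpa [chebD] using this

lemma abs_chebD_le {j : ℕ} (hj : j ≤ 1) (m : ℤ) {ρ : ℝ} (h : ρ ∈ Set.Icc (-1 : ℝ) 1) :
    |chebD j m ρ| ≤ |(m : ℝ)| ^ (2 * j) := by
  interval_cases j
  · simpa using abs_chebD_zero_le m h
  · simpa using abs_chebD_one_le m h

lemma chebD_one (m : ℤ) (ρ : ℝ) : chebD 1 m ρ = m * (U ℝ (m - 1)).eval ρ := by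
  simp [chebD, T_derivative_eq_U]

lemma integrable_measureT_of_continuous {f : ℝ → ℝ} (hf : Continuous f) : Integrable f measureT :=
  integrable_measureT hf.continuousOn

/-- Both indicators are needed because `T_{-m} = T_m`; for `n = m = 0` both equal one, which
accounts for the doubled norm of `T_0`. -/
lemma integral_chebD_mul_chebD (n m : ℤ) :
    ∫ x, chebD 0 n x * chebD 0 m x ∂measureT =
      Real.pi / 2 * ((if n = m then 1 else 0) + if n = -m then 1 else 0) := by
  have key : ∀ k : ℤ, ∫ x, (T ℝ k).eval x ∂measureT = if k = 0 then Real.pi else 0 := by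
    intro k
    split_ifs with h
    · rw [h, integral_eval_T_real_measureT_zero]
    · exact integral_eval_T_real_measureT_of_ne_zero h
  simp only [chebD, Function.iterate_zero, id]
  rw [integral_eval_T_real_mul_eval_T_real_measureT, key, key]
  simp only [sub_eq_zero, add_eq_zero_iff_eq_neg]
  split_ifs <;> ring

/-- By `U_{n+2} = 2 T_{n+2} + U_n`, the polynomial `U_n` is a combination of `T_i` with `i ≤ n`. The
same recursion gives the norm of `U_n` below, since its cross term vanishes. -/
lemma integral_T_mul_U_eq_zero (n : ℕ) : ∀ k : ℕ, n < k →
    ∫ x, (T ℝ k).eval x * (U ℝ n).eval x ∂measureT = 0 := by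
  induction n using Nat.twoStepInduction with
  | zero =>
    intro k hk
    simpa using integral_eval_T_real_measureT_of_ne_zero (n := k) (by omega)
  | one =>
    intro k hk
    have := integral_eval_T_real_mul_eval_T_real_measureT_of_ne (n := k) (m := 1) (by omega)
    simp only [Nat.cast_one, U_one, T_one, Polynomial.eval_X, Polynomial.eval_mul,
      Polynomial.eval_ofNat] at this ⊢
    simp_rw [mul_left_comm _ (2 : ℝ)]
    rw [integral_const_mul, this, mul_zero]
  | more n ih _ =>
    intro k hk
    have h1 := integral_eval_T_real_mul_eval_T_real_measureT_of_ne (n := k) (m := n + 2) (by omega)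
    have h2 := ih k (by omega)
    have : ∀ x, (T ℝ k).eval x * (U ℝ (n + 2 : ℕ)).eval x =
      2 * ((T ℝ k).eval x * (T ℝ (n + 2 : ℕ)).eval x) + (T ℝ k).eval x * (U ℝ n).eval x := by
      intro x
      push_cast
      rw [U_eq_two_mul_T_add_U]
      simp only [Polynomial.eval_add, Polynomial.eval_mul, Polynomial.eval_ofNat]
      ring
    simp_rw [this]
    rw [integral_add (integrable_measureT_of_continuous (by fun_prop))
      (integrable_measureT_of_continuous (by fun_prop)), integral_const_mul, h1, h2]
    simp

lemma integral_U_sq (n : ℕ) : ∫ x, (U ℝ n).eval x ^ 2 ∂measureT = Real.pi * (n + 1) := by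
  induction n using Nat.twoStepInduction with
  | zero =>
    have := integral_eval_T_real_measureT_zero
    simpa using this
  | one =>
    have := integral_T_real_mul_self_measureT_of_ne_zero (n := 1) one_ne_zero
    simp only [Nat.cast_one, U_one, T_one, Polynomial.eval_X, Polynomial.eval_mul,
      Polynomial.eval_ofNat] at this ⊢
    simp_rw [mul_pow, sq (_ : ℝ)]
    rw [integral_const_mul, this]
    ring
  | more n ih _ =>
    have h1 := integral_T_real_mul_self_measureT_of_ne_zero (n := n + 2) (by omega)
    have h2 := integral_T_mul_U_eq_zero n (n + 2) (by omega)
    have : ∀ x, (U ℝ (n + 2 : ℕ)).eval x ^ 2 =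
      4 * ((T ℝ (n + 2 : ℕ)).eval x * (T ℝ (n + 2 : ℕ)).eval x) +
        4 * ((T ℝ (n + 2 : ℕ)).eval x * (U ℝ n).eval x) + (U ℝ n).eval x ^ 2 := by
      intro x
      push_cast
      rw [U_eq_two_mul_T_add_U]
      simp only [Polynomial.eval_add, Polynomial.eval_mul, Polynomial.eval_ofNat]
      ring
    simp_rw [this]
    rw [integral_add (integrable_measureT_of_continuous (by fun_prop))
      (integrable_measureT_of_continuous (by fun_prop)),
      integral_add (integrable_measureT_of_continuous (by fun_prop))
      (integrable_measureT_of_continuous (by fun_prop)), integral_const_mul, integral_const_mul,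
      h1, h2, ih]
    push_cast
    ring

/-- Since `T_m' = m U_{m-1}`, the norm contributes `m² · π|m|`. The exponent three, instead of the
four that the pointwise bound `m²` would give, leaves room for summing over all large `m` at the
rate `M^{2-l}`. -/
lemma integral_chebD_one_sq (m : ℤ) :
    ∫ x, chebD 1 m x ^ 2 ∂measureT = Real.pi * |(m : ℝ)| ^ 3 := by
  rw [← chebD_natAbs, ← Int.cast_abs, ← Int.natCast_natAbs]
  generalize m.natAbs = n
  rcases n with _ | n
  · simp [chebD_one]
  · simp_rw [chebD_one, mul_pow]
    rw [integral_const_mul]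
    have := integral_U_sq n
    push_cast
    rw [add_sub_cancel_right, this]
    ring

lemma integral_chebD_sq_le {j : ℕ} (hj : j ≤ 1) (m : ℤ) :
    ∫ x, chebD j m x ^ 2 ∂measureT ≤ Real.pi * (1 + |(m : ℝ)|) ^ (3 * j) := by
  interval_cases j
  · simp_rw [sq]
    rw [integral_chebD_mul_chebD]
    have := Real.pi_pos
    simp only [mul_zero, pow_zero, mul_one]
    split_ifs <;> linarith
  · rw [integral_chebD_one_sq]
    have := Real.pi_pos
    gcongr
    simp

end

/-! ### The weighted measure, the double basis and Bessel's inequality. -/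

section

open Polynomial.Chebyshev MeasureTheory

instance isFiniteMeasure_measureT : IsFiniteMeasure measureT :=
  (integrable_const_iff_isFiniteMeasure (one_ne_zero (α := ℝ))).1
    (integrable_measureT continuousOn_const)

/-- The Fourier–Chebyshev measure `ω dρ dφ` on `Ω'`. -/
def fcMeasure : Measure (ℝ × ℝ) :=
  measureT.prod (volume.restrict (Set.Ioo 0 (2 * Real.pi)))

instance isFiniteMeasure_fcMeasure : IsFiniteMeasure fcMeasure := by
  unfold fcMeasure; infer_instance

lemma measurable_chebWeight : Measurable chebWeight := by
  unfold chebWeight; fun_prop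

lemma measurableSet_Dom : MeasurableSet Dom := measurableSet_Ioo.prod measurableSet_Ioo

lemma volume_restrict_Dom : (volume : Measure (ℝ × ℝ)).restrict Dom =
    (volume.restrict (Set.Ioo (-1) 1)).prod (volume.restrict (Set.Ioo 0 (2 * Real.pi))) := by
  rw [Measure.prod_restrict]; rfl

lemma measureT_eq : measureT =
    (volume.restrict (Set.Ioo (-1) 1)).withDensity fun ρ => ENNReal.ofReal (chebWeight ρ) := by
  rw [measureT, restrict_withDensity measurableSet_Ioc,
    Measure.restrict_congr_set Ioo_ae_eq_Ioc.symm]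
  congr 1
  ext ρ
  rw [ENNReal.ofReal]
  congr 1
  ext
  simp [chebWeight, Real.sqrt_nonneg]

lemma fcMeasure_eq : fcMeasure =
    (volume.restrict Dom).withDensity fun x => ENNReal.ofReal (chebWeight x.1) := by
  rw [fcMeasure, measureT_eq, volume_restrict_Dom,
    prod_withDensity_left (measurable_chebWeight.ennreal_ofReal)]

lemma lintegral_fcMeasure (F : ℝ × ℝ → ℝ≥0∞) :
    ∫⁻ x, F x ∂fcMeasure = ∫⁻ x in Dom, F x * ENNReal.ofReal (chebWeight x.1) := by
  rw [fcMeasure_eq, lintegral_withDensity_eq_lintegral_mul_non_measurable]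
  · simp only [Pi.mul_apply, mul_comm]
  · exact (measurable_chebWeight.comp measurable_fst).ennreal_ofReal
  · simp

lemma chebWeight_nonneg (ρ : ℝ) : 0 ≤ chebWeight ρ := by unfold chebWeight; positivity

lemma integral_fcMeasure (f : ℝ × ℝ → ℝ) :
    ∫ x, f x ∂fcMeasure = ∫ x in Dom, f x * chebWeight x.1 := by
  rw [fcMeasure_eq, integral_withDensity_eq_integral_toReal_smul]
  · simp [ENNReal.toReal_ofReal, chebWeight_nonneg, mul_comm]
  · exact (measurable_chebWeight.comp measurable_fst).ennreal_ofReal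
  · simp

lemma ae_mem_Dom : ∀ᵐ x ∂fcMeasure, x ∈ Dom := by
  rw [fcMeasure_eq]
  exact (withDensity_absolutelyContinuous _ _).ae_le (ae_restrict_mem measurableSet_Dom)

lemma aestronglyMeasurable_fcMeasure {g : ℝ × ℝ → ℝ} (hg : IntegrableOn g Dom) :
    AEStronglyMeasurable g fcMeasure := by
  rw [fcMeasure_eq]
  exact hg.1.mono_ac (withDensity_absolutelyContinuous _ _)

lemma Dom_subset_DomBar : Dom ⊆ DomBar :=
  Set.prod_mono Set.Ioo_subset_Icc_self Set.Ioo_subset_Icc_self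

lemma fst_mem_Icc {x : ℝ × ℝ} (hx : x ∈ Dom) : x.1 ∈ Set.Icc (-1 : ℝ) 1 :=
  (Dom_subset_DomBar hx).1

lemma isCompact_DomBar : IsCompact DomBar := isCompact_Icc.prod isCompact_Icc

lemma memLp_fcMeasure_of_continuousOn {f : ℝ × ℝ → ℝ} (hf : ContinuousOn f DomBar)
    (p : ℝ≥0∞) : MemLp f p fcMeasure := by
  obtain ⟨C, hC⟩ := isCompact_DomBar.exists_bound_of_continuousOn hf
  refine MemLp.of_bound ?_ C ?_
  · rw [fcMeasure_eq]
    exact ((hf.mono Dom_subset_DomBar).aestronglyMeasurable measurableSet_Dom).mono_ac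
      (withDensity_absolutelyContinuous _ _)
  · filter_upwards [ae_mem_Dom] with x hx using hC x (Dom_subset_DomBar hx)

lemma integrable_fcMeasure_of_continuousOn {f : ℝ × ℝ → ℝ} (hf : ContinuousOn f DomBar) :
    Integrable f fcMeasure :=
  memLp_one_iff_integrable.1 (memLp_fcMeasure_of_continuousOn hf 1)

/-- The bound for a linear combination of functions that are orthogonal across the fibres of
`π`, by the Cauchy–Schwarz inequality in each fibre. -/
lemma integral_sum_sq_le {X A B : Type*} [MeasurableSpace X] {ν : Measure X} [DecidableEq B]
    (F : Finset A) (e : A → X → ℝ) (p w : A → ℝ) (π : A → B) {K : ℝ}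
    (hint : ∀ a b, Integrable (fun x => e a x * e b x) ν)
    (horth : ∀ a b, π a ≠ π b → ∫ x, e a x * e b x ∂ν = 0)
    (hw : ∀ a, 0 < w a)
    (hK : ∀ β, ∑ a ∈ F with π a = β, (∫ x, e a x ^ 2 ∂ν) / w a ^ 2 ≤ K) :
    ∫ x, (∑ a ∈ F, p a * e a x) ^ 2 ∂ν ≤ K * ∑ a ∈ F, (w a * p a) ^ 2 := by
  set G : B → X → ℝ := fun β x => ∑ a ∈ F with π a = β, p a * e a x with hG
  have hGG : ∀ β γ x, G β x * G γ x = ∑ a ∈ F with π a = β, ∑ b ∈ F with π b = γ,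
      (p a * p b) * (e a x * e b x) := by
    intro β γ x
    simp only [hG, Finset.sum_mul_sum]
    exact Finset.sum_congr rfl fun a _ => Finset.sum_congr rfl fun b _ => by ring
  have hGint : ∀ β γ, Integrable (fun x => G β x * G γ x) ν := by
    intro β γ
    simp_rw [hGG]
    exact integrable_finsetSum _ fun a _ => integrable_finsetSum _ fun b _ =>
      (hint a b).const_mul _
  have hGorth : ∀ β γ, β ≠ γ → ∫ x, G β x * G γ x ∂ν = 0 := by
    intro β γ hne
    simp_rw [hGG]
    rw [integral_finsetSum _ fun a _ => integrable_finsetSum _ fun b _ =>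
      (hint a b).const_mul _]
    refine Finset.sum_eq_zero fun a ha => ?_
    rw [integral_finsetSum _ fun b _ => (hint a b).const_mul _]
    refine Finset.sum_eq_zero fun b hb => ?_
    rw [integral_const_mul, horth a b, mul_zero]
    rw [(Finset.mem_filter.1 ha).2, (Finset.mem_filter.1 hb).2]
    exact hne
  have hsum : ∀ x, ∑ a ∈ F, p a * e a x = ∑ β ∈ F.image π, G β x := fun x =>
    (Finset.sum_fiberwise_of_maps_to (fun a ha => Finset.mem_image_of_mem π ha) _).symm
  have hfib : ∀ β, ∫ x, G β x * G β x ∂ν ≤ K * ∑ a ∈ F with π a = β, (w a * p a) ^ 2 := by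
    intro β
    -- Cauchy–Schwarz for the factorisation `p e = (w p)(e / w)`.
    have hpt : ∀ x, G β x * G β x ≤
        (∑ a ∈ F with π a = β, (w a * p a) ^ 2) *
          ∑ a ∈ F with π a = β, (e a x * e a x) * (1 / w a ^ 2) := by
      intro x
      have := Finset.sum_mul_sq_le_sq_mul_sq (F.filter (π · = β)) (fun a => w a * p a)
        (fun a => e a x / w a)
      have h1 : ∑ a ∈ F with π a = β, w a * p a * (e a x / w a) = G β x :=
        Finset.sum_congr rfl fun a _ => by have := (hw a).ne'; field_simp
      have h2 : ∑ a ∈ F with π a = β, (e a x / w a) ^ 2 =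
          ∑ a ∈ F with π a = β, (e a x * e a x) * (1 / w a ^ 2) :=
        Finset.sum_congr rfl fun a _ => by ring
      rwa [h1, h2, sq] at this
    refine (integral_mono (hGint β β) ((integrable_finsetSum _ fun a _ =>
      (hint a a).mul_const _).const_mul _) hpt).trans ?_
    rw [integral_const_mul, integral_finsetSum _ fun a _ => (hint a a).mul_const _, mul_comm]
    refine mul_le_mul_of_nonneg_right ?_ (by positivity)
    refine le_trans (le_of_eq ?_) (hK β)
    refine Finset.sum_congr rfl fun a _ => ?_
    rw [integral_mul_const]
    simp_rw [sq]
    ring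
  calc ∫ x, (∑ a ∈ F, p a * e a x) ^ 2 ∂ν
      = ∫ x, ∑ β ∈ F.image π, ∑ γ ∈ F.image π, G β x * G γ x ∂ν := by
        refine integral_congr_ae (.of_forall fun x => ?_)
        simp only [hsum, sq, Finset.sum_mul_sum]
    _ = ∑ β ∈ F.image π, ∑ γ ∈ F.image π, ∫ x, G β x * G γ x ∂ν := by
        rw [integral_finsetSum _ fun β _ => integrable_finsetSum _ fun γ _ => hGint β γ]
        exact Finset.sum_congr rfl fun β _ => integral_finsetSum _ fun γ _ => hGint β γ
    _ = ∑ β ∈ F.image π, ∫ x, G β x * G β x ∂ν := by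
        refine Finset.sum_congr rfl fun β hβ => Finset.sum_eq_single_of_mem β hβ ?_
        exact fun γ _ hne => hGorth β γ hne.symm
    _ ≤ ∑ β ∈ F.image π, K * ∑ a ∈ F with π a = β, (w a * p a) ^ 2 :=
        Finset.sum_le_sum fun β _ => hfib β
    _ = K * ∑ a ∈ F, (w a * p a) ^ 2 := by
        rw [← Finset.mul_sum,
          Finset.sum_fiberwise_of_maps_to (fun a ha => Finset.mem_image_of_mem π ha)]

/-- The double Chebyshev–Hartley basis. -/
def fcBasis (a : ℤ × ℤ) (x : ℝ × ℝ) : ℝ := chebD 0 a.1 x.1 * casD 0 a.2 x.2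

/-- The (unnormalized) double Chebyshev–Hartley coefficients. -/
def fcCoeff (g : ℝ × ℝ → ℝ) (a : ℤ × ℤ) : ℝ := ∫ x, g x * fcBasis a x ∂fcMeasure

lemma continuous_fcBasis (a : ℤ × ℤ) : Continuous (fcBasis a) :=
  ((continuous_chebD 0 a.1).comp continuous_fst).mul
    ((continuous_casD 0 a.2).comp continuous_snd)

lemma abs_fcBasis_le (a : ℤ × ℤ) {x : ℝ × ℝ} (hx : x.1 ∈ Set.Icc (-1 : ℝ) 1) :
    |fcBasis a x| ≤ 2 := by
  rw [fcBasis, abs_mul]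
  have h1 := abs_chebD_zero_le a.1 hx
  have h2 := abs_casD_le 0 a.2 x.2
  rw [pow_zero, mul_one] at h2
  nlinarith [abs_nonneg (chebD 0 a.1 x.1), abs_nonneg (casD 0 a.2 x.2)]

lemma integral_fcMeasure_prod (f g : ℝ → ℝ) : ∫ x : ℝ × ℝ, f x.1 * g x.2 ∂fcMeasure =
    (∫ ρ, f ρ ∂measureT) * ∫ φ in (0 : ℝ)..(2 * Real.pi), g φ := by
  rw [intervalIntegral.integral_of_le (by positivity), integral_Ioc_eq_integral_Ioo, fcMeasure,
    integral_prod_mul]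

/-- Each function with `a.1 ≠ 0` is listed twice, so `a` pairs with `b` and with the reflection of
`b` in the first index. -/
lemma integral_fcBasis_mul (a b : ℤ × ℤ) : ∫ x, fcBasis a x * fcBasis b x ∂fcMeasure =
    Real.pi ^ 2 * ((if a = b then 1 else 0) + if a = (-b.1, b.2) then 1 else 0) := by
  have : ∀ x : ℝ × ℝ, fcBasis a x * fcBasis b x =
      (fun ρ => chebD 0 a.1 ρ * chebD 0 b.1 ρ) x.1 *
        (fun φ => casD 0 a.2 φ * casD 0 b.2 φ) x.2 := fun x => by simp only [fcBasis]; ring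
  rw [integral_congr_ae (.of_forall this), integral_fcMeasure_prod
    (fun ρ => chebD 0 a.1 ρ * chebD 0 b.1 ρ) (fun φ => casD 0 a.2 φ * casD 0 b.2 φ), integral_cas_mul_cas, integral_chebD_mul_chebD]
  obtain ⟨a1, a2⟩ := a
  obtain ⟨b1, b2⟩ := b
  simp only [Prod.mk.injEq]
  by_cases h1 : a1 = b1 <;> by_cases h2 : a2 = b2 <;> by_cases h3 : a1 = -b1 <;>
    simp [h1, h2, h3] <;> ring

lemma integrable_fcBasis_mul (a b : ℤ × ℤ) :
    Integrable (fun x => fcBasis a x * fcBasis b x) fcMeasure :=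
  integrable_fcMeasure_of_continuousOn
    ((continuous_fcBasis a).mul (continuous_fcBasis b)).continuousOn

lemma integrable_mul_fcBasis {g : ℝ × ℝ → ℝ} (hg : Integrable g fcMeasure) (a : ℤ × ℤ) :
    Integrable (fun x => g x * fcBasis a x) fcMeasure := by
  refine hg.mul_bdd (c := 2) (continuous_fcBasis a).aestronglyMeasurable ?_
  filter_upwards [ae_mem_Dom] with x hx using abs_fcBasis_le a (fst_mem_Icc hx)

/-- Since the family repeats functions, the bound is obtained by duality: the combination `h` of the
basis with coefficients `fcCoeff g a` satisfies `∫ g h = ∑ c²` and `∫ h² ≤ K ∑ c²`, and it remains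
to expand `0 ≤ ∫ (K g - h)²`. -/
lemma sum_fcCoeff_sq_le {g : ℝ × ℝ → ℝ} (hg : MemLp g 2 fcMeasure) (F : Finset (ℤ × ℤ)) :
    ∑ a ∈ F, fcCoeff g a ^ 2 ≤ (4 * Real.pi ^ 2) * ∫ x, g x ^ 2 ∂fcMeasure := by
  have hpi := Real.pi_pos
  -- A fibre `±m` has at most two elements, each of squared norm at most `2π²`.
  set K : ℝ := 4 * Real.pi ^ 2
  have hK0 : 0 < K := by positivity
  have hg1 : Integrable g fcMeasure := hg.integrable (by norm_num)
  set h : ℝ × ℝ → ℝ := fun x => ∑ a ∈ F, fcCoeff g a * fcBasis a x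
  have hh : ContinuousOn h DomBar :=
    (continuous_finsetSum _ fun a _ => continuous_const.mul (continuous_fcBasis a)).continuousOn
  have hb : ∫ x, h x ^ 2 ∂fcMeasure ≤ K * ∑ a ∈ F, (1 * fcCoeff g a) ^ 2 := by
    refine integral_sum_sq_le F fcBasis (fcCoeff g) (fun _ => 1)
      (fun a => (a.1.natAbs, a.2)) integrable_fcBasis_mul ?_ (fun _ => one_pos) ?_
    · intro a b hab
      rw [integral_fcBasis_mul, if_neg, if_neg]
      · simp
      · rintro rfl; simp at hab
      · rintro rfl; simp at hab
    · intro β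
      have hcard : (F.filter fun a => (a.1.natAbs, a.2) = β).card ≤ 2 := by
        refine (Finset.card_le_card (t := {((β.1 : ℤ), β.2), (-(β.1 : ℤ), β.2)}) ?_).trans
          Finset.card_le_two
        intro a ha
        obtain ⟨-, rfl⟩ := Finset.mem_filter.1 ha
        obtain ⟨a1, a2⟩ := a
        simp only [Finset.mem_insert, Finset.mem_singleton, Prod.mk.injEq, and_true]
        omega
      calc _ ≤ ∑ a ∈ F with (a.1.natAbs, a.2) = β, 2 * Real.pi ^ 2 := by
            refine Finset.sum_le_sum fun a _ => ?_
            simp_rw [sq (fcBasis a _)]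
            rw [integral_fcBasis_mul]
            simp only [one_pow, div_one, if_true]
            split_ifs <;> nlinarith
        _ ≤ 2 * (2 * Real.pi ^ 2) := by
            rw [Finset.sum_const, nsmul_eq_mul]
            gcongr
            exact_mod_cast hcard
        _ = K := by ring
  have hgh : ∫ x, g x * h x ∂fcMeasure = ∑ a ∈ F, fcCoeff g a ^ 2 := by
    have : ∀ x, g x * h x = ∑ a ∈ F, fcCoeff g a * (g x * fcBasis a x) := fun x => by
      simp only [h, Finset.mul_sum]
      exact Finset.sum_congr rfl fun a _ => by ring
    simp_rw [this]
    rw [integral_finsetSum _ fun a _ => (integrable_mul_fcBasis hg1 a).const_mul _]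
    refine Finset.sum_congr rfl fun a _ => ?_
    rw [integral_const_mul, sq]; rfl
  have hg2 : Integrable (fun x => g x ^ 2) fcMeasure := hg.integrable_sq
  have hh2 : Integrable (fun x => h x ^ 2) fcMeasure :=
    (memLp_fcMeasure_of_continuousOn hh 2).integrable_sq
  have hghi : Integrable (fun x => g x * h x) fcMeasure :=
    hg.integrable_mul (memLp_fcMeasure_of_continuousOn hh 2)
  have hpos : 0 ≤ ∫ x, (K * g x - h x) ^ 2 ∂fcMeasure := integral_nonneg fun x => sq_nonneg _
  have hexp : ∫ x, (K * g x - h x) ^ 2 ∂fcMeasure =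
      K ^ 2 * ∫ x, g x ^ 2 ∂fcMeasure - 2 * K * ∫ x, g x * h x ∂fcMeasure +
        ∫ x, h x ^ 2 ∂fcMeasure := by
    have h3 : ∀ x, (K * g x - h x) ^ 2 = K ^ 2 * g x ^ 2 - 2 * K * (g x * h x) + h x ^ 2 :=
      fun x => by ring
    simp_rw [h3]
    rw [integral_add (f := fun x => K ^ 2 * g x ^ 2 - 2 * K * (g x * h x))
      ((hg2.const_mul _).sub (hghi.const_mul _)) hh2, integral_sub (hg2.const_mul _)
      (hghi.const_mul _), integral_const_mul, integral_const_mul]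
  rw [hexp, hgh] at hpos
  simp only [one_mul] at hb
  have : 0 ≤ K * (K * ∫ x, g x ^ 2 ∂fcMeasure - ∑ a ∈ F, fcCoeff g a ^ 2) := by linarith
  linarith [nonneg_of_mul_nonneg_right this hK0]

/-- Bessel's inequality. -/
lemma tsum_fcCoeff_sq_le {g : ℝ × ℝ → ℝ} (hg : MemLp g 2 fcMeasure) :
    ∑' a, ENNReal.ofReal (fcCoeff g a ^ 2) ≤
      ENNReal.ofReal (4 * Real.pi ^ 2) * ∫⁻ x, ‖g x‖ₑ ^ 2 ∂fcMeasure := by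
  have h1 : ∫⁻ x, ‖g x‖ₑ ^ 2 ∂fcMeasure = ENNReal.ofReal (∫ x, g x ^ 2 ∂fcMeasure) := by
    rw [ofReal_integral_eq_lintegral_ofReal hg.integrable_sq (.of_forall fun x => sq_nonneg _)]
    refine lintegral_congr fun x => ?_
    rw [← ofReal_norm, ← ENNReal.ofReal_pow (norm_nonneg _), Real.norm_eq_abs, sq_abs]
  rw [h1, ← ENNReal.ofReal_mul (by positivity)]
  rw [ENNReal.tsum_eq_iSup_sum]
  refine iSup_le fun F => ?_
  rw [← ENNReal.ofReal_sum_of_nonneg fun a _ => sq_nonneg _]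
  exact ENNReal.ofReal_le_ofReal (sum_fcCoeff_sq_le hg F)

end

/-! ### Weak derivatives and the coefficients. -/

section

open Polynomial.Chebyshev MeasureTheory Filter Topology

/-- A smooth function of `ρ` that vanishes outside a compact part of `(-1,1)`. -/
def IsCut (χ : ℝ → ℝ) : Prop :=
  ContDiff ℝ ((⊤ : ℕ∞) : WithTop ℕ∞) χ ∧ ∃ a : ℝ, a < 1 ∧ ∀ ρ, a ≤ |ρ| → χ ρ = 0

lemma IsCut.deriv {χ : ℝ → ℝ} (h : IsCut χ) : IsCut (deriv χ) := by
  obtain ⟨h1, a, ha, h2⟩ := h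
  refine ⟨(contDiff_infty_iff_deriv.1 h1).2, (a + 1) / 2, by linarith, fun ρ hρ => ?_⟩
  have hlt : a < |ρ| := by linarith
  have : χ =ᶠ[𝓝 ρ] fun _ => 0 := by
    filter_upwards [continuous_abs.continuousAt.eventually (lt_mem_nhds hlt)] with x hx
    exact h2 x hx.le
  rw [this.deriv_eq, deriv_const]

lemma IsCut.isTestFun {χ : ℝ → ℝ} (h : IsCut χ) (k : ℕ) (n : ℤ) :
    IsTestFun fun x => χ x.1 * casD k n x.2 := by
  obtain ⟨h1, a, ha, h2⟩ := h
  refine ⟨(h1.comp contDiff_fst).mul ((contDiff_casD k n).comp contDiff_snd), ?_, a, ha, ?_⟩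
  · intro ρ φ
    simp only [casD_periodic]
  · intro ρ φ hρ
    simp only [h2 ρ hρ, zero_mul]

lemma mixedDeriv_mul (j k : ℕ) (χ ψ : ℝ → ℝ) (x : ℝ × ℝ) :
    mixedDeriv j k (fun x => χ x.1 * ψ x.2) x =
      iteratedDeriv j χ x.1 * iteratedDeriv k ψ x.2 := by
  simp only [mixedDeriv]
  have : ∀ ρ, iteratedDeriv k (fun φ => χ ρ * ψ φ) x.2 = χ ρ * iteratedDeriv k ψ x.2 :=
    fun ρ => by rw [iteratedDeriv_const_mul_field]
  simp_rw [this]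
  simp_rw [mul_comm (χ _)]
  rw [iteratedDeriv_const_mul_field, mul_comm]

lemma weakDeriv_step_fst {j k : ℕ} {P g g' : ℝ × ℝ → ℝ} (h : IsWeakDeriv j k P g)
    (h' : IsWeakDeriv (j + 1) k P g') {χ : ℝ → ℝ} (hχ : IsCut χ) (n : ℤ) :
    ∫ x in Dom, g x * (deriv χ x.1 * casD 0 n x.2) =
      -∫ x in Dom, g' x * (χ x.1 * casD 0 n x.2) := by
  have h1 := h.2.2 _ (hχ.deriv.isTestFun 0 n)
  have h2 := h'.2.2 _ (hχ.isTestFun 0 n)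
  simp only [mixedDeriv_mul] at h1 h2
  rw [iteratedDeriv_succ', h1] at h2
  have h3 : ((-1 : ℝ) ^ (j + k)) ≠ 0 := by positivity
  apply mul_left_cancel₀ h3
  rw [h2]
  ring

lemma weakDeriv_step_snd {j k : ℕ} {P g g' : ℝ × ℝ → ℝ} (h : IsWeakDeriv j k P g)
    (h' : IsWeakDeriv j (k + 1) P g') {χ : ℝ → ℝ} (hχ : IsCut χ) (n : ℤ) :
    ∫ x in Dom, g x * (χ x.1 * casD 1 n x.2) =
      -∫ x in Dom, g' x * (χ x.1 * casD 0 n x.2) := by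
  have h1 := h.2.2 _ (hχ.isTestFun 1 n)
  have h2 := h'.2.2 _ (hχ.isTestFun 0 n)
  simp only [mixedDeriv_mul] at h1 h2
  have hd : deriv (casD 0 n) = casD 1 n := funext fun φ => (hasDerivAt_casD 0 n φ).deriv
  rw [iteratedDeriv_succ', hd, h1] at h2
  have h3 : ((-1 : ℝ) ^ (j + k)) ≠ 0 := by positivity
  apply mul_left_cancel₀ h3
  rw [h2]
  ring

/-- Smooth cut-off functions of `ρ` that increase to `1` on `(-1,1)`. -/
def cutoff (i : ℕ) (ρ : ℝ) : ℝ := Real.smoothTransition ((i + 2) * (1 - ρ ^ 2) - 1)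

lemma contDiff_cutoff (i : ℕ) : ContDiff ℝ ((⊤ : ℕ∞) : WithTop ℕ∞) (cutoff i) :=
  Real.smoothTransition.contDiff.comp (by fun_prop)

lemma abs_cutoff_le (i : ℕ) (ρ : ℝ) : |cutoff i ρ| ≤ 1 := by
  rw [cutoff, abs_of_nonneg (Real.smoothTransition.nonneg _)]
  exact Real.smoothTransition.le_one _

lemma eventually_two_le {ρ : ℝ} (hρ : ρ ∈ Set.Ioo (-1 : ℝ) 1) :
    ∀ᶠ i : ℕ in atTop, 2 < ((i : ℝ) + 2) * (1 - ρ ^ 2) := by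
  have h0 : 0 < 1 - ρ ^ 2 := by nlinarith [hρ.1, hρ.2]
  have : Tendsto (fun i : ℕ => ((i : ℝ) + 2) * (1 - ρ ^ 2)) atTop atTop :=
    (tendsto_atTop_add_const_right _ _ tendsto_natCast_atTop_atTop).atTop_mul_const h0
  exact this.eventually_gt_atTop 2

lemma tendsto_cutoff {ρ : ℝ} (hρ : ρ ∈ Set.Ioo (-1 : ℝ) 1) :
    Tendsto (fun i => cutoff i ρ) atTop (𝓝 1) := by
  refine tendsto_const_nhds.congr' ?_
  filter_upwards [eventually_two_le hρ] with i hi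
  exact (Real.smoothTransition.one_of_one_le (by linarith)).symm

lemma isCut_cutoff_mul (i : ℕ) {h : ℝ → ℝ}
    (hh : ContDiffOn ℝ ((⊤ : ℕ∞) : WithTop ℕ∞) h (Set.Ioo (-1) 1)) :
    IsCut fun ρ => cutoff i ρ * h ρ := by
  have hi : (0 : ℝ) < i + 2 := by positivity
  constructor
  · rw [contDiff_iff_contDiffAt]
    intro ρ
    by_cases hρ : ρ ∈ Set.Ioo (-1 : ℝ) 1
    · exact (contDiff_cutoff i).contDiffAt.mul (hh.contDiffAt (isOpen_Ioo.mem_nhds hρ))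
    -- Near such a point the cut-off vanishes identically, so the behaviour of `h` there is
    -- irrelevant.
    · have h1 : 1 - ρ ^ 2 ≤ 0 := by
        by_contra hc
        exact hρ ⟨by nlinarith, by nlinarith⟩
      have h2 : ((i : ℝ) + 2) * (1 - ρ ^ 2) < 1 := by nlinarith
      have hc : Continuous fun x : ℝ => ((i : ℝ) + 2) * (1 - x ^ 2) := by fun_prop
      have : (fun ρ => cutoff i ρ * h ρ) =ᶠ[𝓝 ρ] fun _ => 0 := by
        filter_upwards [hc.continuousAt.eventually (gt_mem_nhds h2)] with x hx
        rw [cutoff, Real.smoothTransition.zero_of_nonpos (by linarith), zero_mul]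
      exact contDiffAt_const.congr_of_eventuallyEq this
  · have hpos : 0 < 1 / ((i : ℝ) + 2) := by positivity
    refine ⟨Real.sqrt (1 - 1 / (i + 2)), ?_, fun ρ hρ => ?_⟩
    · rw [Real.sqrt_lt' one_pos]; linarith
    · have h1 := (Real.sqrt_le_left (abs_nonneg ρ)).1 hρ
      rw [sq_abs] at h1
      have h2 : ((i : ℝ) + 2) * (1 - ρ ^ 2) ≤ ((i : ℝ) + 2) * (1 / (i + 2)) := by
        gcongr; linarith
      rw [mul_one_div_cancel hi.ne'] at h2
      change cutoff i ρ * h ρ = 0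
      rw [cutoff, Real.smoothTransition.zero_of_nonpos (by linarith), zero_mul]

lemma deriv_smoothTransition_eq_zero {t : ℝ} (ht : t ∉ Set.Icc (0 : ℝ) 1) :
    deriv Real.smoothTransition t = 0 := by
  rw [Set.mem_Icc, not_and_or, not_le, not_le] at ht
  rcases ht with ht | ht
  · have : Real.smoothTransition =ᶠ[𝓝 t] fun _ => 0 := by
      filter_upwards [gt_mem_nhds ht] with x hx
      exact Real.smoothTransition.zero_of_nonpos hx.le
    rw [this.deriv_eq, deriv_const]
  · have : Real.smoothTransition =ᶠ[𝓝 t] fun _ => 1 := by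
      filter_upwards [lt_mem_nhds ht] with x hx
      exact Real.smoothTransition.one_of_one_le hx.le
    rw [this.deriv_eq, deriv_const]

lemma exists_bound_deriv_smoothTransition :
    ∃ B, ∀ t, |deriv Real.smoothTransition t * (t + 1)| ≤ B := by
  have hc : Continuous (deriv Real.smoothTransition) :=
    (Real.smoothTransition.contDiff (n := 1)).continuous_deriv le_rfl
  obtain ⟨B, hB⟩ := isCompact_Icc (a := (0 : ℝ)) (b := 1) |>.exists_bound_of_continuousOn
    (f := fun t => deriv Real.smoothTransition t * (t + 1)) (by fun_prop)
  refine ⟨max B 0, fun t => ?_⟩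
  by_cases ht : t ∈ Set.Icc (0 : ℝ) 1
  · exact (hB t ht).trans (le_max_left _ _)
  · rw [deriv_smoothTransition_eq_zero ht]; simp

/-- The weighted derivative `(1 - ρ²) (d/dρ) cutoff i ρ`. -/
def cutoffD (i : ℕ) (ρ : ℝ) : ℝ :=
  deriv Real.smoothTransition ((i + 2) * (1 - ρ ^ 2) - 1) *
    (((i + 2) * (1 - ρ ^ 2) - 1) + 1) * (-2 * ρ)

lemma continuous_cutoffD (i : ℕ) : Continuous (cutoffD i) := by
  have hc : Continuous (deriv Real.smoothTransition) :=
    (Real.smoothTransition.contDiff (n := 1)).continuous_deriv le_rfl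
  unfold cutoffD
  fun_prop

/-- The slope of `cutoff i` grows with `i`, but only where `(i+2)(1 - ρ²)` lies between 1 and 2; the
factor `1 - ρ²` compensates uniformly in `i`. -/
lemma exists_bound_cutoffD : ∃ B, ∀ i, ∀ ρ ∈ Set.Icc (-1 : ℝ) 1, |cutoffD i ρ| ≤ B := by
  obtain ⟨B, hB⟩ := exists_bound_deriv_smoothTransition
  refine ⟨B * 2, fun i ρ hρ => ?_⟩
  rw [cutoffD, abs_mul]
  refine mul_le_mul (hB _) ?_ (abs_nonneg _) ((abs_nonneg _).trans (hB 0))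
  rw [abs_mul, abs_neg, abs_two]
  linarith [abs_le.2 hρ]

lemma tendsto_cutoffD {ρ : ℝ} (hρ : ρ ∈ Set.Ioo (-1 : ℝ) 1) :
    Tendsto (fun i => cutoffD i ρ) atTop (𝓝 0) := by
  refine tendsto_const_nhds.congr' ?_
  filter_upwards [eventually_two_le hρ] with i hi
  rw [cutoffD, deriv_smoothTransition_eq_zero]
  · simp
  · intro h; linarith [h.2]

lemma deriv_cutoff_mul (i : ℕ) (ρ : ℝ) :
    HasDerivAt (cutoff i) (deriv Real.smoothTransition ((i + 2) * (1 - ρ ^ 2) - 1) *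
      ((i + 2) * (-2 * ρ))) ρ := by
  have h1 : HasDerivAt Real.smoothTransition
      (deriv Real.smoothTransition ((i + 2) * (1 - ρ ^ 2) - 1)) ((i + 2) * (1 - ρ ^ 2) - 1) :=
    ((Real.smoothTransition.contDiff (n := 1)).differentiable one_ne_zero _).hasDerivAt
  have h2 : HasDerivAt (fun ρ : ℝ => ((i : ℝ) + 2) * (1 - ρ ^ 2) - 1)
      ((i + 2) * (-2 * ρ)) ρ := by
    have := (((hasDerivAt_pow 2 ρ).const_sub 1).const_mul ((i : ℝ) + 2)).sub_const 1
    refine this.congr_deriv ?_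
    simp
  exact h1.comp ρ h2

lemma tendsto_integral_cutoff {f : ℝ × ℝ → ℝ} (hf : Integrable f fcMeasure) :
    Tendsto (fun i : ℕ => ∫ x, cutoff i x.1 * f x ∂fcMeasure) atTop
      (𝓝 (∫ x, f x ∂fcMeasure)) := by
  refine tendsto_integral_of_dominated_convergence (fun x => |f x|) (fun i => ?_) hf.abs
    (fun i => .of_forall fun x => ?_) ?_
  · exact ((contDiff_cutoff i).continuous.comp continuous_fst).aestronglyMeasurable.mul hf.1
  · rw [norm_mul]
    exact mul_le_of_le_one_left (norm_nonneg _) (abs_cutoff_le i x.1)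
  · filter_upwards [ae_mem_Dom] with x hx
    simpa using (tendsto_cutoff hx.1).mul_const (f x)

lemma tendsto_integral_cutoffD {f : ℝ × ℝ → ℝ} (hf : Integrable f fcMeasure) :
    Tendsto (fun i : ℕ => ∫ x, cutoffD i x.1 * f x ∂fcMeasure) atTop (𝓝 0) := by
  obtain ⟨B, hB⟩ := exists_bound_cutoffD
  have : Tendsto (fun i : ℕ => ∫ x, cutoffD i x.1 * f x ∂fcMeasure) atTop
      (𝓝 (∫ x : ℝ × ℝ, (0 : ℝ) ∂fcMeasure)) := by
    refine tendsto_integral_of_dominated_convergence (fun x => B * |f x|) (fun i => ?_)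
      (hf.abs.const_mul B) (fun i => ?_) ?_
    · exact ((continuous_cutoffD i).comp continuous_fst).aestronglyMeasurable.mul hf.1
    · filter_upwards [ae_mem_Dom] with x hx
      rw [norm_mul]
      exact mul_le_mul_of_nonneg_right (hB i _ (fst_mem_Icc hx)) (norm_nonneg _)
    · filter_upwards [ae_mem_Dom] with x hx
      simpa using (tendsto_cutoffD hx.1).mul_const (f x)
  simpa using this

lemma one_sub_sq_pos {ρ : ℝ} (hρ : ρ ∈ Set.Ioo (-1 : ℝ) 1) : 0 < 1 - ρ ^ 2 := by
  nlinarith [hρ.1, hρ.2]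

lemma contDiffOn_sqrt_one_sub_sq :
    ContDiffOn ℝ ((⊤ : ℕ∞) : WithTop ℕ∞) (fun ρ : ℝ => Real.sqrt (1 - ρ ^ 2)) (Set.Ioo (-1) 1) :=
  ContDiffOn.sqrt (by fun_prop) fun _ hρ => (one_sub_sq_pos hρ).ne'

lemma contDiffOn_chebWeight :
    ContDiffOn ℝ ((⊤ : ℕ∞) : WithTop ℕ∞) chebWeight (Set.Ioo (-1) 1) :=
  contDiffOn_const.div contDiffOn_sqrt_one_sub_sq fun _ hρ =>
    (Real.sqrt_pos.2 (one_sub_sq_pos hρ)).ne'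

lemma sqrt_eq_mul_chebWeight {ρ : ℝ} (hρ : ρ ∈ Set.Ioo (-1 : ℝ) 1) :
    Real.sqrt (1 - ρ ^ 2) = (1 - ρ ^ 2) * chebWeight ρ := by
  have h := Real.sqrt_pos.2 (one_sub_sq_pos hρ)
  rw [chebWeight, mul_one_div, eq_div_iff h.ne', Real.mul_self_sqrt (one_sub_sq_pos hρ).le]

lemma integrable_mul_casD_chebD {g : ℝ × ℝ → ℝ} (hg : Integrable g fcMeasure) {f : ℝ → ℝ}
    (hf : Continuous f) (k : ℕ) (n : ℤ) :
    Integrable (fun x => g x * (f x.1 * casD k n x.2)) fcMeasure := by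
  have hc : Continuous fun x : ℝ × ℝ => f x.1 * casD k n x.2 :=
    (hf.comp continuous_fst).mul ((continuous_casD k n).comp continuous_snd)
  obtain ⟨C, hC⟩ := isCompact_DomBar.exists_bound_of_continuousOn hc.continuousOn
  refine hg.mul_bdd (c := C) hc.aestronglyMeasurable ?_
  filter_upwards [ae_mem_Dom] with x hx using hC x (Dom_subset_DomBar hx)

/-- A weak derivative of order zero is another representative of `P`. Comparing the coefficients
through cut-off test functions suffices; equality almost everywhere is never derived. -/
lemma fcCoeff_weakDeriv_zero {P g : ℝ × ℝ → ℝ} (h : IsWeakDeriv 0 0 P g)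
    (hP : Integrable P fcMeasure) (hg : Integrable g fcMeasure) : fcCoeff g = fcCoeff P := by
  ext ⟨m, n⟩
  have key : ∀ i : ℕ, ∫ x, cutoff i x.1 * (P x * fcBasis (m, n) x) ∂fcMeasure =
      ∫ x, cutoff i x.1 * (g x * fcBasis (m, n) x) ∂fcMeasure := by
    intro i
    have hcut : IsCut fun ρ => cutoff i ρ * (chebD 0 m ρ * chebWeight ρ) :=
      isCut_cutoff_mul i ((contDiff_chebD 0 m).contDiffOn.mul contDiffOn_chebWeight)
    have := h.2.2 _ (hcut.isTestFun 0 n)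
    simp only [mixedDeriv, iteratedDeriv_zero, add_zero, pow_zero, one_mul] at this
    rw [integral_fcMeasure, integral_fcMeasure]
    convert this using 3 with x x <;> simp only [fcBasis] <;> ring
  have h1 := tendsto_integral_cutoff (integrable_mul_fcBasis hP (m, n))
  have h2 := tendsto_integral_cutoff (integrable_mul_fcBasis hg (m, n))
  simp_rw [key] at h1
  exact tendsto_nhds_unique h2 h1

/-- The test function is `cutoff · T_m · ω · cas(nφ)`. The cut-off does not depend on `φ`, so it is
removed by dominated convergence without a boundary term. -/
lemma fcCoeff_weakDeriv_snd {j k : ℕ} {P g g' : ℝ × ℝ → ℝ} (h : IsWeakDeriv j k P g)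
    (h' : IsWeakDeriv j (k + 1) P g') (hg : Integrable g fcMeasure)
    (hg' : Integrable g' fcMeasure) (m n : ℤ) :
    fcCoeff g' (m, n) = -(n * fcCoeff g (m, -n)) := by
  have key : ∀ i : ℕ, ∫ x, cutoff i x.1 * (n * (g x * fcBasis (m, -n) x)) ∂fcMeasure =
      -∫ x, cutoff i x.1 * (g' x * fcBasis (m, n) x) ∂fcMeasure := by
    intro i
    have hcut : IsCut fun ρ => cutoff i ρ * (chebD 0 m ρ * chebWeight ρ) :=
      isCut_cutoff_mul i ((contDiff_chebD 0 m).contDiffOn.mul contDiffOn_chebWeight)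
    have := weakDeriv_step_snd h h' hcut n
    rw [integral_fcMeasure, integral_fcMeasure]
    convert this using 3 with x x
    · simp only [fcBasis, casD]; ring
    · ext x; simp only [fcBasis]; ring
  have h1 := tendsto_integral_cutoff ((integrable_mul_fcBasis hg (m, -n)).const_mul (n : ℝ))
  have h2 := tendsto_integral_cutoff (integrable_mul_fcBasis hg' (m, n))
  simp_rw [key] at h1
  have := tendsto_nhds_unique h1 h2.neg
  rw [integral_const_mul] at this
  rw [fcCoeff, fcCoeff, this, neg_neg]

/-- With `ρ = cos θ` the function is `sin(mθ)`, and the formula is `d/dθ sin(mθ) = m cos(mθ)`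
together with `dρ = -sin θ dθ`. -/
lemma hasDerivAt_sqrt_mul_U (m : ℤ) {ρ : ℝ} (hρ : ρ ∈ Set.Ioo (-1 : ℝ) 1) :
    HasDerivAt (fun ρ => Real.sqrt (1 - ρ ^ 2) * (U ℝ (m - 1)).eval ρ)
      (-(m * (chebD 0 m ρ * chebWeight ρ))) ρ := by
  have h0 := one_sub_sq_pos hρ
  have hs := Real.sqrt_pos.2 h0
  have h1 : HasDerivAt (fun ρ : ℝ => 1 - ρ ^ 2) (-(2 * ρ)) ρ := by
    simpa using (hasDerivAt_pow 2 ρ).const_sub 1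
  refine ((h1.sqrt h0.ne').mul ((U ℝ (m - 1)).hasDerivAt ρ)).congr_deriv ?_
  have h2 := congrArg (Polynomial.eval ρ) (add_one_mul_T_eq_poly_in_U (R := ℝ) (m - 1))
  simp only [Polynomial.eval_mul, Polynomial.eval_sub, Polynomial.eval_add, Polynomial.eval_one,
    Polynomial.eval_pow, Polynomial.eval_X, Polynomial.eval_intCast, sub_add_cancel] at h2
  push_cast at h2
  simp only [sub_add_cancel] at h2
  have h3 : chebD 0 m ρ = (T ℝ m).eval ρ := rfl
  rw [h3, ← mul_assoc, h2, chebWeight]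
  have h4 := Real.mul_self_sqrt h0.le
  field_simp
  rw [Real.sq_sqrt h0.le]
  ring

lemma one_sub_sq_mul_U (m : ℤ) (ρ : ℝ) :
    (1 - ρ ^ 2) * (U ℝ (m - 1)).eval ρ = (chebD 0 (m - 1) ρ - chebD 0 (m + 1) ρ) / 2 := by
  have h2 := congrArg (Polynomial.eval ρ) (one_sub_X_sq_mul_U_eq_pol_in_T ℝ (m - 1))
  have h3 := congrArg (Polynomial.eval ρ) (T_add_two ℝ (m - 1))
  have e1 : m - 1 + 2 = m + 1 := by ring
  simp only [Polynomial.eval_mul, Polynomial.eval_sub, Polynomial.eval_one,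
    Polynomial.eval_pow, Polynomial.eval_X, sub_add_cancel, e1, Polynomial.eval_ofNat] at h2 h3
  have h4 : ∀ k, chebD 0 k ρ = (T ℝ k).eval ρ := fun _ => rfl
  rw [h4, h4, h2]
  linarith

/-- The test function contains `√(1-ρ²) U_{m-1}`, chosen because its derivative is `-m T_m ω`, while
the function itself is `ω (1-ρ²) U_{m-1} = ω (T_{m-1} - T_{m+1}) / 2`. The two sides of the weak
identity thus become coefficients of `g` and of `g'`. -/
lemma fcCoeff_weakDeriv_fst {j k : ℕ} {P g g' : ℝ × ℝ → ℝ} (h : IsWeakDeriv j k P g)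
    (h' : IsWeakDeriv (j + 1) k P g') (hg : Integrable g fcMeasure)
    (hg' : Integrable g' fcMeasure) (m n : ℤ) :
    2 * (m * fcCoeff g (m, n)) = fcCoeff g' (m - 1, n) - fcCoeff g' (m + 1, n) := by
  have hUc : Continuous fun ρ => (U ℝ (m - 1)).eval ρ := (U ℝ (m - 1)).continuous
  have hgU := integrable_mul_casD_chebD hg hUc 0 n
  have hgm := (integrable_mul_fcBasis hg (m, n)).const_mul (-(m : ℝ))
  have hgU' : Integrable (fun x => g' x * ((1 - x.1 ^ 2) * (U ℝ (m - 1)).eval x.1 *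
      casD 0 n x.2)) fcMeasure :=
    integrable_mul_casD_chebD hg' (f := fun ρ => (1 - ρ ^ 2) * (U ℝ (m - 1)).eval ρ)
      (by fun_prop) 0 n
  have hcD : ∀ i, Integrable (fun x => cutoffD i x.1 *
      (g x * ((U ℝ (m - 1)).eval x.1 * casD 0 n x.2))) fcMeasure := fun i =>
    (integrable_mul_casD_chebD hg ((continuous_cutoffD i).mul hUc) 0 n).congr
      (.of_forall fun x => by simp only [Pi.mul_apply]; ring)
  have hc : ∀ i, Integrable (fun x => cutoff i x.1 * (-(m : ℝ) * (g x * fcBasis (m, n) x)))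
      fcMeasure := fun i =>
    (integrable_mul_casD_chebD hg (((contDiff_cutoff i).continuous.mul
      (continuous_chebD 0 m)).const_mul (-(m : ℝ))) 0 n).congr
      (.of_forall fun x => by simp only [fcBasis, Pi.mul_apply]; ring)
  have key : ∀ i : ℕ,
      ∫ x, cutoffD i x.1 * (g x * ((U ℝ (m - 1)).eval x.1 * casD 0 n x.2)) ∂fcMeasure +
        ∫ x, cutoff i x.1 * (-(m : ℝ) * (g x * fcBasis (m, n) x)) ∂fcMeasure =
      -∫ x, cutoff i x.1 * (g' x * ((1 - x.1 ^ 2) * (U ℝ (m - 1)).eval x.1 *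
        casD 0 n x.2)) ∂fcMeasure := by
    intro i
    have hcut : IsCut fun ρ => cutoff i ρ * (Real.sqrt (1 - ρ ^ 2) * (U ℝ (m - 1)).eval ρ) :=
      isCut_cutoff_mul i (contDiffOn_sqrt_one_sub_sq.mul
        (Polynomial.contDiff_aeval (U ℝ (m - 1)) _).contDiffOn)
    have := weakDeriv_step_fst h h' hcut n
    rw [← integral_add (hcD i) (hc i), integral_fcMeasure, integral_fcMeasure]
    convert this using 1
    · refine setIntegral_congr_fun measurableSet_Dom fun x hx => ?_
      have hd := (deriv_cutoff_mul i x.1).mul (hasDerivAt_sqrt_mul_U m hx.1)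
      have hd' := hd.deriv
      simp only [Pi.mul_def] at hd'
      simp only [hd', sqrt_eq_mul_chebWeight hx.1, cutoffD, fcBasis]
      ring
    · congr 1
      refine setIntegral_congr_fun measurableSet_Dom fun x hx => ?_
      simp only [sqrt_eq_mul_chebWeight hx.1]
      ring
  -- The term with the derivative of the cut-off carries `√(1-ρ²) = (1-ρ²) ω`, hence is an integral
  -- against `cutoffD` and disappears in the limit.
  have h1 := (tendsto_integral_cutoffD hgU).add (tendsto_integral_cutoff hgm)
  have h2 := (tendsto_integral_cutoff hgU').neg
  simp_rw [key] at h1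
  have h3 := tendsto_nhds_unique h1 h2
  rw [zero_add, integral_const_mul] at h3
  have h4 : ∫ x, g' x * ((1 - x.1 ^ 2) * (U ℝ (m - 1)).eval x.1 * casD 0 n x.2) ∂fcMeasure =
      (fcCoeff g' (m - 1, n) - fcCoeff g' (m + 1, n)) / 2 := by
    rw [fcCoeff, fcCoeff, ← integral_sub (integrable_mul_fcBasis hg' _)
      (integrable_mul_fcBasis hg' _), ← integral_div]
    refine integral_congr_ae (.of_forall fun x => ?_)
    simp only [one_sub_sq_mul_U, fcBasis]
    ring
  rw [h4] at h3
  have h5 : fcCoeff g (m, n) = ∫ x, g x * fcBasis (m, n) x ∂fcMeasure := rfl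
  rw [h5]
  linarith

end

/-! ### Weighted square summability of the coefficients. -/

section

open MeasureTheory Filter Topology

/-- The weight `(1 + |m|)^l` on `ℤ`. -/
def wt (l : ℕ) (m : ℤ) : ℝ := (1 + |(m : ℝ)|) ^ l

lemma wt_pos (l : ℕ) (m : ℤ) : 0 < wt l m := by unfold wt; positivity

lemma wt_succ (l : ℕ) (m : ℤ) : wt (l + 1) m = wt l m * (1 + |(m : ℝ)|) := pow_succ _ _

lemma ofReal_sq_add_le {x y z A : ℝ} (h : |x| ≤ |y| + A * |z|) :
    ENNReal.ofReal (x ^ 2) ≤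
      2 * ENNReal.ofReal (y ^ 2) + ENNReal.ofReal (2 * A ^ 2) * ENNReal.ofReal (z ^ 2) := by
  rw [← ENNReal.ofReal_ofNat 2, ← ENNReal.ofReal_mul (by norm_num),
    ← ENNReal.ofReal_mul (by positivity), ← ENNReal.ofReal_add (by positivity) (by positivity)]
  apply ENNReal.ofReal_le_ofReal
  have h1 : x ^ 2 ≤ (|y| + A * |z|) ^ 2 := by
    rw [← sq_abs x]; gcongr
  nlinarith [sq_nonneg (|y| - A * |z|), sq_abs y, sq_abs z]

/-- Decay of coefficients whose "derivatives" are square summable: if `|m| |c_i(m)|` is controlled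
by shifts of `c_{i+1}`, then `(1 + |m|)^l c_0` is square summable. -/
lemma exists_weighted_tsum_le (τ₁ τ₂ : ℤ ≃ ℤ) (h₁ : ∀ m, wt 1 m ≤ 2 * wt 1 (τ₁ m))
    (h₂ : ∀ m, wt 1 m ≤ 2 * wt 1 (τ₂ m)) (l : ℕ) :
    ∃ C : ℝ≥0∞, C ≠ ⊤ ∧ ∀ c : ℕ → ℤ → ℝ,
      (∀ i < l, ∀ m : ℤ, |(m : ℝ) * c i m| ≤ |c (i + 1) (τ₁ m)| + |c (i + 1) (τ₂ m)|) →
      ∑' m, ENNReal.ofReal ((wt l m * c 0 m) ^ 2) ≤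
        C * ∑ i ∈ Finset.range (l + 1), ∑' m, ENNReal.ofReal (c i m ^ 2) := by
  induction l with
  | zero => exact ⟨1, by simp, fun c _ => by simp [wt]⟩
  | succ l ih =>
    obtain ⟨C, hC, ih⟩ := ih
    set D : ℝ≥0∞ := ENNReal.ofReal (2 * (2 ^ l) ^ 2) with hD
    have hDtop : D ≠ ⊤ := ENNReal.ofReal_ne_top
    refine ⟨2 * C + 2 * (D * C) + 2 * (D * C), by finiteness, fun c hc => ?_⟩
    have hw : ∀ τ : ℤ ≃ ℤ, (∀ m, wt 1 m ≤ 2 * wt 1 (τ m)) → ∀ m, wt l m ≤ 2 ^ l * wt l (τ m) := by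
      intro τ hτ m
      have := hτ m
      simp only [wt, pow_one] at this
      rw [wt, wt, ← mul_pow]
      gcongr
    have hpt : ∀ m, ENNReal.ofReal ((wt (l + 1) m * c 0 m) ^ 2) ≤
        2 * ENNReal.ofReal ((wt l m * c 0 m) ^ 2) +
          2 * (D * ENNReal.ofReal ((wt l (τ₁ m) * c 1 (τ₁ m)) ^ 2)) +
          2 * (D * ENNReal.ofReal ((wt l (τ₂ m) * c 1 (τ₂ m)) ^ 2)) := by
      intro m
      have h0 := hc 0 (Nat.succ_pos l) m
      have hwl := wt_pos l m
      have hb1 : wt l m * |c 1 (τ₁ m)| ≤ 2 ^ l * |wt l (τ₁ m) * c 1 (τ₁ m)| := by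
        rw [abs_mul, abs_of_pos (wt_pos l _), ← mul_assoc]
        exact mul_le_mul_of_nonneg_right (hw τ₁ h₁ m) (abs_nonneg _)
      have hb2 : wt l m * |c 1 (τ₂ m)| ≤ 2 ^ l * |wt l (τ₂ m) * c 1 (τ₂ m)| := by
        rw [abs_mul, abs_of_pos (wt_pos l _), ← mul_assoc]
        exact mul_le_mul_of_nonneg_right (hw τ₂ h₂ m) (abs_nonneg _)
      set u := 2 ^ l * |wt l (τ₁ m) * c 1 (τ₁ m)| with hu
      set v := 2 ^ l * |wt l (τ₂ m) * c 1 (τ₂ m)| with hv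
      -- Split `(1+|m|)^{l+1}` as `(1+|m|)^l + |m| (1+|m|)^l` and trade the factor `|m|` for the
      -- moved entries of `c 1`; moving the weight along costs `2^l`.
      have hkey : |wt (l + 1) m * c 0 m| ≤ |wt l m * c 0 m| + 1 * |u + v| := by
        rw [wt_succ, abs_mul, abs_mul, abs_mul, abs_of_pos hwl,
          abs_of_nonneg (a := 1 + |(m : ℝ)|) (by positivity)]
        rw [abs_mul] at h0
        have h3 := mul_le_mul_of_nonneg_left h0 hwl.le
        have h4 := le_abs_self (u + v)
        nlinarith
      refine (ofReal_sq_add_le hkey).trans ?_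
      rw [add_assoc]
      gcongr
      have huv : |u + v| ≤ |u| + 1 * |v| := by rw [one_mul]; exact abs_add_le _ _
      refine (mul_le_mul_right (ofReal_sq_add_le huv) _).trans (le_of_eq ?_)
      have hu2 : ENNReal.ofReal (u ^ 2) * 2 =
          D * ENNReal.ofReal ((wt l (τ₁ m) * c 1 (τ₁ m)) ^ 2) := by
        rw [hD, ← ENNReal.ofReal_mul (by positivity), ← ENNReal.ofReal_ofNat 2,
          ← ENNReal.ofReal_mul (by positivity), hu, mul_pow, sq_abs]
        congr 1; ring
      have hv2 : ENNReal.ofReal (v ^ 2) * 2 =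
          D * ENNReal.ofReal ((wt l (τ₂ m) * c 1 (τ₂ m)) ^ 2) := by
        rw [hD, ← ENNReal.ofReal_mul (by positivity), ← ENNReal.ofReal_ofNat 2,
          ← ENNReal.ofReal_mul (by positivity), hv, mul_pow, sq_abs]
        congr 1; ring
      rw [← hu2, ← hv2]
      simp only [one_pow, mul_one, ENNReal.ofReal_ofNat]
      ring
    set S := ∑ i ∈ Finset.range (l + 1 + 1), ∑' m, ENNReal.ofReal (c i m ^ 2) with hS
    have e0 : ∑' m, ENNReal.ofReal ((wt l m * c 0 m) ^ 2) ≤ C * S := by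
      refine (ih c fun i hi => hc i (by omega)).trans ?_
      gcongr
      rw [hS, Finset.sum_range_succ _ (l + 1)]
      exact le_self_add
    -- The induction hypothesis is applied to the sequence that starts at `c 1`.
    have e1 : ∑' m, ENNReal.ofReal ((wt l m * c 1 m) ^ 2) ≤ C * S := by
      refine (ih (fun i => c (i + 1)) fun i hi => hc (i + 1) (by omega)).trans ?_
      gcongr
      rw [hS, Finset.sum_range_succ' _ (l + 1)]
      exact le_self_add
    calc _ ≤ _ := ENNReal.tsum_le_tsum hpt
      _ = 2 * ∑' m, ENNReal.ofReal ((wt l m * c 0 m) ^ 2) +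
          2 * (D * ∑' m, ENNReal.ofReal ((wt l m * c 1 m) ^ 2)) +
          2 * (D * ∑' m, ENNReal.ofReal ((wt l m * c 1 m) ^ 2)) := by
        rw [ENNReal.tsum_add, ENNReal.tsum_add, ENNReal.tsum_mul_left, ENNReal.tsum_mul_left,
          ENNReal.tsum_mul_left, ENNReal.tsum_mul_left, ENNReal.tsum_mul_left,
          τ₁.tsum_eq fun m => ENNReal.ofReal ((wt l m * c 1 m) ^ 2),
          τ₂.tsum_eq fun m => ENNReal.ofReal ((wt l m * c 1 m) ^ 2)]
      _ ≤ 2 * (C * S) + 2 * (D * (C * S)) + 2 * (D * (C * S)) := by gcongr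
      _ = _ := by ring

lemma wt_one_le_of_abs_sub_le {m k : ℤ} (h : |(m : ℝ) - k| ≤ 1) : wt 1 m ≤ 2 * wt 1 k := by
  simp only [wt, pow_one]
  have := abs_sub_abs_le_abs_sub (m : ℝ) k
  have := abs_nonneg (k : ℝ)
  linarith

/-- The powers of `n` are gained first, for fixed `m` and along the pure `φ`-derivatives, then the
powers of `m` for each fixed `n` and `k`. The relevant bijections of `ℤ` are negation for `n` and
the unit shifts for `m`. -/
lemma exists_weighted_tsum_prod_le (l s : ℕ) :
    ∃ C : ℝ≥0∞, C ≠ ⊤ ∧ ∀ c : ℕ → ℕ → ℤ × ℤ → ℝ,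
      (∀ i < l, ∀ k ≤ s, ∀ m n : ℤ, 2 * ((m : ℝ) * c i k (m, n)) =
        c (i + 1) k (m - 1, n) - c (i + 1) k (m + 1, n)) →
      (∀ k < s, ∀ m n : ℤ, c 0 (k + 1) (m, n) = -((n : ℝ) * c 0 k (m, -n))) →
      ∑' a : ℤ × ℤ, ENNReal.ofReal ((wt l a.1 * wt s a.2 * c 0 0 a) ^ 2) ≤
        C * ∑ k ∈ Finset.range (s + 1), ∑ i ∈ Finset.range (l + 1),
          ∑' a, ENNReal.ofReal (c i k a ^ 2) := by
  obtain ⟨C₁, hC₁, H₁⟩ := exists_weighted_tsum_le (Equiv.subRight 1) (Equiv.addRight 1)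
    (fun m => wt_one_le_of_abs_sub_le (by simp))
    (fun m => wt_one_le_of_abs_sub_le (by simp)) l
  obtain ⟨C₂, hC₂, H₂⟩ := exists_weighted_tsum_le (Equiv.neg ℤ) (Equiv.neg ℤ)
    (fun m => by simp [wt]; linarith [abs_nonneg (m : ℝ)])
    (fun m => by simp [wt]; linarith [abs_nonneg (m : ℝ)]) s
  refine ⟨C₂ * C₁, by finiteness, fun c hm hn => ?_⟩
  have e2 : ∀ m, ∑' n, ENNReal.ofReal ((wt l m * wt s n * c 0 0 (m, n)) ^ 2) ≤
      C₂ * ∑ k ∈ Finset.range (s + 1),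
        ∑' n, ENNReal.ofReal ((wt l m * c 0 k (m, n)) ^ 2) := by
    intro m
    have := H₂ (fun k n => wt l m * c 0 k (m, n)) fun k hk n => by
      have h := hn k hk m (-n)
      simp only [Equiv.neg_apply]
      rw [h]
      push_cast
      rw [neg_neg, neg_mul, neg_neg, mul_left_comm]
      exact le_add_of_nonneg_left (abs_nonneg _)
    refine le_trans (le_of_eq (tsum_congr fun n => ?_)) this
    ring_nf
  have e1 : ∀ k ≤ s, ∀ n, ∑' m, ENNReal.ofReal ((wt l m * c 0 k (m, n)) ^ 2) ≤
      C₁ * ∑ i ∈ Finset.range (l + 1), ∑' m, ENNReal.ofReal (c i k (m, n) ^ 2) := by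
    intro k hk n
    refine H₁ (fun i m => c i k (m, n)) fun i hi m => ?_
    have h := hm i hi k hk m n
    simp only [Equiv.subRight_apply, Equiv.coe_addRight]
    have h3 : (m : ℝ) * c i k (m, n) =
      (c (i + 1) k (m - 1, n) - c (i + 1) k (m + 1, n)) / 2 := by linarith
    rw [h3, abs_div, abs_two]
    have := abs_sub (c (i + 1) k (m - 1, n)) (c (i + 1) k (m + 1, n))
    linarith [abs_nonneg (c (i + 1) k (m - 1, n) - c (i + 1) k (m + 1, n))]
  calc _ = ∑' m, ∑' n, ENNReal.ofReal ((wt l m * wt s n * c 0 0 (m, n)) ^ 2) :=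
        ENNReal.tsum_prod' (f := fun a : ℤ × ℤ =>
          ENNReal.ofReal ((wt l a.1 * wt s a.2 * c 0 0 a) ^ 2))
    _ ≤ ∑' m, C₂ * ∑ k ∈ Finset.range (s + 1),
        ∑' n, ENNReal.ofReal ((wt l m * c 0 k (m, n)) ^ 2) := ENNReal.tsum_le_tsum e2
    _ = C₂ * ∑ k ∈ Finset.range (s + 1),
        ∑' n, ∑' m, ENNReal.ofReal ((wt l m * c 0 k (m, n)) ^ 2) := by
      rw [ENNReal.tsum_mul_left, Summable.tsum_finsetSum fun _ _ => ENNReal.summable]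
      congr 1
      exact Finset.sum_congr rfl fun k _ => ENNReal.tsum_comm
    _ ≤ C₂ * ∑ k ∈ Finset.range (s + 1),
        ∑' n, C₁ * ∑ i ∈ Finset.range (l + 1), ∑' m, ENNReal.ofReal (c i k (m, n) ^ 2) := by
      gcongr with k hk n
      exact e1 k (by simpa [Nat.lt_succ_iff] using hk) n
    _ = _ := by
      rw [mul_assoc, Finset.mul_sum (a := C₁)]
      congr 1
      refine Finset.sum_congr rfl fun k _ => ?_
      rw [ENNReal.tsum_mul_left, Summable.tsum_finsetSum fun _ _ => ENNReal.summable]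
      congr 1
      refine Finset.sum_congr rfl fun i _ => ?_
      rw [ENNReal.tsum_comm, ENNReal.tsum_prod' (f := fun a => ENNReal.ofReal (c i k a ^ 2))]

lemma sobNorm_sq (μ σ : ℕ) (v : ℝ × ℝ → ℝ) : sobNorm μ σ v ^ 2 =
    ∑ k ∈ Finset.range (μ + 1), ∑ j ∈ Finset.range (σ + 1), derivSq j k v := by
  rw [sobNorm, ← ENNReal.rpow_natCast, ← ENNReal.rpow_mul]
  norm_num

/-- Weighted square summability of the Fourier–Chebyshev coefficients. -/
lemma exists_tsum_fcCoeff_le (l s : ℕ) :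
    ∃ C : ℝ≥0∞, C ≠ ⊤ ∧ ∀ P : ℝ × ℝ → ℝ, ContinuousOn P DomBar → MemSob s l P →
      ∑' a : ℤ × ℤ, ENNReal.ofReal ((wt l a.1 * wt s a.2 * fcCoeff P a) ^ 2) ≤
        C * sobNorm s l P ^ 2 := by
  obtain ⟨C, hC, H⟩ := exists_weighted_tsum_prod_le l s
  refine ⟨C * ENNReal.ofReal (4 * Real.pi ^ 2), by finiteness, fun P hP hmem => ?_⟩
  have htop : sobNorm s l P ^ 2 ≠ ⊤ := ENNReal.pow_ne_top hmem.ne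
  have hd : ∀ k ≤ s, ∀ i ≤ l, derivSq i k P ≠ ⊤ := by
    intro k hk i hi
    rw [sobNorm_sq] at htop
    refine ne_top_of_le_ne_top htop ?_
    refine le_trans ?_ (Finset.single_le_sum (fun _ _ => zero_le)
      (Finset.mem_range.2 (Nat.lt_succ_of_le hk)))
    exact Finset.single_le_sum (f := fun i => derivSq i k P) (fun _ _ => zero_le)
      (Finset.mem_range.2 (Nat.lt_succ_of_le hi))
  -- `derivSq` is an infimum, so weak derivatives within `ε` of it are chosen and `ε` tends to zero
  -- at the end; no infimum has to be attained.
  have key : ∀ ε : ℝ≥0∞, 0 < ε → ε < ⊤ →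
      ∑' a : ℤ × ℤ, ENNReal.ofReal ((wt l a.1 * wt s a.2 * fcCoeff P a) ^ 2) ≤
        C * ENNReal.ofReal (4 * Real.pi ^ 2) *
          (sobNorm s l P ^ 2 + ((s + 1 : ℕ) * ((l + 1 : ℕ) * ε))) := by
    intro ε hε hεtop
    have hex : ∀ i k, ∃ g : ℝ × ℝ → ℝ, k ≤ s → i ≤ l → IsWeakDeriv i k P g ∧
        ∫⁻ x, ‖g x‖ₑ ^ 2 ∂fcMeasure < derivSq i k P + ε := by
      intro i k
      by_cases h : k ≤ s ∧ i ≤ l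
      · have := ENNReal.lt_add_right (hd k h.1 i h.2) hε.ne'
        conv at this => lhs; rw [derivSq]
        obtain ⟨g, hg⟩ := iInf_lt_iff.1 this
        obtain ⟨hg1, hg2⟩ := iInf_lt_iff.1 hg
        exact ⟨g, fun _ _ => ⟨hg1, by rwa [lintegral_fcMeasure]⟩⟩
      · exact ⟨0, fun h1 h2 => (h ⟨h1, h2⟩).elim⟩
    choose g hg using hex
    have hL2 : ∀ k ≤ s, ∀ i ≤ l, MemLp (g i k) 2 fcMeasure := by
      intro k hk i hi
      obtain ⟨h1, h2⟩ := hg i k hk hi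
      refine ⟨aestronglyMeasurable_fcMeasure h1.2.1, ?_⟩
      rw [eLpNorm_lt_top_iff_lintegral_rpow_enorm_lt_top (by norm_num) (by norm_num)]
      simp only [ENNReal.toReal_ofNat, ENNReal.rpow_ofNat]
      exact h2.trans_le le_top
    have hint : ∀ k ≤ s, ∀ i ≤ l, Integrable (g i k) fcMeasure := fun k hk i hi =>
      (hL2 k hk i hi).integrable (by norm_num)
    have hb := H (fun i k => fcCoeff (g i k))
      (fun i hi k hk m n => fcCoeff_weakDeriv_fst (hg i k hk hi.le).1 (hg (i + 1) k hk hi).1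
        (hint k hk i hi.le) (hint k hk (i + 1) hi) m n)
      (fun k hk m n => fcCoeff_weakDeriv_snd (hg 0 k hk.le l.zero_le).1
        (hg 0 (k + 1) hk l.zero_le).1 (hint k hk.le 0 l.zero_le)
        (hint (k + 1) hk 0 l.zero_le) m n)
    have h00 : fcCoeff (g 0 0) = fcCoeff P :=
      fcCoeff_weakDeriv_zero (hg 0 0 s.zero_le l.zero_le).1
        (integrable_fcMeasure_of_continuousOn hP) (hint 0 s.zero_le 0 l.zero_le)
    simp only [h00] at hb
    refine hb.trans ?_
    rw [mul_assoc]
    gcongr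
    calc _ ≤ ∑ k ∈ Finset.range (s + 1), ∑ i ∈ Finset.range (l + 1),
          ENNReal.ofReal (4 * Real.pi ^ 2) * (derivSq i k P + ε) := by
          refine Finset.sum_le_sum fun k hk => Finset.sum_le_sum fun i hi => ?_
          have hk' := Nat.lt_succ_iff.1 (Finset.mem_range.1 hk)
          have hi' := Nat.lt_succ_iff.1 (Finset.mem_range.1 hi)
          refine (tsum_fcCoeff_sq_le (hL2 k hk' i hi')).trans ?_
          gcongr
          exact (hg i k hk' hi').2.le
      _ = _ := by
          simp only [← Finset.mul_sum, sobNorm_sq, Finset.sum_add_distrib, Finset.sum_const,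
            Finset.card_range, nsmul_eq_mul]
          ring
  have hlim : Tendsto (fun ε : ℝ≥0∞ => C * ENNReal.ofReal (4 * Real.pi ^ 2) *
      (sobNorm s l P ^ 2 + ((s + 1 : ℕ) * ((l + 1 : ℕ) * ε)))) (𝓝[>] 0)
      (𝓝 (C * ENNReal.ofReal (4 * Real.pi ^ 2) *
        (sobNorm s l P ^ 2 + ((s + 1 : ℕ) * ((l + 1 : ℕ) * 0))))) := by
    refine ENNReal.Tendsto.const_mul (tendsto_const_nhds.add (ENNReal.Tendsto.const_mul
      (ENNReal.Tendsto.const_mul (tendsto_id.mono_left nhdsWithin_le_nhds) (.inr (by simp)))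
      (.inr (by simp)))) (.inr (by finiteness))
  have := ge_of_tendsto hlim (b := ∑' a : ℤ × ℤ,
    ENNReal.ofReal ((wt l a.1 * wt s a.2 * fcCoeff P a) ^ 2)) ?_
  · simpa using this
  · filter_upwards [Ioo_mem_nhdsGT (show (0 : ℝ≥0∞) < ⊤ by simp)] with ε hε using key ε hε.1 hε.2

end

/-! ### Completeness and the Fourier–Chebyshev expansion. -/

section

open MeasureTheory Filter Topology Polynomial.Chebyshev

lemma cos_eq_casD (n : ℤ) (x : ℝ) : Real.cos (n * x) = (casD 0 n x + casD 0 (-n) x) / 2 := by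
  simp only [casD]
  push_cast
  rw [neg_mul, Real.cos_neg, Real.sin_neg]
  ring

lemma sin_eq_casD (n : ℤ) (x : ℝ) : Real.sin (n * x) = (casD 0 n x - casD 0 (-n) x) / 2 := by
  simp only [casD]
  push_cast
  rw [neg_mul, Real.cos_neg, Real.sin_neg]
  ring

/-- Completeness of the Hartley system on an interval of length `2π`. -/
lemma eq_zero_of_integral_casD_eq_zero {f : ℝ → ℝ} (hf : Continuous f) (a : ℝ)
    (h : ∀ n : ℤ, ∫ x in a..(a + 2 * Real.pi), f x * casD 0 n x = 0) :
    ∀ x ∈ Set.Icc a (a + 2 * Real.pi), f x = 0 := by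
  have hpi := Real.pi_pos
  have hab : a < a + 2 * Real.pi := by linarith
  have hic : ∀ n : ℤ, IntervalIntegrable (fun x => f x * casD 0 n x) volume a
      (a + 2 * Real.pi) := fun n => (hf.mul (continuous_casD 0 n)).intervalIntegrable _ _
  have hcos : ∀ n : ℤ, ∫ x in a..(a + 2 * Real.pi), f x * Real.cos (n * x) = 0 := by
    intro n
    have e : ∀ x, f x * Real.cos (n * x) = (f x * casD 0 n x + f x * casD 0 (-n) x) / 2 :=
      fun x => by rw [cos_eq_casD]; ring
    simp_rw [e]
    rw [intervalIntegral.integral_div, intervalIntegral.integral_add (hic n) (hic (-n)), h, h]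
    simp
  have hsin : ∀ n : ℤ, ∫ x in a..(a + 2 * Real.pi), f x * Real.sin (n * x) = 0 := by
    intro n
    have e : ∀ x, f x * Real.sin (n * x) = (f x * casD 0 n x - f x * casD 0 (-n) x) / 2 :=
      fun x => by rw [sin_eq_casD]; ring
    simp_rw [e]
    rw [intervalIntegral.integral_div, intervalIntegral.integral_sub (hic n) (hic (-n)), h, h]
    simp
  have hcoeff : ∀ n : ℤ, fourierCoeffOn hab (fun x => (f x : ℂ)) n = 0 := by
    intro n
    rw [fourierCoeffOn_eq_integral]
    have e : ∀ x : ℝ, fourier (-n) (x : AddCircle (a + 2 * Real.pi - a)) • (f x : ℂ) =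
        ((f x * Real.cos (n * x) : ℝ) : ℂ) - Complex.I * ((f x * Real.sin (n * x) : ℝ) : ℂ) := by
      intro x
      have hpc : (Real.pi : ℂ) ≠ 0 := by exact_mod_cast hpi.ne'
      rw [fourier_coe_apply]
      have : 2 * (Real.pi : ℂ) * Complex.I * ((-n : ℤ) : ℂ) * x /
          ((a + 2 * Real.pi - a : ℝ) : ℂ) = ((-(n * x) : ℝ) : ℂ) * Complex.I := by
        push_cast
        field_simp
        ring
      rw [this, Complex.exp_mul_I, ← Complex.ofReal_cos, ← Complex.ofReal_sin, Real.cos_neg,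
        Real.sin_neg]
      push_cast
      simp only [smul_eq_mul]
      ring
    simp_rw [e]
    rw [intervalIntegral.integral_sub, intervalIntegral.integral_const_mul,
      intervalIntegral.integral_ofReal, intervalIntegral.integral_ofReal, hcos, hsin]
    · simp
    · exact Continuous.intervalIntegrable (by fun_prop) _ _
    · exact Continuous.intervalIntegrable (by fun_prop) _ _
  have hL2 : MemLp (fun x => (f x : ℂ)) 2 (volume.restrict (Set.Ioc a (a + 2 * Real.pi))) := by
    have hc : Continuous fun x => (f x : ℂ) := by fun_prop
    obtain ⟨C, hC⟩ := (isCompact_Icc (a := a) (b := a + 2 * Real.pi)).exists_bound_of_continuousOn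
      hc.continuousOn
    refine MemLp.of_bound hc.aestronglyMeasurable C ?_
    filter_upwards [ae_restrict_mem measurableSet_Ioc] with x hx
      using hC x (Set.Ioc_subset_Icc_self hx)
  -- By Parseval the integral of `f²` vanishes, and continuity then gives zero everywhere, endpoints
  -- included.
  have hP := hasSum_sq_fourierCoeffOn hab hL2
  simp only [hcoeff, norm_zero, ne_eq, OfNat.ofNat_ne_zero, not_false_eq_true, zero_pow] at hP
  have h0 := hP.unique hasSum_zero
  rw [smul_eq_zero] at h0
  have h1 : ∫ x in a..(a + 2 * Real.pi), ‖(f x : ℂ)‖ ^ 2 = 0 :=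
    h0.resolve_left (inv_ne_zero (by linarith))
  rw [intervalIntegral.integral_of_le hab.le, integral_Ioc_eq_integral_Ioo,
    setIntegral_eq_zero_iff_of_nonneg_ae (.of_forall fun x => by positivity)
      ((Continuous.integrableOn_Icc (by fun_prop)).mono_set Set.Ioo_subset_Icc_self)] at h1
  have h2 : Set.EqOn f (fun _ => 0) (Set.Ioo a (a + 2 * Real.pi)) := by
    refine Measure.eqOn_Ioo_of_ae_eq volume ?_ hf.continuousOn continuousOn_const
    filter_upwards [h1] with x hx
    simpa using hx
  have h3 := h2.closure hf continuous_const
  rw [closure_Ioo hab.ne] at h3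
  exact fun x hx => h3 hx

/-- Completeness of the double Chebyshev–Hartley system. -/
lemma eqOn_zero_of_fcCoeff_eq_zero {h : ℝ × ℝ → ℝ} (hh : ContinuousOn h DomBar)
    (h0 : ∀ a, fcCoeff h a = 0) : ∀ x ∈ DomBar, h x = 0 := by
  have hpi := Real.pi_pos
  -- The substitution `ρ = cos θ` turns `ω dρ` into `dθ`; clamping `φ` to `[0, 2π]` yields a
  -- function continuous on the whole plane.
  set G : ℝ × ℝ → ℝ := fun y => h (Real.cos y.1, max 0 (min y.2 (2 * Real.pi))) with hG
  have hGc : Continuous G := by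
    refine hh.comp_continuous (by fun_prop) fun y => ⟨?_, ?_⟩
    · exact ⟨Real.neg_one_le_cos _, Real.cos_le_one _⟩
    · exact ⟨le_max_left _ _, max_le (by positivity) (min_le_right _ _)⟩
  set K : ℤ → ℝ → ℝ := fun n θ => ∫ φ in (0 : ℝ)..(2 * Real.pi), G (θ, φ) * casD 0 n φ with hK
  have hKc : ∀ n, Continuous (K n) := by
    intro n
    have := continuous_casD 0 n
    refine intervalIntegral.continuous_parametric_intervalIntegral_of_continuous' ?_ _ _
    fun_prop
  have hKcos : ∀ n m : ℤ, ∫ θ in (0 : ℝ)..Real.pi, K n θ * Real.cos (m * θ) = 0 := by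
    intro n m
    have h1 := h0 (m, n)
    have hint := integrable_mul_fcBasis (integrable_fcMeasure_of_continuousOn hh) (m, n)
    rw [fcCoeff, fcMeasure, integral_prod _ hint, integral_measureT_eq_integral_cos] at h1
    rw [← h1]
    congr 1
    ext θ
    simp only [hK, hG, fcBasis]
    rw [← intervalIntegral.integral_mul_const, intervalIntegral.integral_of_le (by positivity),
      integral_Ioc_eq_integral_Ioo]
    refine setIntegral_congr_fun measurableSet_Ioo fun φ hφ => ?_
    have hT : chebD 0 m (Real.cos θ) = Real.cos (m * θ) := T_real_cos θ m
    simp only [hT, min_eq_left hφ.2.le, max_eq_right hφ.1.le]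
    ring
  have hKeven : ∀ n θ, K n (-θ) = K n θ := fun n θ => by simp only [hK, hG, Real.cos_neg]
  have hK0 : ∀ n, ∀ θ ∈ Set.Icc (0 : ℝ) Real.pi, K n θ = 0 := by
    intro n θ hθ
    refine eq_zero_of_integral_casD_eq_zero (hKc n) (-Real.pi) (fun m => ?_) θ
      ⟨by linarith [hθ.1], by linarith [hθ.2]⟩
    have hint : ∀ u v : ℝ, IntervalIntegrable (fun x => K n x * casD 0 m x) volume u v :=
      fun u v => ((hKc n).mul (continuous_casD 0 m)).intervalIntegrable _ _
    have hend : -Real.pi + 2 * Real.pi = Real.pi := by ring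
    rw [hend, ← intervalIntegral.integral_add_adjacent_intervals (hint _ 0) (hint 0 _)]
    -- Since `K n` is even in `θ`, folding the two halves of `[-π, π]` cancels the sine part and
    -- leaves the Chebyshev coefficients.
    have hneg : ∫ x in -Real.pi..0, K n x * casD 0 m x =
        ∫ x in (0 : ℝ)..Real.pi, K n (-x) * casD 0 m (-x) := by
      rw [intervalIntegral.integral_comp_neg fun x => K n x * casD 0 m x, neg_zero]
    have hc : Continuous fun x => K n (-x) * casD 0 m (-x) :=
      ((hKc n).comp continuous_neg).mul ((continuous_casD 0 m).comp continuous_neg)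
    rw [hneg, ← intervalIntegral.integral_add (hc.intervalIntegrable _ _) (hint _ _)]
    have e : ∀ x, K n (-x) * casD 0 m (-x) + K n x * casD 0 m x =
        2 * (K n x * Real.cos (m * x)) := by
      intro x
      rw [hKeven]
      simp only [casD, mul_neg, Real.cos_neg, Real.sin_neg]
      ring
    simp_rw [e]
    rw [intervalIntegral.integral_const_mul, hKcos, mul_zero]
  intro x hx
  have hθ : Real.arccos x.1 ∈ Set.Icc 0 Real.pi :=
    ⟨Real.arccos_nonneg _, Real.arccos_le_pi _⟩
  have h2 := eq_zero_of_integral_casD_eq_zero (f := fun φ => G (Real.arccos x.1, φ))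
    (by fun_prop) 0 (fun n => by rw [zero_add]; exact hK0 n _ hθ) x.2 (by rw [zero_add]; exact hx.2)
  simpa only [hG, Real.cos_arccos hx.1.1 hx.1.2, min_eq_left hx.2.2, max_eq_right hx.2.1] using h2

lemma norm_mul_fcBasis_le (c : ℝ) (a : ℤ × ℤ) {x : ℝ × ℝ} (hx : x ∈ DomBar) :
    ‖c * fcBasis a x‖ ≤ |c| * 2 := by
  rw [norm_mul]
  exact mul_le_mul_of_nonneg_left (abs_fcBasis_le a hx.1) (abs_nonneg _)

/-- The Fourier–Chebyshev expansion of a continuous function. -/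
lemma hasSum_fcBasis {P : ℝ × ℝ → ℝ} (hP : ContinuousOn P DomBar)
    (hs : Summable fun a => |fcCoeff P a|) {x : ℝ × ℝ} (hx : x ∈ DomBar) :
    HasSum (fun a => fcCoeff P a / (2 * Real.pi ^ 2) * fcBasis a x) (P x) := by
  have hpi := Real.pi_pos
  -- The divisor is `2π²` because the sum runs over both signs of `m`: for `m ≠ 0` two copies of
  -- norm `π²` share the coefficient, for `m = 0` a single one has norm `2π²`.
  set p : ℤ × ℤ → ℝ := fun a => fcCoeff P a / (2 * Real.pi ^ 2) with hp
  have hps : Summable fun a => |p a| * 2 := by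
    refine (hs.div_const (2 * Real.pi ^ 2)).mul_right 2 |>.congr fun a => ?_
    rw [hp, abs_div, abs_of_pos (a := 2 * Real.pi ^ 2) (by positivity)]
  set Φ : ℝ × ℝ → ℝ := fun x => ∑' a, p a * fcBasis a x with hΦ
  have hsum : ∀ x ∈ DomBar, Summable fun a => p a * fcBasis a x := fun x hx =>
    Summable.of_norm_bounded hps fun a => norm_mul_fcBasis_le _ _ hx
  have hΦc : ContinuousOn Φ DomBar :=
    continuousOn_tsum (fun a => (continuous_const.mul (continuous_fcBasis a)).continuousOn) hps
      fun a x hx => norm_mul_fcBasis_le _ _ hx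
  have hneg : ∀ a : ℤ × ℤ, fcCoeff P (-a.1, a.2) = fcCoeff P a := fun a => by
    simp only [fcCoeff, fcBasis, chebD_neg]
  have hcoef : ∀ b, fcCoeff Φ b = fcCoeff P b := by
    intro b
    have hb4 : ∀ a, ∀ᵐ x ∂fcMeasure, ‖p a * fcBasis a x * fcBasis b x‖ ≤ |p a| * 2 * 2 := by
      intro a
      filter_upwards [ae_mem_Dom] with x hx
      rw [norm_mul]
      exact mul_le_mul (norm_mul_fcBasis_le _ _ (Dom_subset_DomBar hx))
        (abs_fcBasis_le b (fst_mem_Icc hx)) (norm_nonneg _) (by positivity)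
    have hI : HasSum (fun a => ∫ x, p a * fcBasis a x * fcBasis b x ∂fcMeasure)
        (∫ x, Φ x * fcBasis b x ∂fcMeasure) := by
      refine hasSum_integral_of_dominated_convergence (fun a _ => |p a| * 2 * 2)
        (fun a => ((continuous_const.mul (continuous_fcBasis a)).mul
          (continuous_fcBasis b)).aestronglyMeasurable) hb4
        (.of_forall fun x => hps.mul_right 2) (integrable_const _) ?_
      filter_upwards [ae_mem_Dom] with x hx
      exact (hsum x (Dom_subset_DomBar hx)).hasSum.mul_right _
    have hterm : ∀ a, ∫ x, p a * fcBasis a x * fcBasis b x ∂fcMeasure =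
        (if a = b then fcCoeff P b / 2 else 0) +
          if a = (-b.1, b.2) then fcCoeff P b / 2 else 0 := by
      intro a
      simp_rw [mul_assoc]
      rw [integral_const_mul, integral_fcBasis_mul]
      have h1 : a = b → p a * Real.pi ^ 2 = fcCoeff P b / 2 := by
        rintro rfl
        simp only [hp]
        field_simp
      have h2 : a = (-b.1, b.2) → p a * Real.pi ^ 2 = fcCoeff P b / 2 := by
        rintro rfl
        simp only [hp, hneg]
        field_simp
      rw [← mul_assoc, mul_add]
      congr 1
      · split_ifs with h
        · rw [mul_one, h1 h]
        · rw [mul_zero]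
      · split_ifs with h
        · rw [mul_one, h2 h]
        · rw [mul_zero]
    simp_rw [hterm] at hI
    have := hI.unique ((hasSum_ite_eq b (fcCoeff P b / 2)).add
      (hasSum_ite_eq ((-b.1, b.2) : ℤ × ℤ) (fcCoeff P b / 2)))
    rw [fcCoeff, this]
    ring
  -- `P` and the sum of its series are continuous on the closed rectangle with equal coefficients,
  -- so the expansion also holds on the boundary.
  have hz := eqOn_zero_of_fcCoeff_eq_zero (h := fun x => P x - Φ x) (hP.sub hΦc) fun b => by
    have h1 := integrable_mul_fcBasis (integrable_fcMeasure_of_continuousOn hP) b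
    have h2 := integrable_mul_fcBasis (integrable_fcMeasure_of_continuousOn hΦc) b
    rw [fcCoeff]
    simp_rw [sub_mul]
    rw [integral_sub h1 h2]
    have := hcoef b
    rw [fcCoeff, fcCoeff] at this
    rw [this, sub_self]
  have := hz x hx
  rw [sub_eq_zero] at this
  rw [this]
  exact (hsum x hx).hasSum

end

/-! ### The interpolant: cardinal functions, uniqueness and aliasing. -/

section

open Polynomial.Chebyshev

/-- A trigonometric polynomial in the span of the Fourier interpolation space (`N` even). -/
def IsTrigPoly (N : ℕ) (t : ℝ → ℝ) : Prop :=
  ∃ a b : ℕ → ℝ, ∀ φ, t φ = ∑ k ∈ Finset.range (N / 2 + 1), a k * Real.cos (k * φ) +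
    ∑ k ∈ Finset.Ico 1 (N / 2), b k * Real.sin (k * φ)

lemma IsTrigPoly.add {N : ℕ} {s t : ℝ → ℝ} (hs : IsTrigPoly N s) (ht : IsTrigPoly N t) :
    IsTrigPoly N fun φ => s φ + t φ := by
  obtain ⟨a, b, h⟩ := hs
  obtain ⟨c, d, h'⟩ := ht
  refine ⟨a + c, b + d, fun φ => ?_⟩
  simp only [h, h', Pi.add_apply, add_mul, Finset.sum_add_distrib]
  ring

lemma IsTrigPoly.const_mul {N : ℕ} {t : ℝ → ℝ} (ht : IsTrigPoly N t) (c : ℝ) :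
    IsTrigPoly N fun φ => c * t φ := by
  obtain ⟨a, b, h⟩ := ht
  refine ⟨fun k => c * a k, fun k => c * b k, fun φ => ?_⟩
  simp only [h, mul_add, Finset.mul_sum, mul_assoc]

lemma isTrigPoly_zero (N : ℕ) : IsTrigPoly N fun _ => 0 := ⟨0, 0, fun φ => by simp⟩

lemma IsTrigPoly.sum {N : ℕ} {ι : Type*} (F : Finset ι) {t : ι → ℝ → ℝ}
    (ht : ∀ i ∈ F, IsTrigPoly N (t i)) : IsTrigPoly N fun φ => ∑ i ∈ F, t i φ := by
  classical
  induction F using Finset.induction_on with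
  | empty => simpa using isTrigPoly_zero N
  | insert i F hi ih =>
    simp only [Finset.sum_insert hi]
    exact (ht i (Finset.mem_insert_self i F)).add
      (ih fun j hj => ht j (Finset.mem_insert_of_mem hj))

lemma isTrigPoly_cos {N k : ℕ} (hk : k ≤ N / 2) : IsTrigPoly N fun φ => Real.cos (k * φ) := by
  refine ⟨fun i => if i = k then 1 else 0, 0, fun φ => ?_⟩
  simp [ite_mul, hk]

lemma isTrigPoly_sin {N k : ℕ} (hk : k < N / 2) : IsTrigPoly N fun φ => Real.sin (k * φ) := by
  rcases Nat.eq_zero_or_pos k with rfl | h0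
  · simpa using isTrigPoly_zero N
  refine ⟨0, fun i => if i = k then 1 else 0, fun φ => ?_⟩
  simp only [Pi.zero_apply, zero_mul, Finset.sum_const_zero, zero_add, ite_mul, one_mul]
  rw [Finset.sum_ite_eq', if_pos (Finset.mem_Ico.2 ⟨h0, hk⟩)]

lemma bmod_spec {N : ℕ} (hN : 0 < N) (he : Even N) (n : ℤ) :
    n.bmod N % N = n % N ∧ -(N : ℤ) ≤ 2 * n.bmod N ∧ 2 * n.bmod N < N := by
  refine ⟨Int.bmod_emod, ?_, ?_⟩
  · have := Int.le_bmod (x := n) hN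
    obtain ⟨k, hk⟩ := he
    omega
  · have := Int.bmod_lt (x := n) hN
    obtain ⟨k, hk⟩ := he
    omega

/-- The function (differentiated `k` times) with which the Hartley function of frequency `n`
coincides at the Fourier nodes. -/
def casAlias (N k : ℕ) (n : ℤ) (φ : ℝ) : ℝ :=
  if 2 * n.bmod N = -N then (casD k (n.bmod N) φ + casD k (-n.bmod N) φ) / 2
  else casD k (n.bmod N) φ

/-- Balanced residues lie in `[-N/2, N/2)`. At `-N/2` the function `sin(Nφ/2)` is missing from the
space but vanishes at the nodes; averaging the frequencies `±N/2` keeps only the cosine. -/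
lemma isTrigPoly_casAlias {N : ℕ} (hN : 0 < N) (he : Even N) (n : ℤ) :
    IsTrigPoly N (casAlias N 0 n) := by
  obtain ⟨-, h1, h2⟩ := bmod_spec hN he n
  unfold casAlias
  set r := n.bmod N
  have hcos : ∀ φ : ℝ, Real.cos (r * φ) = Real.cos (r.natAbs * φ) := fun φ => by
    rcases Int.natAbs_eq r with h | h <;> rw [h] <;> simp
  split_ifs with h
  · have e : ∀ φ, (casD 0 r φ + casD 0 (-r) φ) / 2 = Real.cos (r.natAbs * φ) := fun φ => by
      rw [← cos_eq_casD, hcos]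
    simp_rw [e]
    exact isTrigPoly_cos (by omega)
  · have e : ∀ φ, casD 0 r φ = Real.cos (r.natAbs * φ) +
        (r.sign : ℝ) * Real.sin (r.natAbs * φ) := fun φ => by
      rw [← hcos, casD]
      congr 1
      have : ((r.sign * r.natAbs : ℤ) : ℝ) = r := by rw [Int.sign_mul_natAbs]
      conv_lhs => rw [← this]
      rcases Int.sign_trichotomy r with h | h | h <;> simp [h]
    simp_rw [e]
    exact (isTrigPoly_cos (by omega)).add ((isTrigPoly_sin (by obtain ⟨k, rfl⟩ := he; omega)).const_mul _)

lemma casD_node_congr {N : ℕ} (hN : 0 < N) {a b : ℤ} (h : a % N = b % N) (n : ℕ) :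
    casD 0 a (nodeφ N n) = casD 0 b (nodeφ N n) := by
  obtain ⟨q, hq⟩ := Int.dvd_of_emod_eq_zero (Int.emod_eq_emod_iff_emod_sub_eq_zero.1 h)
  have hN' : (N : ℝ) ≠ 0 := by positivity
  have : (a : ℝ) * nodeφ N n = b * nodeφ N n + ((q * n : ℤ) : ℝ) * (2 * Real.pi) := by
    have : (a : ℝ) = b + N * q := by
      have : a = b + N * q := by linarith
      exact_mod_cast this
    rw [this, nodeφ]
    push_cast
    field_simp
  simp only [casD, this, Real.cos_add_int_mul_two_pi, Real.sin_add_int_mul_two_pi]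

lemma casAlias_node {N : ℕ} (hN : 0 < N) (n : ℤ) (i : ℕ) :
    casAlias N 0 n (nodeφ N i) = casD 0 n (nodeφ N i) := by
  have h1 : casD 0 (n.bmod N) (nodeφ N i) = casD 0 n (nodeφ N i) :=
    casD_node_congr hN Int.bmod_emod i
  unfold casAlias
  split_ifs with h
  · have h2 : casD 0 (-n.bmod N) (nodeφ N i) = casD 0 (n.bmod N) (nodeφ N i) := by
      refine casD_node_congr hN ?_ i
      have : -n.bmod N = n.bmod N + N := by linarith
      rw [this, Int.add_emod_right]
    rw [h2, h1]
    ring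
  · exact h1

lemma casAlias_congr {N : ℕ} {a b : ℤ} (h : a % N = b % N) (k : ℕ) :
    casAlias N k a = casAlias N k b := by
  have : a.bmod N = b.bmod N := by rw [Int.bmod_def, Int.bmod_def, h]
  funext φ
  simp only [casAlias, this]

lemma sum_cexp_node {N : ℕ} (hN : 0 < N) (k : ℤ) :
    ∑ n ∈ Finset.range N, Complex.exp ((k * nodeφ N n : ℝ) * Complex.I) =
      if (N : ℤ) ∣ k then (N : ℂ) else 0 := by
  have hN' : (N : ℂ) ≠ 0 := by exact_mod_cast hN.ne'
  have hpi : (Real.pi : ℂ) ≠ 0 := by exact_mod_cast Real.pi_ne_zero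
  set z := Complex.exp (2 * Real.pi * Complex.I * k / N) with hz
  have e : ∀ n : ℕ, Complex.exp ((k * nodeφ N n : ℝ) * Complex.I) = z ^ n := by
    intro n
    rw [hz, ← Complex.exp_nat_mul]
    congr 1
    simp only [nodeφ]
    push_cast
    field_simp
  simp_rw [e]
  have hzN : z ^ N = 1 := by
    rw [hz, ← Complex.exp_nat_mul, Complex.exp_eq_one_iff]
    exact ⟨k, by field_simp⟩
  have hz1 : z = 1 ↔ (N : ℤ) ∣ k := by
    rw [hz, Complex.exp_eq_one_iff]
    constructor
    · rintro ⟨q, hq⟩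
      refine ⟨q, ?_⟩
      have hI := Complex.I_ne_zero
      field_simp at hq
      exact_mod_cast hq
    · rintro ⟨q, rfl⟩
      exact ⟨q, by push_cast; field_simp⟩
  split_ifs with h
  · simp [hz1.2 h]
  · rw [geom_sum_eq (fun hc => h (hz1.1 hc)), hzN, sub_self, zero_div]

/-- Discrete orthogonality of the Hartley functions. -/
lemma sum_casD_node_mul {N : ℕ} (hN : 0 < N) (a b : ℤ) :
    ∑ n ∈ Finset.range N, casD 0 a (nodeφ N n) * casD 0 b (nodeφ N n) =
      if a % N = b % N then (N : ℝ) else 0 := by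
  have hc : ∑ n ∈ Finset.range N, Real.cos ((a - b : ℤ) * nodeφ N n) =
      if (N : ℤ) ∣ a - b then (N : ℝ) else 0 := by
    have := congrArg Complex.re (sum_cexp_node hN (a - b))
    simp only [Complex.re_sum, Complex.exp_ofReal_mul_I_re] at this
    rw [this]
    split_ifs <;> simp
  have hs : ∑ n ∈ Finset.range N, Real.sin ((a + b : ℤ) * nodeφ N n) = 0 := by
    have := congrArg Complex.im (sum_cexp_node hN (a + b))
    simp only [Complex.im_sum, Complex.exp_ofReal_mul_I_im] at this
    rw [this]
    split_ifs <;> simp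
  simp_rw [cas_mul_cas]
  rw [Finset.sum_add_distrib, hc, hs, add_zero]
  simp only [Int.emod_eq_emod_iff_emod_sub_eq_zero, Int.dvd_iff_emod_eq_zero]

/-- The cardinal functions of Fourier interpolation. -/
def fourierCard (N n : ℕ) (φ : ℝ) : ℝ :=
  (∑ r ∈ Finset.range N, casD 0 r (nodeφ N n) * casAlias N 0 r φ) / N

lemma isTrigPoly_fourierCard {N : ℕ} (hN : 0 < N) (he : Even N) (n : ℕ) :
    IsTrigPoly N (fourierCard N n) := by
  have := (IsTrigPoly.sum (Finset.range N) fun r _ =>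
    (isTrigPoly_casAlias hN he (r : ℤ)).const_mul (casD 0 r (nodeφ N n))).const_mul (1 / N)
  simp only [one_div, inv_mul_eq_div] at this
  exact this

lemma fourierCard_node {N n i : ℕ} (hn : n < N) (hi : i < N) :
    fourierCard N n (nodeφ N i) = if n = i then 1 else 0 := by
  have hN : 0 < N := by omega
  have hN' : (N : ℝ) ≠ 0 := by positivity
  -- Both angles equal `2π r j / N`, so the sum over frequencies becomes a sum over nodes, to which
  -- discrete orthogonality applies.
  have hsw : ∀ r j : ℕ, casD 0 (r : ℤ) (nodeφ N j) = casD 0 (j : ℤ) (nodeφ N r) := by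
    intro r j
    have : ((r : ℤ) : ℝ) * nodeφ N j = ((j : ℤ) : ℝ) * nodeφ N r := by
      simp only [nodeφ]; push_cast; ring
    simp only [casD, this]
  simp only [fourierCard, casAlias_node hN]
  simp_rw [hsw _ n, hsw _ i]
  rw [sum_casD_node_mul hN]
  have : ((n : ℤ) % N = (i : ℤ) % N) ↔ n = i := by
    rw [Int.emod_eq_of_lt (by omega) (by omega), Int.emod_eq_of_lt (by omega) (by omega)]
    omega
  simp only [this]
  split_ifs
  · exact div_self hN'
  · simp

lemma sum_casD_mul_fourierCard {N : ℕ} (hN : 0 < N) (a : ℤ) (φ : ℝ) :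
    ∑ n ∈ Finset.range N, casD 0 a (nodeφ N n) * fourierCard N n φ = casAlias N 0 a φ := by
  have hN' : (N : ℝ) ≠ 0 := by positivity
  have hmod : 0 ≤ a % N ∧ a % N < N :=
    ⟨Int.emod_nonneg _ (by omega), Int.emod_lt_of_pos _ (by omega)⟩
  calc _ = ∑ r ∈ Finset.range N, (∑ n ∈ Finset.range N,
        casD 0 a (nodeφ N n) * casD 0 r (nodeφ N n)) * casAlias N 0 r φ / N := by
        simp only [fourierCard, mul_div_assoc', Finset.mul_sum, Finset.sum_mul, Finset.sum_div]
        rw [Finset.sum_comm]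
        exact Finset.sum_congr rfl fun r _ => Finset.sum_congr rfl fun n _ => by ring
    _ = ∑ r ∈ Finset.range N, if (a % N).toNat = r then casAlias N 0 a φ else 0 := by
        refine Finset.sum_congr rfl fun r hr => ?_
        have hr' := Finset.mem_range.1 hr
        rw [sum_casD_node_mul hN]
        have e : a % N = (r : ℤ) % N ↔ (a % N).toNat = r := by
          rw [Int.emod_eq_of_lt (by omega : (0 : ℤ) ≤ r) (by omega)]
          omega
        by_cases h : a % N = (r : ℤ) % N
        · rw [if_pos h, if_pos (e.1 h), casAlias_congr h]
          field_simp
        · rw [if_neg h, if_neg (fun h' => h (e.2 h'))]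
          simp
    _ = _ := by
        rw [Finset.sum_ite_eq, if_pos (Finset.mem_range.2 (by omega))]

lemma casAlias_of_lt {N : ℕ} (k : ℕ) {n : ℤ} (h : |2 * n| < N) :
    casAlias N k n = casD k n := by
  obtain ⟨h1, h2⟩ := abs_lt.1 h
  have : n.bmod N = n := Int.bmod_eq_of_le_mul_two (by omega) (by omega)
  funext φ
  rw [casAlias, this, if_neg (by omega)]

/-- At `|n| = N/2` neither term is reproduced on its own, but the sum is `2 cos(nφ)`, which belongs
to the space. This covers the top cosine in `IsTrigPoly.sum_mul_fourierCard`. -/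
lemma casAlias_add_casAlias_neg {N : ℕ} (hN : 0 < N) {n : ℤ} (h : |2 * n| ≤ N) (φ : ℝ) :
    casAlias N 0 n φ + casAlias N 0 (-n) φ = casD 0 n φ + casD 0 (-n) φ := by
  rcases h.lt_or_eq with h | h
  · rw [casAlias_of_lt 0 h, casAlias_of_lt 0 (by rwa [mul_neg, abs_neg])]
  · have hn : ∀ m : ℤ, |2 * m| = N → casAlias N 0 m φ = (casD 0 m φ + casD 0 (-m) φ) / 2 := by
      intro m hm
      have hb : m.bmod N = -|m| := by
        rw [abs_mul, abs_two] at hm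
        rcases abs_choice m with h' | h'
        · rw [h'] at hm ⊢
          exact Int.bmod_eq_neg (abs_nonneg m |>.trans_eq h') hm.symm
        · rw [h'] at hm ⊢
          rw [neg_neg]
          exact Int.bmod_eq_of_le_mul_two (by omega) (by omega)
      rw [casAlias, hb, if_pos (by rw [abs_mul, abs_two] at hm; linarith)]
      rcases abs_choice m with h' | h' <;> rw [h'] <;> simp [add_comm]
    rw [hn n h, hn (-n) (by rwa [mul_neg, abs_neg]), neg_neg]
    ring

/-- Fourier interpolation reproduces trigonometric polynomials. -/
lemma IsTrigPoly.sum_mul_fourierCard {N : ℕ} (hN : 0 < N) (he : Even N) {t : ℝ → ℝ}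
    (ht : IsTrigPoly N t) (φ : ℝ) :
    ∑ n ∈ Finset.range N, t (nodeφ N n) * fourierCard N n φ = t φ := by
  have hcos : ∀ k ≤ N / 2, ∑ n ∈ Finset.range N,
      Real.cos (k * nodeφ N n) * fourierCard N n φ = Real.cos (k * φ) := by
    intro k hk
    have h := cos_eq_casD k
    push_cast at h
    simp_rw [h, div_mul_eq_mul_div, add_mul]
    rw [← Finset.sum_div, Finset.sum_add_distrib, sum_casD_mul_fourierCard hN,
      sum_casD_mul_fourierCard hN, casAlias_add_casAlias_neg hN (by
        rw [abs_of_nonneg (by positivity)]; obtain ⟨q, rfl⟩ := he; omega)]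
  have hsin : ∀ k < N / 2, ∑ n ∈ Finset.range N,
      Real.sin (k * nodeφ N n) * fourierCard N n φ = Real.sin (k * φ) := by
    intro k hk
    have h := sin_eq_casD k
    push_cast at h
    have hlt : |2 * (k : ℤ)| < N := by
      rw [abs_of_nonneg (by positivity)]; obtain ⟨q, rfl⟩ := he; omega
    simp_rw [h, div_mul_eq_mul_div, sub_mul]
    rw [← Finset.sum_div, Finset.sum_sub_distrib, sum_casD_mul_fourierCard hN,
      sum_casD_mul_fourierCard hN, casAlias_of_lt 0 hlt,
      casAlias_of_lt 0 (by rwa [mul_neg, abs_neg])]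
  obtain ⟨a, b, h⟩ := ht
  simp only [h, add_mul, Finset.sum_mul, Finset.sum_add_distrib]
  congr 1
  · rw [Finset.sum_comm]
    refine Finset.sum_congr rfl fun k hk => ?_
    simp_rw [mul_assoc]
    rw [← Finset.mul_sum, hcos k (by simpa [Nat.lt_succ_iff] using hk)]
  · rw [Finset.sum_comm]
    refine Finset.sum_congr rfl fun k hk => ?_
    simp_rw [mul_assoc]
    rw [← Finset.mul_sum, hsin k (Finset.mem_Ico.1 hk).2]

lemma nodeρ_injOn {M : ℕ} : Set.InjOn (nodeρ M) (Finset.range (M + 1)) :=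
  (strictAntiOn_node M).injOn

lemma nodeρ_mem (M m : ℕ) : nodeρ M m ∈ Set.Icc (-1 : ℝ) 1 :=
  ⟨Real.neg_one_le_cos _, Real.cos_le_one _⟩

/-- The cardinal functions of Chebyshev interpolation. -/
def chebCard (M m : ℕ) (ρ : ℝ) : ℝ :=
  (Lagrange.basis (Finset.range (M + 1)) (nodeρ M) m).eval ρ

lemma chebCard_node {M m i : ℕ} (hm : m ≤ M) (hi : i ≤ M) :
    chebCard M m (nodeρ M i) = if m = i then 1 else 0 := by
  have hm' : m ∈ Finset.range (M + 1) := Finset.mem_range.2 (by omega)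
  have hi' : i ∈ Finset.range (M + 1) := Finset.mem_range.2 (by omega)
  split_ifs with h
  · subst h
    exact Lagrange.eval_basis_self nodeρ_injOn hm'
  · exact Lagrange.eval_basis_of_ne h hi'

lemma sum_eval_mul_chebCard {M : ℕ} {f : ℝ → ℝ} {Q : Polynomial ℝ} (hQ : Q.natDegree ≤ M)
    (h : ∀ m ≤ M, f (nodeρ M m) = Q.eval (nodeρ M m)) (ρ : ℝ) :
    ∑ m ∈ Finset.range (M + 1), f (nodeρ M m) * chebCard M m ρ = Q.eval ρ := by
  have hdeg : Q.degree < (Finset.range (M + 1)).card := by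
    rw [Finset.card_range]
    exact lt_of_le_of_lt Polynomial.degree_le_natDegree (by exact_mod_cast Nat.lt_succ_of_le hQ)
  have := Lagrange.eq_interpolate nodeρ_injOn hdeg
  conv_rhs => rw [this]
  rw [Lagrange.interpolate_apply, Polynomial.eval_finsetSum]
  refine Finset.sum_congr rfl fun m hm => ?_
  rw [Polynomial.eval_mul, Polynomial.eval_C, h m (by simpa [Nat.lt_succ_iff] using hm)]
  rfl

/-- At the nodes `T_a` equals `cos(a m π / M)`, and changing `a` by `2M` moves the angle by a
multiple of `2π`. -/
lemma chebD_node_congr {M : ℕ} (hM : 0 < M) (a : ℤ) (m : ℕ) :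
    chebD 0 a (nodeρ M m) = chebD 0 (a.bmod (2 * M)) (nodeρ M m) := by
  have hM' : (M : ℝ) ≠ 0 := by positivity
  have h : ∀ k, chebD 0 k (nodeρ M m) = Real.cos (k * (m * Real.pi / M)) := fun k =>
    T_real_cos _ k
  have hq := Int.bmod_add_bdiv a (2 * M)
  have : (a : ℝ) * (m * Real.pi / M) = (a.bmod (2 * M) : ℤ) * (m * Real.pi / M) +
      ((a.bdiv (2 * M) * m : ℤ) : ℝ) * (2 * Real.pi) := by
    conv_lhs => rw [← hq]
    push_cast
    field_simp
  rw [h, h, this, Real.cos_add_int_mul_two_pi]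

lemma natAbs_bmod_le {M : ℕ} (hM : 0 < M) (a : ℤ) : (a.bmod (2 * M)).natAbs ≤ M := by
  obtain ⟨-, h1, h2⟩ := bmod_spec (N := 2 * M) (by omega) (even_two_mul M) a
  omega

lemma sum_chebD_mul_chebCard {M : ℕ} (hM : 0 < M) (a : ℤ) (ρ : ℝ) :
    ∑ m ∈ Finset.range (M + 1), chebD 0 a (nodeρ M m) * chebCard M m ρ =
      chebD 0 (a.bmod (2 * M)) ρ :=
  sum_eval_mul_chebCard (f := chebD 0 a) (Q := T ℝ (a.bmod (2 * M)))
    (by rw [natDegree_T]; exact natAbs_bmod_le hM a) (fun m _ => chebD_node_congr hM a m) ρ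

lemma exists_chebCard_eq_sum {M m : ℕ} (hm : m ≤ M) :
    ∃ α : ℕ → ℝ, ∀ ρ, chebCard M m ρ = ∑ j ∈ Finset.range (M + 1), α j * (T ℝ j).eval ρ := by
  have hm' : m ∈ Finset.range (M + 1) := Finset.mem_range.2 (by omega)
  have hdeg : Lagrange.basis (Finset.range (M + 1)) (nodeρ M) m ∈ Polynomial.degreeLT ℝ (M + 1) := by
    rw [Polynomial.mem_degreeLT, Lagrange.degree_basis nodeρ_injOn hm', Finset.card_range,
      Nat.add_sub_cancel]
    exact_mod_cast Nat.lt_succ_self M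
  have hspan := (chebyshevTsequence (R := ℝ)).span_degreeLT (m := M + 1) fun i _ =>
    (Polynomial.leadingCoeff_ne_zero.2 ((chebyshevTsequence (R := ℝ)).ne_zero i)).isUnit
  rw [← hspan, ← Finset.coe_range, Submodule.mem_span_image_finset_iff_exists_fun] at hdeg
  obtain ⟨α, hα⟩ := hdeg
  refine ⟨fun j => if h : j ∈ Finset.range (M + 1) then α ⟨j, h⟩ else 0, fun ρ => ?_⟩
  rw [chebCard, ← hα, Polynomial.eval_finsetSum]
  refine Eq.trans ?_ (Finset.sum_coe_sort (Finset.range (M + 1)) _)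
  refine Finset.sum_congr rfl fun j _ => ?_
  beta_reduce
  rw [Polynomial.eval_smul, smul_eq_mul, dif_pos j.2]
  rfl

lemma IsFCPoly.sum {M N : ℕ} {ι : Type*} (F : Finset ι) {p : ι → ℝ × ℝ → ℝ}
    (hp : ∀ i ∈ F, IsFCPoly M N (p i)) : IsFCPoly M N fun x => ∑ i ∈ F, p i x := by
  classical
  induction F using Finset.induction_on with
  | empty => exact ⟨0, 0, fun ρ φ => by simp⟩
  | insert i F hi ih =>
    obtain ⟨a, b, h⟩ := hp i (Finset.mem_insert_self i F)
    obtain ⟨c, d, h'⟩ := ih fun j hj => hp j (Finset.mem_insert_of_mem hj)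
    refine ⟨a + c, b + d, fun ρ φ => ?_⟩
    simp only [Finset.sum_insert hi, h, h', Pi.add_apply, add_mul, Finset.sum_add_distrib]
    ring

lemma isFCPoly_mul {M N : ℕ} {u t : ℝ → ℝ} (α : ℕ → ℝ)
    (hu : ∀ ρ, u ρ = ∑ j ∈ Finset.range (M + 1), α j * (T ℝ j).eval ρ) (ht : IsTrigPoly N t) :
    IsFCPoly M N fun x => u x.1 * t x.2 := by
  obtain ⟨a, b, h⟩ := ht
  refine ⟨fun k j => a k * α j, fun k j => b k * α j, fun ρ φ => ?_⟩
  simp only [hu, h, Finset.sum_mul]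
  refine Finset.sum_congr rfl fun j _ => ?_
  have e1 : ∀ k : ℕ, a k * α j * Real.cos (k * φ) = α j * (a k * Real.cos (k * φ)) :=
    fun k => by ring
  have e2 : ∀ k : ℕ, b k * α j * Real.sin (k * φ) = α j * (b k * Real.sin (k * φ)) :=
    fun k => by ring
  simp_rw [e1, e2]
  rw [← Finset.mul_sum, ← Finset.mul_sum]
  ring

/-- An explicit formula for the Fourier–Chebyshev interpolant. -/
def fcInterp (M N : ℕ) (v : ℝ × ℝ → ℝ) (x : ℝ × ℝ) : ℝ :=
  ∑ m ∈ Finset.range (M + 1), ∑ n ∈ Finset.range N,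
    v (nodeρ M m, nodeφ N n) * (chebCard M m x.1 * fourierCard N n x.2)

lemma isInterpolant_fcInterp {M N : ℕ} (hN : 0 < N) (he : Even N) (v : ℝ × ℝ → ℝ) :
    IsInterpolant M N v (fcInterp M N v) := by
  constructor
  · refine IsFCPoly.sum _ fun m hm => IsFCPoly.sum _ fun n _ => ?_
    obtain ⟨α, hα⟩ := exists_chebCard_eq_sum (M := M) (m := m)
      (by simpa [Nat.lt_succ_iff] using hm)
    have := isFCPoly_mul α hα ((isTrigPoly_fourierCard hN he n).const_mul (v (nodeρ M m, nodeφ N n)))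
    convert this using 2
    ring
  · intro i hi j hj
    rw [fcInterp, Finset.sum_eq_single_of_mem i (Finset.mem_range.2 (by omega)),
      Finset.sum_eq_single_of_mem j (Finset.mem_range.2 hj)]
    · simp [chebCard_node hi hi, fourierCard_node hj hj]
    · intro n hn hne
      rw [fourierCard_node (Finset.mem_range.1 hn) hj, if_neg hne]
      simp
    · intro m hm hne
      refine Finset.sum_eq_zero fun n _ => ?_
      rw [chebCard_node (by simpa [Nat.lt_succ_iff] using hm) hi, if_neg hne]
      simp

/-- Fourier–Chebyshev polynomials are determined by their values at the nodes. -/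
lemma IsFCPoly.eq_fcInterp {M N : ℕ} (hN : 0 < N) (he : Even N) {p : ℝ × ℝ → ℝ}
    (hp : IsFCPoly M N p) : p = fcInterp M N p := by
  obtain ⟨a, b, h⟩ := hp
  ext ⟨ρ, φ⟩
  set A : ℕ → ℝ → ℝ := fun j φ => ∑ k ∈ Finset.range (N / 2 + 1), a k j * Real.cos (k * φ) +
    ∑ k ∈ Finset.Ico 1 (N / 2), b k j * Real.sin (k * φ) with hA
  have hp' : ∀ ρ φ, p (ρ, φ) = ∑ j ∈ Finset.range (M + 1), A j φ * (T ℝ j).eval ρ := h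
  have hAt : ∀ j, IsTrigPoly N (A j) := fun j => ⟨fun k => a k j, fun k => b k j, fun _ => rfl⟩
  have hφ : IsTrigPoly N fun φ => p (ρ, φ) := by
    simp_rw [hp', mul_comm (A _ _)]
    exact IsTrigPoly.sum _ fun j _ => (hAt j).const_mul _
  have hρ : ∀ φ, ∑ m ∈ Finset.range (M + 1), p (nodeρ M m, φ) * chebCard M m ρ = p (ρ, φ) := by
    intro φ
    set Q : Polynomial ℝ := ∑ j ∈ Finset.range (M + 1), Polynomial.C (A j φ) * T ℝ j with hQ
    have hQe : ∀ ρ, p (ρ, φ) = Q.eval ρ := fun ρ => by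
      simp [hp', hQ, Polynomial.eval_finsetSum]
    rw [hQe]
    refine sum_eval_mul_chebCard (f := fun ρ => p (ρ, φ)) ?_ (fun m _ => hQe _) ρ
    refine Polynomial.natDegree_sum_le_of_forall_le _ _ fun j hj => ?_
    refine (Polynomial.natDegree_C_mul_le _ _).trans ?_
    rw [natDegree_T, Int.natAbs_natCast]
    simpa [Nat.lt_succ_iff] using hj
  rw [← hφ.sum_mul_fourierCard hN he φ]
  simp_rw [← hρ (nodeφ N _), Finset.sum_mul]
  rw [fcInterp, Finset.sum_comm]
  exact Finset.sum_congr rfl fun m _ => Finset.sum_congr rfl fun n _ => by ring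

lemma IsInterpolant.eq_fcInterp {M N : ℕ} (hN : 0 < N) (he : Even N) {v p : ℝ × ℝ → ℝ}
    (h : IsInterpolant M N v p) : p = fcInterp M N v := by
  rw [h.1.eq_fcInterp hN he]
  ext x
  refine Finset.sum_congr rfl fun m hm => Finset.sum_congr rfl fun n hn => ?_
  rw [h.2 m (by simpa [Nat.lt_succ_iff] using hm) n (Finset.mem_range.1 hn)]

lemma existsUnique_isInterpolant {M N : ℕ} (hN : 0 < N) (he : Even N) (v : ℝ × ℝ → ℝ) :
    ∃! p, IsInterpolant M N v p :=
  ⟨fcInterp M N v, isInterpolant_fcInterp hN he v, fun _ h => h.eq_fcInterp hN he⟩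

lemma isInterpolant_interp {M N : ℕ} (hN : 0 < N) (he : Even N) (v : ℝ × ℝ → ℝ) :
    IsInterpolant M N v (interp M N v) := by
  have h := (existsUnique_isInterpolant (M := M) hN he v).exists
  rw [interp, dif_pos h]
  exact h.choose_spec

lemma interp_eq {M N : ℕ} (hN : 0 < N) (he : Even N) (v : ℝ × ℝ → ℝ) :
    interp M N v = fcInterp M N v :=
  (isInterpolant_interp hN he v).eq_fcInterp hN he

lemma memBNM_interp {M N : ℕ} (hN : 0 < N) (he : Even N) {P₀ Q₀ : ℝ → ℝ}
    {P Q : ℝ × ℝ → ℝ} (h : MemB P₀ Q₀ P Q) :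
    MemBNM M N P₀ Q₀ (interp M N P) (interp M N Q) := by
  have hP := isInterpolant_interp (M := M) hN he P
  have hQ := isInterpolant_interp (M := M) hN he Q
  -- The side `ρ = 1` carries the nodes with `m = 0`, so interpolation preserves the Dirichlet data
  -- there.
  have h0 : nodeρ M 0 = 1 := by simp [nodeρ]
  refine ⟨hP.1, hQ.1, fun n hn => ?_⟩
  have hN' : (0 : ℝ) < N := by positivity
  have hmem : nodeφ N n ∈ Set.Icc 0 (2 * Real.pi) := by
    have hnN : (n : ℝ) ≤ N := by exact_mod_cast hn.le
    refine ⟨by unfold nodeφ; positivity, ?_⟩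
    rw [nodeφ, div_le_iff₀ hN']
    nlinarith [Real.pi_pos]
  have h1 := hP.2 0 M.zero_le n hn
  have h2 := hQ.2 0 M.zero_le n hn
  rw [h0] at h1 h2
  rw [h1, h2]
  exact h.2.2 _ hmem

lemma node_mem_DomBar {M N m n : ℕ} (hn : n < N) : (nodeρ M m, nodeφ N n) ∈ DomBar := by
  refine ⟨nodeρ_mem M m, ?_⟩
  have hN' : (0 : ℝ) < N := by exact_mod_cast (by omega : 0 < N)
  have hnN : (n : ℝ) ≤ N := by exact_mod_cast hn.le
  refine ⟨by unfold nodeφ; positivity, ?_⟩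
  rw [nodeφ, div_le_iff₀ hN']
  nlinarith [Real.pi_pos]

/-- Aliasing: the expansion of the interpolant. -/
lemma hasSum_interp {M N : ℕ} (hM : 0 < M) (hN : 0 < N) (he : Even N) {v : ℝ × ℝ → ℝ}
    {p : ℤ × ℤ → ℝ} (hv : ∀ x ∈ DomBar, HasSum (fun a => p a * fcBasis a x) (v x)) (x : ℝ × ℝ) :
    HasSum (fun a : ℤ × ℤ => p a * (chebD 0 (a.1.bmod (2 * M)) x.1 * casAlias N 0 a.2 x.2))
      (interp M N v x) := by
  rw [interp_eq hN he, fcInterp]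
  have h1 : HasSum (fun a => ∑ m ∈ Finset.range (M + 1), ∑ n ∈ Finset.range N,
      p a * fcBasis a (nodeρ M m, nodeφ N n) * (chebCard M m x.1 * fourierCard N n x.2))
      (∑ m ∈ Finset.range (M + 1), ∑ n ∈ Finset.range N,
        v (nodeρ M m, nodeφ N n) * (chebCard M m x.1 * fourierCard N n x.2)) :=
    hasSum_sum fun m _ => hasSum_sum fun n hn =>
      (hv _ (node_mem_DomBar (Finset.mem_range.1 hn))).mul_right _
  refine h1.congr_fun fun a => ?_
  rw [← sum_chebD_mul_chebCard hM, ← sum_casD_mul_fourierCard hN, Finset.sum_mul_sum,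
    Finset.mul_sum]
  refine Finset.sum_congr rfl fun m _ => ?_
  rw [Finset.mul_sum]
  refine Finset.sum_congr rfl fun n _ => ?_
  simp only [fcBasis]
  ring

end

/-! ### Tails of inverse powers along residue classes. -/

section

/-- The weight `(1 + |m|)^(-p)` on `ℤ`. -/
def invWt (p : ℕ) (m : ℤ) : ℝ := (wt p m)⁻¹

lemma invWt_pos (p : ℕ) (m : ℤ) : 0 < invWt p m := inv_pos.2 (wt_pos p m)

lemma one_le_wt (p : ℕ) (m : ℤ) : 1 ≤ wt p m :=
  one_le_pow₀ (by linarith [abs_nonneg (m : ℝ)])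

lemma wt_mono {p q : ℕ} (h : p ≤ q) (m : ℤ) : wt p m ≤ wt q m :=
  pow_le_pow_right₀ (by linarith [abs_nonneg (m : ℝ)]) h

lemma invWt_anti {p q : ℕ} (h : p ≤ q) (m : ℤ) : invWt q m ≤ invWt p m :=
  inv_anti₀ (wt_pos p m) (wt_mono h m)

lemma invWt_add (p q : ℕ) (m : ℤ) : invWt (p + q) m = invWt p m * invWt q m := by
  simp only [invWt, wt, pow_add, mul_inv]

lemma summable_invWt_two : Summable (invWt 2) := by
  have h1 : Summable fun n : ℕ => 1 / ((n : ℝ) + 1) ^ 2 := by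
    have := (summable_nat_add_iff 1).2 (Real.summable_one_div_nat_pow.2 (by norm_num : 1 < 2))
    simpa using this
  rw [summable_int_iff_summable_nat_and_neg]
  constructor <;> refine h1.congr fun n => ?_ <;> simp [invWt, wt, add_comm]

/-- The sum of `(1 + |m|)^(-2)` over `ℤ`, as an extended real number. -/
def invWtSum : ℝ≥0∞ := ∑' m : ℤ, ENNReal.ofReal (invWt 2 m)

lemma invWtSum_ne_top : invWtSum ≠ ⊤ := summable_invWt_two.tsum_ofReal_ne_top

lemma tsum_invWt_le {p : ℕ} (hp : 2 ≤ p) : ∑' m, ENNReal.ofReal (invWt p m) ≤ invWtSum :=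
  ENNReal.tsum_le_tsum fun m => ENNReal.ofReal_le_ofReal (invWt_anti hp m)

/-- Sums over the tail of a residue class. -/
lemma tsum_invWt_class_le {p L : ℕ} (hp : 2 ≤ p) (hL : 0 < L) (κ : ℤ) :
    ∑' m : ℤ, {m : ℤ | m % L = κ ∧ (L : ℤ) ≤ 2 * |m|}.indicator
      (fun m => ENNReal.ofReal (invWt p m)) m ≤
      ENNReal.ofReal (4 ^ p * ((L : ℝ) ^ p)⁻¹) * invWtSum := by
  set r := κ.bmod L with hr
  have hL' : (0 : ℝ) < L := by exact_mod_cast hL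
  have hr2 : |2 * r| ≤ L := by
    have h1 := Int.le_bmod (x := κ) hL
    have h2 := Int.bmod_lt (x := κ) hL
    rw [abs_le]
    omega
  have hinj : Function.Injective fun q : ℤ => r + L * q := by
    intro q q' h
    have : (L : ℤ) * q = L * q' := by simpa using h
    exact mul_left_cancel₀ (by omega : (L : ℤ) ≠ 0) this
  have hsupp : Function.support ({m : ℤ | m % L = κ ∧ (L : ℤ) ≤ 2 * |m|}.indicator
      (fun m => ENNReal.ofReal (invWt p m))) ⊆ Set.range fun q : ℤ => r + L * q := by
    intro m hm
    have hm' := Set.mem_of_indicator_ne_zero hm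
    have h1 : κ.bmod L = m.bmod L := by
      rw [← hm'.1, Int.emod_bmod]
    exact ⟨m.bdiv L, by simp only [hr, h1]; exact Int.bmod_add_bdiv m L⟩
  rw [← hinj.tsum_eq hsupp]
  calc _ ≤ ∑' q : ℤ, ENNReal.ofReal (4 ^ p * ((L : ℝ) ^ p)⁻¹) * ENNReal.ofReal (invWt p q) := by
        refine ENNReal.tsum_le_tsum fun q => ?_
        by_cases hmem : (r + L * q) ∈ {m : ℤ | m % L = κ ∧ (L : ℤ) ≤ 2 * |m|}
        · rw [Set.indicator_of_mem hmem, ← ENNReal.ofReal_mul (by positivity)]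
          apply ENNReal.ofReal_le_ofReal
          -- With `m = r + Lq` one has `L ≤ 2|m|` and `|r| ≤ L/2 ≤ |m|`, hence `L|q| ≤ 2|m|`;
          -- together at most `4|m|`.
          have key : (L : ℝ) * (1 + |(q : ℝ)|) ≤ 4 * (1 + |((r + L * q : ℤ) : ℝ)|) := by
            have h1 : (L : ℝ) ≤ 2 * |((r + L * q : ℤ) : ℝ)| := by exact_mod_cast hmem.2
            have h2 : |2 * (r : ℝ)| ≤ L := by exact_mod_cast hr2
            have h3 : (L : ℝ) * |(q : ℝ)| ≤ |((r + L * q : ℤ) : ℝ)| + |(r : ℝ)| := by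
              have : (L : ℝ) * q = ((r + L * q : ℤ) : ℝ) - r := by push_cast; ring
              rw [← abs_of_pos hL', ← abs_mul, this]
              exact abs_sub _ _
            rw [abs_mul, abs_two] at h2
            linarith
          have hpow := pow_le_pow_left₀ (by positivity) key p
          rw [mul_pow, mul_pow] at hpow
          have h0 : (0 : ℝ) < 1 + |((r + L * q : ℤ) : ℝ)| := by positivity
          rw [invWt, invWt, wt, wt, mul_assoc, ← mul_inv, ← div_eq_mul_inv,
            inv_le_comm₀ (by positivity) (by positivity), inv_div, div_le_iff₀ (by positivity)]
          linarith
        · rw [Set.indicator_of_notMem hmem]; exact zero_le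
    _ ≤ _ := by
        rw [ENNReal.tsum_mul_left]
        gcongr
        exact tsum_invWt_le hp

lemma tsum_indicator_le_sum {ι : Type*} (F : Finset ι) (S : Set ℤ) (T : ι → Set ℤ)
    (h : S ⊆ ⋃ i ∈ F, T i) (f : ℤ → ℝ≥0∞) :
    ∑' m, S.indicator f m ≤ ∑ i ∈ F, ∑' m, (T i).indicator f m := by
  rw [← Summable.tsum_finsetSum fun _ _ => ENNReal.summable]
  refine ENNReal.tsum_le_tsum fun m => ?_
  by_cases hm : m ∈ S
  · obtain ⟨i, hi, hmi⟩ : ∃ i ∈ F, m ∈ T i := by simpa using h hm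
    rw [Set.indicator_of_mem hm, ← Set.indicator_of_mem hmi f]
    exact Finset.single_le_sum (f := fun i => (T i).indicator f m) (fun _ _ => zero_le) hi
  · rw [Set.indicator_of_notMem hm]; exact zero_le

/-- Sums over the tail of `ℤ`. -/
lemma tsum_invWt_tail_le {p L : ℕ} (hp : 2 ≤ p) (hL : 0 < L) :
    ∑' m : ℤ, {m : ℤ | (L : ℤ) ≤ 2 * |m|}.indicator
      (fun m => ENNReal.ofReal (invWt p m)) m ≤
      ENNReal.ofReal (4 ^ p * ((L : ℝ) ^ (p - 1))⁻¹) * invWtSum := by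
  have hL' : (0 : ℝ) < L := by exact_mod_cast hL
  refine (tsum_indicator_le_sum (Finset.range L) _
    (fun κ : ℕ => {m : ℤ | m % L = κ ∧ (L : ℤ) ≤ 2 * |m|}) ?_ _).trans ?_
  · intro m hm
    simp only [Set.mem_iUnion, Finset.mem_range]
    have h1 := Int.emod_nonneg m (by omega : (L : ℤ) ≠ 0)
    have h2 := Int.emod_lt_of_pos m (by omega : (0 : ℤ) < L)
    exact ⟨(m % L).toNat, by omega, by omega, hm⟩
  -- There are `L` classes, each of size `L^{-p}`: summing the full tail loses one power compared
  -- with a single class.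
  · refine (Finset.sum_le_sum (s := Finset.range L) fun (κ : ℕ) _ =>
      tsum_invWt_class_le hp hL (κ : ℤ)).trans (le_of_eq ?_)
    rw [Finset.sum_const, Finset.card_range, nsmul_eq_mul, ← mul_assoc,
      ← ENNReal.ofReal_natCast L, ← ENNReal.ofReal_mul hL'.le]
    congr 2
    obtain ⟨q, rfl⟩ : ∃ q, p = q + 1 := ⟨p - 1, by omega⟩
    rw [Nat.add_sub_cancel, pow_succ (L : ℝ)]
    field_simp

/-- The pair of residue classes `±m mod L`. -/
def resPair (L : ℕ) (m : ℤ) : Finset ℤ := {m % L, (-m) % L}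

lemma resPair_neg (L : ℕ) (m : ℤ) : resPair L (-m) = resPair L m := by
  simp only [resPair, neg_neg, Finset.pair_comm]

lemma resPair_bmod (L : ℕ) (m : ℤ) : resPair L (m.bmod L) = resPair L m := by
  have h : m.bmod L % L = m % L := Int.bmod_emod
  have h' : (-m.bmod L) % L = (-m) % L := Int.ModEq.neg h
  simp only [resPair, h, h']

/-- Sums over the tail of a pair of residue classes. -/
lemma tsum_invWt_resPair_le {p L : ℕ} (hp : 2 ≤ p) (hL : 0 < L) (β : Finset ℤ) :
    ∑' m : ℤ, {m : ℤ | resPair L m = β ∧ (L : ℤ) ≤ 2 * |m|}.indicator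
      (fun m => ENNReal.ofReal (invWt p m)) m ≤
      2 * (ENNReal.ofReal (4 ^ p * ((L : ℝ) ^ p)⁻¹) * invWtSum) := by
  by_cases hβ : ∃ m₀, resPair L m₀ = β
  · obtain ⟨m₀, rfl⟩ := hβ
    refine (tsum_indicator_le_sum Finset.univ _
      (fun i : Bool => {m : ℤ | m % L = (if i then m₀ % L else (-m₀) % L) ∧
        (L : ℤ) ≤ 2 * |m|}) ?_ _).trans ?_
    · rintro m ⟨hm, hm'⟩
      have : m % L ∈ resPair L m₀ := by rw [← hm]; simp [resPair]
      simp only [resPair, Finset.mem_insert, Finset.mem_singleton] at this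
      simp only [Finset.mem_univ, Set.iUnion_true, Set.mem_iUnion]
      rcases this with h | h
      · exact ⟨true, by simpa using h, hm'⟩
      · exact ⟨false, by simpa using h, hm'⟩
    · refine (Finset.sum_le_sum fun i _ => tsum_invWt_class_le hp hL _).trans ?_
      simp
  · have : {m : ℤ | resPair L m = β ∧ (L : ℤ) ≤ 2 * |m|} = ∅ := by
      ext m
      simp only [Set.mem_ofPred_eq, Set.mem_empty_iff_false, iff_false, not_and]
      exact fun h => (hβ ⟨m, h⟩).elim
    simp [this]

/-- Product sums over the indices that are not resolved by the interpolation. -/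
lemma tsum_unresolved_le (S T S' T' : Set ℤ) (u v : ℤ → ℝ≥0∞) :
    ∑' a : ℤ × ℤ, {a : ℤ × ℤ | a.1 ∈ S ∧ a.2 ∈ T ∧ (a.1 ∈ S' ∨ a.2 ∈ T')}.indicator
      (fun a => u a.1 * v a.2) a ≤
      (∑' m, (S ∩ S').indicator u m) * (∑' n, v n) +
        (∑' m, u m) * ∑' n, (T ∩ T').indicator v n := by
  have hprod : ∀ f g : ℤ → ℝ≥0∞, ∑' a : ℤ × ℤ, f a.1 * g a.2 = (∑' m, f m) * ∑' n, g n := by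
    intro f g
    rw [ENNReal.tsum_prod (f := fun m n => f m * g n)]
    simp only [ENNReal.tsum_mul_left, ENNReal.tsum_mul_right]
  rw [← hprod, ← hprod, ← ENNReal.tsum_add]
  refine ENNReal.tsum_le_tsum fun a => ?_
  by_cases ha : a ∈ {a : ℤ × ℤ | a.1 ∈ S ∧ a.2 ∈ T ∧ (a.1 ∈ S' ∨ a.2 ∈ T')}
  · rw [Set.indicator_of_mem ha]
    obtain ⟨h1, h2, h3 | h3⟩ := ha
    · rw [Set.indicator_of_mem (show a.1 ∈ S ∩ S' from ⟨h1, h3⟩)]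
      exact le_self_add
    · rw [Set.indicator_of_mem (show a.2 ∈ T ∩ T' from ⟨h2, h3⟩)]
      exact le_add_self
  · rw [Set.indicator_of_notMem ha]; exact zero_le

end

/-! ### Interpolation errors of the basis functions: size and orthogonality. -/

section

open MeasureTheory Filter Topology Polynomial.Chebyshev

/-- The interpolation error of the basis function `a`, differentiated `j` times in `ρ` and `k`
times in `φ`. -/
def basisErr (M N j k : ℕ) (a : ℤ × ℤ) (x : ℝ × ℝ) : ℝ :=
  chebD j a.1 x.1 * casD k a.2 x.2 -
    chebD j (a.1.bmod (2 * M)) x.1 * casAlias N k a.2 x.2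

/-- The indices that the interpolation does not resolve. -/
def Unresolved (M N : ℕ) (a : ℤ × ℤ) : Prop := (M : ℤ) < |a.1| ∨ (N : ℤ) ≤ 2 * |a.2|

/-- The index `M` has balanced residue `-M`, which is harmless as `T` is even in its index. Hence
`|m| = M` is still resolved, in contrast to `|n| = N/2`. -/
lemma chebD_bmod_of_le {M : ℕ} (hM : 0 < M) (j : ℕ) {m : ℤ} (h : |m| ≤ M) :
    chebD j (m.bmod (2 * M)) = chebD j m := by
  obtain ⟨h1, h2⟩ := abs_le.1 h
  rcases h2.lt_or_eq with h2 | h2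
  · rw [Int.bmod_eq_of_le_mul_two (by push_cast; omega) (by push_cast; omega)]
  · rw [Int.bmod_eq_neg (by omega) (by push_cast; omega), chebD_neg]

lemma basisErr_eq_zero {M N : ℕ} (hM : 0 < M) (j k : ℕ) {a : ℤ × ℤ} (h : ¬ Unresolved M N a) :
    basisErr M N j k a = 0 := by
  rw [Unresolved, not_or, not_lt, not_le] at h
  ext x
  rw [basisErr, chebD_bmod_of_le hM j h.1, casAlias_of_lt k (by rw [abs_mul, abs_two]; exact h.2)]
  simp

lemma abs_bmod_le {L : ℕ} (hL : 0 < L) (he : Even L) (n : ℤ) :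
    |((n.bmod L : ℤ) : ℝ)| ≤ |(n : ℝ)| := by
  have : |n.bmod L| ≤ |n| := by
    by_cases h : |2 * n| < L
    · obtain ⟨h1, h2⟩ := abs_lt.1 h
      rw [Int.bmod_eq_of_le_mul_two (by omega) (by omega)]
    · obtain ⟨-, h1, h2⟩ := bmod_spec hL he n
      rw [abs_mul, abs_two] at h
      rw [abs_le]
      constructor <;> omega
  exact_mod_cast this

lemma abs_casAlias_le {N : ℕ} (hN : 0 < N) (he : Even N) (k : ℕ) (n : ℤ) (φ : ℝ) :
    |casAlias N k n φ| ≤ 2 * |(n : ℝ)| ^ k := by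
  have h1 := abs_casD_le k (n.bmod N) φ
  have h2 := abs_casD_le k (-n.bmod N) φ
  push_cast at h2
  rw [abs_neg] at h2
  have h3 : |((n.bmod N : ℤ) : ℝ)| ^ k ≤ |(n : ℝ)| ^ k :=
    pow_le_pow_left₀ (abs_nonneg _) (abs_bmod_le hN he n) k
  unfold casAlias
  split_ifs
  · rw [abs_div, abs_two]
    have := abs_add_le (casD k (n.bmod N) φ) (casD k (-n.bmod N) φ)
    linarith
  · linarith

lemma continuous_casAlias (N k : ℕ) (n : ℤ) : Continuous (casAlias N k n) := by
  have h1 := continuous_casD k (n.bmod N)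
  have h2 := continuous_casD k (-n.bmod N)
  unfold casAlias
  split_ifs
  · fun_prop
  · exact h1

lemma hasDerivAt_casAlias (N k : ℕ) (n : ℤ) (φ : ℝ) :
    HasDerivAt (casAlias N k n) (casAlias N (k + 1) n φ) φ := by
  unfold casAlias
  split_ifs
  · exact ((hasDerivAt_casD k _ φ).add (hasDerivAt_casD k _ φ)).div_const 2
  · exact hasDerivAt_casD k _ φ

lemma continuous_basisErr (M N j k : ℕ) (a : ℤ × ℤ) : Continuous (basisErr M N j k a) := by
  have h1 := continuous_casD k a.2
  have h2 := continuous_casAlias N k a.2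
  unfold basisErr
  fun_prop

lemma abs_pow_le_wt (p : ℕ) (m : ℤ) : |(m : ℝ)| ^ p ≤ wt p m :=
  pow_le_pow_left₀ (abs_nonneg _) (by linarith) p

/-- Aliasing never increases the modulus of a frequency, so the alias obeys the same bound as the
function itself. -/
lemma abs_basisErr_le {M N j k : ℕ} (hM : 0 < M) (hN : 0 < N) (he : Even N) (hj : j ≤ 1)
    (a : ℤ × ℤ) {x : ℝ × ℝ} (hx : x.1 ∈ Set.Icc (-1 : ℝ) 1) :
    |basisErr M N j k a x| ≤ 4 * (wt (2 * j) a.1 * wt k a.2) := by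
  have h1 := (abs_chebD_le hj a.1 hx).trans (abs_pow_le_wt _ _)
  have h2 := (abs_casD_le k a.2 x.2).trans
    (mul_le_mul_of_nonneg_left (abs_pow_le_wt k a.2) zero_le_two)
  have h3 : |chebD j (a.1.bmod (2 * M)) x.1| ≤ wt (2 * j) a.1 :=
    ((abs_chebD_le hj _ hx).trans (pow_le_pow_left₀ (abs_nonneg _)
      (abs_bmod_le (by omega) (even_two_mul M) a.1) _)).trans (abs_pow_le_wt _ _)
  have h4 := (abs_casAlias_le hN he k a.2 x.2).trans
    (mul_le_mul_of_nonneg_left (abs_pow_le_wt k a.2) zero_le_two)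
  have hw := (wt_pos (2 * j) a.1).le
  calc _ ≤ |chebD j a.1 x.1| * |casD k a.2 x.2| +
        |chebD j (a.1.bmod (2 * M)) x.1| * |casAlias N k a.2 x.2| := by
        rw [← abs_mul, ← abs_mul]; exact abs_sub _ _
    _ ≤ wt (2 * j) a.1 * (2 * wt k a.2) + wt (2 * j) a.1 * (2 * wt k a.2) :=
        add_le_add (mul_le_mul h1 h2 (abs_nonneg _) hw) (mul_le_mul h3 h4 (abs_nonneg _) hw)
    _ = _ := by ring

lemma integral_prod_sq_le {j k : ℕ} (hj : j ≤ 1) (m : ℤ) {g : ℝ → ℝ} (hg : Continuous g) {n : ℤ}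
    (hgn : ∀ φ, |g φ| ≤ 2 * |(n : ℝ)| ^ k) :
    ∫ x : ℝ × ℝ, (chebD j m x.1 * g x.2) ^ 2 ∂fcMeasure ≤
      8 * Real.pi ^ 2 * (wt (3 * j) m * wt (2 * k) n) := by
  have hpi := Real.pi_pos
  simp_rw [mul_pow]
  rw [integral_fcMeasure_prod (fun ρ => chebD j m ρ ^ 2) (fun φ => g φ ^ 2)]
  have h1 := integral_chebD_sq_le hj m
  have h2 : ∫ φ in (0 : ℝ)..(2 * Real.pi), g φ ^ 2 ≤ 8 * Real.pi * wt (2 * k) n := by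
    calc _ ≤ ∫ φ in (0 : ℝ)..(2 * Real.pi), 4 * wt (2 * k) n := by
          refine intervalIntegral.integral_mono (by positivity)
            ((hg.pow 2).intervalIntegrable _ _) (by simp) fun φ => ?_
          have h3 : |g φ| ^ 2 ≤ (2 * |(n : ℝ)| ^ k) ^ 2 :=
            pow_le_pow_left₀ (abs_nonneg _) (hgn φ) 2
          rw [sq_abs, mul_pow, ← pow_mul, mul_comm k] at h3
          have h4 := abs_pow_le_wt (2 * k) n
          simp only
          linarith
      _ = _ := by
          rw [intervalIntegral.integral_const, smul_eq_mul]; ring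
  have h3 : 0 ≤ ∫ φ in (0 : ℝ)..(2 * Real.pi), g φ ^ 2 :=
    intervalIntegral.integral_nonneg (by positivity) fun _ _ => sq_nonneg _
  have hw := wt_pos (3 * j) m
  calc _ ≤ (Real.pi * wt (3 * j) m) * (8 * Real.pi * wt (2 * k) n) :=
        mul_le_mul h1 h2 h3 (by positivity)
    _ = _ := by ring

lemma integral_basisErr_sq_le {M N j k : ℕ} (hM : 0 < M) (hN : 0 < N) (he : Even N)
    (hj : j ≤ 1) (a : ℤ × ℤ) :
    ∫ x, basisErr M N j k a x ^ 2 ∂fcMeasure ≤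
      32 * Real.pi ^ 2 * (wt (3 * j) a.1 * wt (2 * k) a.2) := by
  have h1 := integral_prod_sq_le (k := k) hj a.1 (continuous_casD k a.2) (abs_casD_le k a.2)
  have h2 := integral_prod_sq_le hj (a.1.bmod (2 * M)) (continuous_casAlias N k a.2)
    (abs_casAlias_le hN he k a.2)
  have h3 : wt (3 * j) (a.1.bmod (2 * M)) ≤ wt (3 * j) a.1 :=
    pow_le_pow_left₀ (by positivity)
      (by linarith [abs_bmod_le (L := 2 * M) (by omega) (even_two_mul M) a.1]) _
  have hc1 : Continuous fun x : ℝ × ℝ => (chebD j a.1 x.1 * casD k a.2 x.2) ^ 2 := by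
    have := continuous_casD k a.2
    fun_prop
  have hc2 : Continuous fun x : ℝ × ℝ =>
      (chebD j (a.1.bmod (2 * M)) x.1 * casAlias N k a.2 x.2) ^ 2 := by
    have := continuous_casAlias N k a.2
    fun_prop
  have hi1 := integrable_fcMeasure_of_continuousOn hc1.continuousOn
  have hi2 := integrable_fcMeasure_of_continuousOn hc2.continuousOn
  have hi0 := integrable_fcMeasure_of_continuousOn
    ((continuous_basisErr M N j k a).pow 2).continuousOn
  have hle : ∫ x, basisErr M N j k a x ^ 2 ∂fcMeasure ≤
      ∫ x, (2 * (chebD j a.1 x.1 * casD k a.2 x.2) ^ 2 +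
        2 * (chebD j (a.1.bmod (2 * M)) x.1 * casAlias N k a.2 x.2) ^ 2) ∂fcMeasure := by
    refine integral_mono hi0 ((hi1.const_mul 2).add (hi2.const_mul 2)) fun x => ?_
    simp only [basisErr]
    nlinarith [sq_nonneg (chebD j a.1 x.1 * casD k a.2 x.2 +
      chebD j (a.1.bmod (2 * M)) x.1 * casAlias N k a.2 x.2)]
  rw [integral_add (hi1.const_mul 2) (hi2.const_mul 2), integral_const_mul,
    integral_const_mul] at hle
  have h4 : wt (3 * j) (a.1.bmod (2 * M)) * wt (2 * k) a.2 ≤ wt (3 * j) a.1 * wt (2 * k) a.2 :=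
    mul_le_mul_of_nonneg_right h3 (wt_pos _ _).le
  have h5 := mul_le_mul_of_nonneg_left h4 (by positivity : 0 ≤ 8 * Real.pi ^ 2)
  linarith

/-- The functions that are combinations of two Hartley functions with frequencies in a residue
class. -/
def IsResidual (N k : ℕ) (n : ℤ) (g : ℝ → ℝ) : Prop :=
  ∃ i i' : ℤ, ∃ α α' : ℝ, i % N = n % N ∧ i' % N = n % N ∧
    ∀ φ, g φ = α * casD k i φ + α' * casD k i' φ

lemma isResidual_casD (N k : ℕ) (n : ℤ) : IsResidual N k n (casD k n) :=
  ⟨n, n, 1, 0, rfl, rfl, fun φ => by ring⟩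

lemma isResidual_casAlias (N k : ℕ) (n : ℤ) : IsResidual N k n (casAlias N k n) := by
  have h0 : n.bmod N % N = n % N := Int.bmod_emod
  by_cases h : 2 * n.bmod N = -N
  · refine ⟨n.bmod N, -n.bmod N, 1 / 2, 1 / 2, h0, ?_, fun φ => ?_⟩
    · have : -n.bmod N = n.bmod N + N := by linarith
      rw [this, Int.add_emod_right, h0]
    · rw [casAlias, if_pos h]; ring
  · exact ⟨n.bmod N, n.bmod N, 1, 0, h0, h0, fun φ => by rw [casAlias, if_neg h]; ring⟩

lemma IsResidual.integral_mul_eq_zero {N k : ℕ} {n n' : ℤ} {g g' : ℝ → ℝ}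
    (h : IsResidual N k n g) (h' : IsResidual N k n' g') (hne : n % N ≠ n' % N) :
    ∫ φ in (0 : ℝ)..(2 * Real.pi), g φ * g' φ = 0 := by
  obtain ⟨i, i', α, α', hi, hi', hg⟩ := h
  obtain ⟨l, l', γ, γ', hl, hl', hg'⟩ := h'
  have key : ∀ p q : ℤ, p % N = n % N → q % N = n' % N →
      ∫ φ in (0 : ℝ)..(2 * Real.pi), casD k p φ * casD k q φ = 0 := by
    intro p q hp hq
    exact integral_casD_mul_casD_of_ne k (by rintro rfl; exact hne (hp.symm.trans hq))
  have hint : ∀ (c : ℝ) (p q : ℤ), IntervalIntegrable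
      (fun φ => c * (casD k p φ * casD k q φ)) volume 0 (2 * Real.pi) := fun c p q =>
    (((continuous_casD k p).mul (continuous_casD k q)).const_mul c).intervalIntegrable _ _
  have e : ∀ φ, g φ * g' φ = (α * γ) * (casD k i φ * casD k l φ) +
      (α * γ') * (casD k i φ * casD k l' φ) + ((α' * γ) * (casD k i' φ * casD k l φ) +
      (α' * γ') * (casD k i' φ * casD k l' φ)) := fun φ => by rw [hg, hg']; ring
  simp_rw [e]
  rw [intervalIntegral.integral_add ((hint _ _ _).add (hint _ _ _))
    ((hint _ _ _).add (hint _ _ _)), intervalIntegral.integral_add (hint _ _ _) (hint _ _ _),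
    intervalIntegral.integral_add (hint _ _ _) (hint _ _ _)]
  simp only [intervalIntegral.integral_const_mul, key _ _ hi hl, key _ _ hi hl',
    key _ _ hi' hl, key _ _ hi' hl']
  simp

lemma integral_chebD_mul_eq_zero {L : ℕ} {m m' : ℤ} (h : resPair L m ≠ resPair L m') :
    ∫ x, chebD 0 m x * chebD 0 m' x ∂measureT = 0 := by
  rw [integral_chebD_mul_chebD, if_neg (by rintro rfl; exact h rfl),
    if_neg (by rintro rfl; exact h (resPair_neg _ _))]
  simp

/-- The product of two errors has four terms, each a function of `ρ` times a function of `φ`;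
orthogonality in one variable is enough for each of them. -/
lemma integral_basisErr_mul {M N j k : ℕ} (a b : ℤ × ℤ)
    (h : ∀ f ∈ ({chebD j a.1, chebD j (a.1.bmod (2 * M))} : Set (ℝ → ℝ)),
      ∀ f' ∈ ({chebD j b.1, chebD j (b.1.bmod (2 * M))} : Set (ℝ → ℝ)),
      ∀ g ∈ ({casD k a.2, casAlias N k a.2} : Set (ℝ → ℝ)),
      ∀ g' ∈ ({casD k b.2, casAlias N k b.2} : Set (ℝ → ℝ)),
      (∫ ρ, f ρ * f' ρ ∂measureT) * ∫ φ in (0 : ℝ)..(2 * Real.pi), g φ * g' φ = 0) :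
    ∫ x, basisErr M N j k a x * basisErr M N j k b x ∂fcMeasure = 0 := by
  have key : ∀ f ∈ ({chebD j a.1, chebD j (a.1.bmod (2 * M))} : Set (ℝ → ℝ)),
      ∀ f' ∈ ({chebD j b.1, chebD j (b.1.bmod (2 * M))} : Set (ℝ → ℝ)),
      ∀ g ∈ ({casD k a.2, casAlias N k a.2} : Set (ℝ → ℝ)),
      ∀ g' ∈ ({casD k b.2, casAlias N k b.2} : Set (ℝ → ℝ)),
      ∫ x : ℝ × ℝ, (f x.1 * g x.2) * (f' x.1 * g' x.2) ∂fcMeasure = 0 := by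
    intro f hf f' hf' g hg g' hg'
    rw [← h f hf f' hf' g hg g' hg',
      ← integral_fcMeasure_prod (fun ρ => f ρ * f' ρ) (fun φ => g φ * g' φ)]
    exact integral_congr_ae (.of_forall fun x => by ring)
  have c1 := continuous_casD k a.2
  have c2 := continuous_casAlias N k a.2
  have c3 := continuous_casD k b.2
  have c4 := continuous_casAlias N k b.2
  have hint : ∀ F : ℝ × ℝ → ℝ, Continuous F → Integrable F fcMeasure := fun F hF =>
    integrable_fcMeasure_of_continuousOn hF.continuousOn
  have e : ∀ x, basisErr M N j k a x * basisErr M N j k b x =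
      ((chebD j a.1 x.1 * casD k a.2 x.2) * (chebD j b.1 x.1 * casD k b.2 x.2) -
        (chebD j a.1 x.1 * casD k a.2 x.2) *
          (chebD j (b.1.bmod (2 * M)) x.1 * casAlias N k b.2 x.2)) -
      ((chebD j (a.1.bmod (2 * M)) x.1 * casAlias N k a.2 x.2) *
          (chebD j b.1 x.1 * casD k b.2 x.2) -
        (chebD j (a.1.bmod (2 * M)) x.1 * casAlias N k a.2 x.2) *
          (chebD j (b.1.bmod (2 * M)) x.1 * casAlias N k b.2 x.2)) := fun x => by
    simp only [basisErr]; ring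
  simp_rw [e]
  rw [integral_sub (hint _ (by fun_prop)) (hint _ (by fun_prop)),
    integral_sub (hint _ (by fun_prop)) (hint _ (by fun_prop)),
    integral_sub (hint _ (by fun_prop)) (hint _ (by fun_prop)),
    key _ (by simp) _ (by simp) _ (by simp) _ (by simp),
    key _ (by simp) _ (by simp) _ (by simp) _ (by simp),
    key _ (by simp) _ (by simp) _ (by simp) _ (by simp),
    key _ (by simp) _ (by simp) _ (by simp) _ (by simp)]
  simp

lemma integral_basisErr_mul_of_ne {M N j k : ℕ} {a b : ℤ × ℤ} (h : a.2 % N ≠ b.2 % N) :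
    ∫ x, basisErr M N j k a x * basisErr M N j k b x ∂fcMeasure = 0 := by
  refine integral_basisErr_mul a b fun f _ f' _ g hg g' hg' => ?_
  have hr : IsResidual N k a.2 g := by
    rcases hg with rfl | rfl
    · exact isResidual_casD _ _ _
    · exact isResidual_casAlias _ _ _
  have hr' : IsResidual N k b.2 g' := by
    rcases hg' with rfl | rfl
    · exact isResidual_casD _ _ _
    · exact isResidual_casAlias _ _ _
  rw [hr.integral_mul_eq_zero hr' h, mul_zero]

/-- Restricted to no `ρ`-derivative: the functions `T_m'` are multiples of `U_{m-1}`, which are not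
mutually orthogonal for `ω`. -/
lemma integral_basisErr_zero_mul_of_ne {M N k : ℕ} {a b : ℤ × ℤ}
    (h : resPair (2 * M) a.1 ≠ resPair (2 * M) b.1) :
    ∫ x, basisErr M N 0 k a x * basisErr M N 0 k b x ∂fcMeasure = 0 := by
  refine integral_basisErr_mul a b fun f hf f' hf' g _ g' _ => ?_
  have : ∫ ρ, f ρ * f' ρ ∂measureT = 0 := by
    rcases hf with rfl | rfl <;> rcases hf' with rfl | rfl <;>
      refine integral_chebD_mul_eq_zero (L := 2 * M) ?_ <;> simpa only [resPair_bmod] using h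
  rw [this, zero_mul]

end

/-! ### Weak derivatives of the error series. -/

section

open MeasureTheory Filter Topology Polynomial.Chebyshev

lemma mixedDeriv_one_zero {η : ℝ × ℝ → ℝ} (x : ℝ × ℝ) :
    mixedDeriv 1 0 η x = deriv (fun ρ => η (ρ, x.2)) x.1 := by
  simp [mixedDeriv]

lemma mixedDeriv_zero_one {η : ℝ × ℝ → ℝ} (x : ℝ × ℝ) :
    mixedDeriv 0 1 η x = deriv (fun φ => η (x.1, φ)) x.2 := by
  simp [mixedDeriv]

lemma mixedDeriv_one_one {η : ℝ × ℝ → ℝ} :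
    mixedDeriv 1 1 η = mixedDeriv 1 0 (mixedDeriv 0 1 η) := by
  ext x
  simp [mixedDeriv]

lemma hasDerivAt_slice_fst {η : ℝ × ℝ → ℝ} {x : ℝ × ℝ} (h : DifferentiableAt ℝ η x) :
    HasDerivAt (fun ρ => η (ρ, x.2)) (fderiv ℝ η x (1, 0)) x.1 :=
  h.hasFDerivAt.comp_hasDerivAt (f := fun ρ : ℝ => (ρ, x.2)) x.1
    ((hasDerivAt_id x.1).prodMk (hasDerivAt_const x.1 x.2))

lemma hasDerivAt_slice_snd {η : ℝ × ℝ → ℝ} {x : ℝ × ℝ} (h : DifferentiableAt ℝ η x) :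
    HasDerivAt (fun φ => η (x.1, φ)) (fderiv ℝ η x (0, 1)) x.2 :=
  h.hasFDerivAt.comp_hasDerivAt (f := fun φ : ℝ => (x.1, φ)) x.2
    ((hasDerivAt_const x.2 x.1).prodMk (hasDerivAt_id x.2))

lemma IsTestFun.differentiable {η : ℝ × ℝ → ℝ} (h : IsTestFun η) : Differentiable ℝ η :=
  h.1.differentiable (by simp)

lemma IsTestFun.hasDerivAt_fst {η : ℝ × ℝ → ℝ} (h : IsTestFun η) (ρ φ : ℝ) :
    HasDerivAt (fun ρ => η (ρ, φ)) (mixedDeriv 1 0 η (ρ, φ)) ρ := by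
  rw [mixedDeriv_one_zero]
  exact (hasDerivAt_slice_fst (h.differentiable (ρ, φ))).differentiableAt.hasDerivAt

lemma IsTestFun.hasDerivAt_snd {η : ℝ × ℝ → ℝ} (h : IsTestFun η) (ρ φ : ℝ) :
    HasDerivAt (fun φ => η (ρ, φ)) (mixedDeriv 0 1 η (ρ, φ)) φ := by
  rw [mixedDeriv_zero_one]
  exact (hasDerivAt_slice_snd (h.differentiable (ρ, φ))).differentiableAt.hasDerivAt

lemma IsTestFun.continuous_mixedDeriv_fst {η : ℝ × ℝ → ℝ} (h : IsTestFun η) :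
    Continuous (mixedDeriv 1 0 η) := by
  have e : mixedDeriv 1 0 η = fun x => fderiv ℝ η x (1, 0) := funext fun x => by
    rw [mixedDeriv_one_zero, (hasDerivAt_slice_fst (h.differentiable x)).deriv]
  rw [e]
  exact (h.1.continuous_fderiv (by simp)).clm_apply continuous_const

lemma IsTestFun.mixedDeriv_snd {η : ℝ × ℝ → ℝ} (h : IsTestFun η) :
    IsTestFun (mixedDeriv 0 1 η) := by
  have e : mixedDeriv 0 1 η = fun x => fderiv ℝ η x (0, 1) := funext fun x => by
    rw [mixedDeriv_zero_one, (hasDerivAt_slice_snd (h.differentiable x)).deriv]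
  refine ⟨?_, fun ρ φ => ?_, ?_⟩
  · rw [e]
    exact (h.1.fderiv_right (m := ((⊤ : ℕ∞) : WithTop ℕ∞)) (by simp)).clm_apply contDiff_const
  · simp only [mixedDeriv_zero_one]
    rw [← deriv_comp_add_const]
    congr 1
    exact funext fun t => h.2.1 ρ t
  · obtain ⟨a, ha, h0⟩ := h.2.2
    refine ⟨a, ha, fun ρ φ hρ => ?_⟩
    rw [mixedDeriv_zero_one]
    have : (fun t => η (ρ, t)) = fun _ => 0 := funext fun t => h0 ρ t hρ
    simp [this]

lemma integrableOn_Dom_of_continuousOn {F : ℝ × ℝ → ℝ} (hF : ContinuousOn F DomBar) :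
    IntegrableOn F Dom :=
  (hF.integrableOn_compact isCompact_DomBar).mono_set Dom_subset_DomBar

lemma setIntegral_Dom {F : ℝ × ℝ → ℝ} (hF : Continuous F) :
    ∫ x in Dom, F x = ∫ φ in (0 : ℝ)..(2 * Real.pi), ∫ ρ in (-1 : ℝ)..1, F (ρ, φ) := by
  have hi : Integrable F ((volume.restrict (Set.Ioo (-1) 1)).prod
      (volume.restrict (Set.Ioo 0 (2 * Real.pi)))) := by
    rw [← volume_restrict_Dom]
    exact integrableOn_Dom_of_continuousOn hF.continuousOn
  rw [volume_restrict_Dom, integral_prod_symm _ hi,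
    intervalIntegral.integral_of_le (by positivity), integral_Ioc_eq_integral_Ioo]
  refine integral_congr_ae (.of_forall fun φ => ?_)
  simp only
  rw [intervalIntegral.integral_of_le (by norm_num), integral_Ioc_eq_integral_Ioo]

lemma setIntegral_Dom' {F : ℝ × ℝ → ℝ} (hF : Continuous F) :
    ∫ x in Dom, F x = ∫ ρ in (-1 : ℝ)..1, ∫ φ in (0 : ℝ)..(2 * Real.pi), F (ρ, φ) := by
  have hi : Integrable F ((volume.restrict (Set.Ioo (-1) 1)).prod
      (volume.restrict (Set.Ioo 0 (2 * Real.pi)))) := by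
    rw [← volume_restrict_Dom]
    exact integrableOn_Dom_of_continuousOn hF.continuousOn
  rw [volume_restrict_Dom, integral_prod _ hi,
    intervalIntegral.integral_of_le (by norm_num), integral_Ioc_eq_integral_Ioo]
  refine integral_congr_ae (.of_forall fun φ => ?_)
  simp only
  rw [intervalIntegral.integral_of_le (by positivity), integral_Ioc_eq_integral_Ioo]

/-- Integration by parts in `ρ`. -/
lemma IsTestFun.integral_mul_fst {η : ℝ × ℝ → ℝ} (h : IsTestFun η) {E E' : ℝ × ℝ → ℝ}
    (hE : Continuous E) (hE' : Continuous E')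
    (hd : ∀ ρ φ, HasDerivAt (fun ρ => E (ρ, φ)) (E' (ρ, φ)) ρ) :
    ∫ x in Dom, E x * mixedDeriv 1 0 η x = -∫ x in Dom, E' x * η x := by
  have hη := h.1.continuous
  have hη' := h.continuous_mixedDeriv_fst
  rw [setIntegral_Dom (F := fun x => E x * mixedDeriv 1 0 η x) (hE.mul hη'),
    setIntegral_Dom (F := fun x => E' x * η x) (hE'.mul hη),
    ← intervalIntegral.integral_neg]
  refine intervalIntegral.integral_congr fun φ _ => ?_
  rw [intervalIntegral.integral_mul_deriv_eq_deriv_mul (u := fun ρ => E (ρ, φ))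
    (v := fun ρ => η (ρ, φ)) (fun ρ _ => hd ρ φ) (fun ρ _ => h.hasDerivAt_fst ρ φ)
    (Continuous.intervalIntegrable (by fun_prop) _ _)
    (Continuous.intervalIntegrable (by fun_prop) _ _)]
  obtain ⟨a, ha, h0⟩ := h.2.2
  rw [h0 1 φ (by simpa using ha.le), h0 (-1) φ (by simpa using ha.le)]
  simp

/-- Integration by parts in `φ`. -/
lemma IsTestFun.integral_mul_snd {η : ℝ × ℝ → ℝ} (h : IsTestFun η) {E E' : ℝ × ℝ → ℝ}
    (hE : Continuous E) (hE' : Continuous E')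
    (hd : ∀ ρ φ, HasDerivAt (fun φ => E (ρ, φ)) (E' (ρ, φ)) φ)
    (hp : ∀ ρ φ, E (ρ, φ + 2 * Real.pi) = E (ρ, φ)) :
    ∫ x in Dom, E x * mixedDeriv 0 1 η x = -∫ x in Dom, E' x * η x := by
  have hη := h.1.continuous
  have hη' := h.mixedDeriv_snd.1.continuous
  rw [setIntegral_Dom' (F := fun x => E x * mixedDeriv 0 1 η x) (hE.mul hη'),
    setIntegral_Dom' (F := fun x => E' x * η x) (hE'.mul hη),
    ← intervalIntegral.integral_neg]
  refine intervalIntegral.integral_congr fun ρ _ => ?_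
  rw [intervalIntegral.integral_mul_deriv_eq_deriv_mul (u := fun φ => E (ρ, φ))
    (v := fun φ => η (ρ, φ)) (fun φ _ => hd ρ φ) (fun φ _ => h.hasDerivAt_snd ρ φ)
    (Continuous.intervalIntegrable (by fun_prop) _ _)
    (Continuous.intervalIntegrable (by fun_prop) _ _)]
  have h1 := hp ρ 0
  have h2 := h.2.1 ρ 0
  rw [zero_add] at h1 h2
  rw [h1, h2]
  simp

lemma hasDerivAt_basisErr_fst (M N j k : ℕ) (a : ℤ × ℤ) (ρ φ : ℝ) :
    HasDerivAt (fun ρ => basisErr M N j k a (ρ, φ)) (basisErr M N (j + 1) k a (ρ, φ)) ρ :=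
  ((hasDerivAt_chebD j a.1 ρ).mul_const (casD k a.2 φ)).sub
    ((hasDerivAt_chebD j (a.1.bmod (2 * M)) ρ).mul_const (casAlias N k a.2 φ))

lemma hasDerivAt_basisErr_snd (M N j k : ℕ) (a : ℤ × ℤ) (ρ φ : ℝ) :
    HasDerivAt (fun φ => basisErr M N j k a (ρ, φ)) (basisErr M N j (k + 1) a (ρ, φ)) φ :=
  ((hasDerivAt_casD k a.2 φ).const_mul (chebD j a.1 ρ)).sub
    ((hasDerivAt_casAlias N k a.2 φ).const_mul (chebD j (a.1.bmod (2 * M)) ρ))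

lemma basisErr_periodic (M N j k : ℕ) (a : ℤ × ℤ) (ρ φ : ℝ) :
    basisErr M N j k a (ρ, φ + 2 * Real.pi) = basisErr M N j k a (ρ, φ) := by
  simp only [basisErr, casAlias, casD_periodic]

lemma IsTestFun.integral_basisErr_mul {η : ℝ × ℝ → ℝ} (h : IsTestFun η) {M N j k : ℕ}
    (hj : j ≤ 1) (hk : k ≤ 1) (a : ℤ × ℤ) :
    ∫ x in Dom, basisErr M N 0 0 a x * mixedDeriv j k η x =
      (-1) ^ (j + k) * ∫ x in Dom, basisErr M N j k a x * η x := by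
  have hfst : ∀ (k : ℕ) {η : ℝ × ℝ → ℝ}, IsTestFun η →
      ∫ x in Dom, basisErr M N 0 k a x * mixedDeriv 1 0 η x =
        -∫ x in Dom, basisErr M N 1 k a x * η x := fun k η h =>
    h.integral_mul_fst (continuous_basisErr _ _ _ _ _) (continuous_basisErr _ _ _ _ _)
      (hasDerivAt_basisErr_fst M N 0 k a)
  have hsnd : ∀ (j : ℕ) {η : ℝ × ℝ → ℝ}, IsTestFun η →
      ∫ x in Dom, basisErr M N j 0 a x * mixedDeriv 0 1 η x =
        -∫ x in Dom, basisErr M N j 1 a x * η x := fun j η h =>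
    h.integral_mul_snd (continuous_basisErr _ _ _ _ _) (continuous_basisErr _ _ _ _ _)
      (hasDerivAt_basisErr_snd M N j 0 a) (basisErr_periodic M N j 0 a)
  interval_cases j <;> interval_cases k
  · simp [mixedDeriv]
  · simpa using hsnd 0 h
  · simpa using hfst 0 h
  -- The `φ`-derivative of a test function is again a test function, so the two integrations by
  -- parts can be chained.
  · rw [mixedDeriv_one_one, hfst 0 h.mixedDeriv_snd, hsnd 1 h]
    simp

/-- The series with coefficients `q` of the differentiated interpolation errors. -/
def errSeries (M N : ℕ) (q : ℤ × ℤ → ℝ) (j k : ℕ) (x : ℝ × ℝ) : ℝ :=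
  ∑' a, q a * basisErr M N j k a x

lemma abs_mul_basisErr_le {M N j k : ℕ} (hM : 0 < M) (hN : 0 < N) (he : Even N) (hj : j ≤ 1)
    (hk : k ≤ 1) (q : ℤ × ℤ → ℝ) (a : ℤ × ℤ) {x : ℝ × ℝ} (hx : x.1 ∈ Set.Icc (-1 : ℝ) 1) :
    ‖q a * basisErr M N j k a x‖ ≤ 4 * (|q a| * (wt 2 a.1 * wt 1 a.2)) := by
  have h1 := abs_basisErr_le (k := k) hM hN he hj a hx
  have h2 : wt (2 * j) a.1 * wt k a.2 ≤ wt 2 a.1 * wt 1 a.2 :=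
    mul_le_mul (wt_mono (by omega) _) (wt_mono hk _) (wt_pos _ _).le (wt_pos _ _).le
  rw [norm_mul, Real.norm_eq_abs, Real.norm_eq_abs]
  calc _ ≤ |q a| * (4 * (wt 2 a.1 * wt 1 a.2)) := by gcongr; linarith
    _ = _ := by ring

section Series

variable {M N j k : ℕ} {q : ℤ × ℤ → ℝ}

lemma hasSum_errSeries (hM : 0 < M) (hN : 0 < N) (he : Even N) (hj : j ≤ 1) (hk : k ≤ 1)
    (hq : Summable fun a => |q a| * (wt 2 a.1 * wt 1 a.2)) {x : ℝ × ℝ}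
    (hx : x.1 ∈ Set.Icc (-1 : ℝ) 1) :
    HasSum (fun a => q a * basisErr M N j k a x) (errSeries M N q j k x) :=
  (Summable.of_norm_bounded (hq.mul_left 4) fun a =>
    abs_mul_basisErr_le hM hN he hj hk q a hx).hasSum

lemma continuousOn_errSeries (hM : 0 < M) (hN : 0 < N) (he : Even N) (hj : j ≤ 1) (hk : k ≤ 1)
    (hq : Summable fun a => |q a| * (wt 2 a.1 * wt 1 a.2)) :
    ContinuousOn (errSeries M N q j k) DomBar :=
  continuousOn_tsum (fun a => (continuous_const.mul (continuous_basisErr M N j k a)).continuousOn)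
    (hq.mul_left 4) fun a _ hx => abs_mul_basisErr_le hM hN he hj hk q a hx.1

lemma hasSum_integral_errSeries_mul (hM : 0 < M) (hN : 0 < N) (he : Even N) (hj : j ≤ 1)
    (hk : k ≤ 1) (hq : Summable fun a => |q a| * (wt 2 a.1 * wt 1 a.2)) {ψ : ℝ × ℝ → ℝ}
    (hψ : Continuous ψ) :
    HasSum (fun a => q a * ∫ x in Dom, basisErr M N j k a x * ψ x)
      (∫ x in Dom, errSeries M N q j k x * ψ x) := by
  obtain ⟨C, hC⟩ := isCompact_DomBar.exists_bound_of_continuousOn hψ.continuousOn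
  have hfin : IsFiniteMeasure ((volume : Measure (ℝ × ℝ)).restrict Dom) := by
    rw [volume_restrict_Dom]; infer_instance
  have := hasSum_integral_of_dominated_convergence (μ := volume.restrict Dom)
    (F := fun a x => q a * (basisErr M N j k a x * ψ x))
    (f := fun x => errSeries M N q j k x * ψ x)
    (fun a _ => 4 * (|q a| * (wt 2 a.1 * wt 1 a.2)) * C)
    (fun a => (continuous_const.mul
      ((continuous_basisErr M N j k a).mul hψ)).aestronglyMeasurable) ?_
    (.of_forall fun x => (hq.mul_left 4).mul_right C) (integrable_const _) ?_
  · simpa only [integral_const_mul] using this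
  · intro a
    filter_upwards [ae_restrict_mem measurableSet_Dom] with x hx
    rw [← mul_assoc, norm_mul]
    have := wt_pos 2 a.1
    have := wt_pos 1 a.2
    exact mul_le_mul (abs_mul_basisErr_le hM hN he hj hk q a (fst_mem_Icc hx))
      (hC x (Dom_subset_DomBar hx)) (norm_nonneg _) (by positivity)
  · filter_upwards [ae_restrict_mem measurableSet_Dom] with x hx
    simpa only [mul_assoc] using
      (hasSum_errSeries hM hN he hj hk hq (fst_mem_Icc hx)).mul_right (ψ x)

lemma IsTestFun.continuous_mixedDeriv {η : ℝ × ℝ → ℝ} (h : IsTestFun η) (hj : j ≤ 1)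
    (hk : k ≤ 1) : Continuous (mixedDeriv j k η) := by
  interval_cases j <;> interval_cases k
  · have : mixedDeriv 0 0 η = η := by ext x; simp [mixedDeriv]
    rw [this]
    exact h.1.continuous
  · exact h.mixedDeriv_snd.1.continuous
  · exact h.continuous_mixedDeriv_fst
  · rw [mixedDeriv_one_one]
    exact h.mixedDeriv_snd.continuous_mixedDeriv_fst

/-- The weak identity holds for each term by integration by parts and survives summation by
dominated convergence; no classical differentiability of `v` enters. -/
lemma isWeakDeriv_errSeries (hM : 0 < M) (hN : 0 < N) (he : Even N) (hj : j ≤ 1)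
    (hk : k ≤ 1) (hq : Summable fun a => |q a| * (wt 2 a.1 * wt 1 a.2)) {v : ℝ × ℝ → ℝ}
    (hv : Set.EqOn v (errSeries M N q 0 0) Dom) :
    IsWeakDeriv j k v (errSeries M N q j k) := by
  refine ⟨(integrableOn_Dom_of_continuousOn (continuousOn_errSeries hM hN he zero_le_one
    zero_le_one hq)).congr_fun hv.symm measurableSet_Dom, integrableOn_Dom_of_continuousOn
    (continuousOn_errSeries hM hN he hj hk hq), fun η hη => ?_⟩
  rw [setIntegral_congr_fun (g := fun x => errSeries M N q 0 0 x * mixedDeriv j k η x)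
    measurableSet_Dom fun x hx => by simp only [hv hx]]
  have h1 := hasSum_integral_errSeries_mul hM hN he zero_le_one zero_le_one hq
    (hη.continuous_mixedDeriv hj hk)
  have h2 := (hasSum_integral_errSeries_mul hM hN he hj hk hq hη.1.continuous).mul_left
    ((-1) ^ (j + k))
  refine h1.unique (h2.congr_fun fun a => ?_)
  rw [hη.integral_basisErr_mul hj hk]
  ring

end Series

end

/-! ### The `L²` estimate of the error series by alias classes. -/

section

open MeasureTheory Filter Topology Polynomial.Chebyshev

/-- The class of an index, such that basis errors of different classes are orthogonal. -/
def errClass (M N j : ℕ) (a : ℤ × ℤ) : Finset ℤ × ℤ :=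
  (if j = 0 then resPair (2 * M) a.1 else ∅, a.2 % N)

lemma integral_basisErr_mul_of_errClass_ne {M N j k : ℕ} {a b : ℤ × ℤ}
    (h : errClass M N j a ≠ errClass M N j b) :
    ∫ x, basisErr M N j k a x * basisErr M N j k b x ∂fcMeasure = 0 := by
  by_cases h2 : a.2 % N = b.2 % N
  · by_cases hj : j = 0
    · subst hj
      refine integral_basisErr_zero_mul_of_ne fun h1 => h ?_
      simp only [errClass, if_true, h1, h2]
    · exact (h (by simp only [errClass, if_neg hj, h2])).elim
  · exact integral_basisErr_mul_of_ne h2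

lemma wt_mul_invWt {p q : ℕ} (h : p ≤ q) (m : ℤ) : wt p m / wt q m = invWt (q - p) m := by
  obtain ⟨r, rfl⟩ := Nat.exists_eq_add_of_le h
  have h1 := (wt_pos p m).ne'
  rw [Nat.add_sub_cancel_left, invWt, show wt (p + r) m = wt p m * wt r m from pow_add _ _ _]
  have h2 := (wt_pos r m).ne'
  field_simp

lemma wt_sq (p : ℕ) (m : ℤ) : wt p m ^ 2 = wt (2 * p) m := by
  simp only [wt]; rw [← pow_mul, mul_comm]

lemma inv_pow_two_mul_le {M : ℕ} (hM : 0 < M) (p : ℕ) :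
    (((2 * M : ℕ) : ℝ) ^ p)⁻¹ ≤ ((M : ℝ) ^ p)⁻¹ := by
  have : (0 : ℝ) < M := by exact_mod_cast hM
  gcongr
  linarith

/-- For `j = 0` only two residue classes modulo `2M` contribute, giving `M^{-2l}`. For `j = 1` the
class carries no information on `m`, and the whole tail of exponent `2l - 3` gives `M^{-(2l-4)}`,
again the square of `M^{-(l-2j)}`. -/
lemma tsum_errClass_fst_le {l M j : ℕ} (hl : 3 ≤ l) (hM : 0 < M) (hj : j ≤ 1) (β : Finset ℤ) :
    ∑' m : ℤ, ({m : ℤ | (if j = 0 then resPair (2 * M) m else ∅) = β} ∩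
      {m : ℤ | ((2 * M : ℕ) : ℤ) ≤ 2 * |m|}).indicator
      (fun m => ENNReal.ofReal (invWt (2 * l - 3 * j) m)) m ≤
      ENNReal.ofReal (2 * 4 ^ (2 * l) * (((M : ℝ) ^ (l - 2 * j))⁻¹) ^ 2) * invWtSum := by
  have hM' : (0 : ℝ) < M := by exact_mod_cast hM
  interval_cases j
  · simp only [if_true, mul_zero, Nat.sub_zero]
    refine (tsum_invWt_resPair_le (p := 2 * l) (L := 2 * M) (by omega) (by omega) β).trans ?_
    rw [← mul_assoc, ← ENNReal.ofReal_ofNat 2, ← ENNReal.ofReal_mul (by norm_num)]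
    refine mul_le_mul_left (ENNReal.ofReal_le_ofReal ?_) _
    have := inv_pow_two_mul_le hM (2 * l)
    rw [inv_pow, ← pow_mul, mul_comm l 2, mul_assoc]
    gcongr
  · calc _ ≤ ∑' m : ℤ, {m : ℤ | ((2 * M : ℕ) : ℤ) ≤ 2 * |m|}.indicator
          (fun m => ENNReal.ofReal (invWt (2 * l - 3 * 1) m)) m :=
          ENNReal.tsum_le_tsum fun m => Set.indicator_le_indicator_of_subset
            Set.inter_subset_right (fun _ => zero_le) m
      _ ≤ _ := tsum_invWt_tail_le (p := 2 * l - 3 * 1) (L := 2 * M) (by omega) (by omega)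
      _ ≤ _ := by
          refine mul_le_mul_left (ENNReal.ofReal_le_ofReal ?_) _
          have h1 := inv_pow_two_mul_le hM (2 * l - 3 * 1 - 1)
          have h2 : (4 : ℝ) ^ (2 * l - 3 * 1) ≤ 2 * 4 ^ (2 * l) := by
            have : (4 : ℝ) ^ (2 * l - 3 * 1) ≤ 4 ^ (2 * l) :=
              pow_le_pow_right₀ (by norm_num) (by omega)
            have : (0 : ℝ) < 4 ^ (2 * l) := by positivity
            linarith
          rw [inv_pow, ← pow_mul, show (l - 2 * 1) * 2 = 2 * l - 3 * 1 - 1 by omega]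
          gcongr

lemma tsum_errClass_snd_le {s N k : ℕ} (hs : 2 ≤ s) (hN : 0 < N) (hk : k ≤ 1) (κ : ℤ) :
    ∑' n : ℤ, ({n : ℤ | n % N = κ} ∩ {n : ℤ | (N : ℤ) ≤ 2 * |n|}).indicator
      (fun n => ENNReal.ofReal (invWt (2 * s - 2 * k) n)) n ≤
      ENNReal.ofReal (2 * 4 ^ (2 * s) * (((N : ℝ) ^ (s - k))⁻¹) ^ 2) * invWtSum := by
  refine (tsum_invWt_class_le (p := 2 * s - 2 * k) (by omega) hN κ).trans ?_
  refine mul_le_mul_left (ENNReal.ofReal_le_ofReal ?_) _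
  have h2 : (4 : ℝ) ^ (2 * s - 2 * k) ≤ 2 * 4 ^ (2 * s) := by
    have : (4 : ℝ) ^ (2 * s - 2 * k) ≤ 4 ^ (2 * s) :=
      pow_le_pow_right₀ (by norm_num) (by omega)
    have : (0 : ℝ) < 4 ^ (2 * s) := by positivity
    linarith
  rw [inv_pow, ← pow_mul, show (s - k) * 2 = 2 * s - 2 * k by omega]
  gcongr

lemma integral_basisErr_div_le {l s M N j k : ℕ} (hl : 3 ≤ l) (hs : 2 ≤ s) (hM : 0 < M)
    (hN : 0 < N) (he : Even N) (hj : j ≤ 1) (hk : k ≤ 1) (a : ℤ × ℤ) :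
    (∫ x, basisErr M N j k a x ^ 2 ∂fcMeasure) / (wt l a.1 * wt s a.2) ^ 2 ≤
      32 * Real.pi ^ 2 * (invWt (2 * l - 3 * j) a.1 * invWt (2 * s - 2 * k) a.2) := by
  have h1 := wt_pos l a.1
  have h2 := wt_pos s a.2
  calc _ ≤ 32 * Real.pi ^ 2 * (wt (3 * j) a.1 * wt (2 * k) a.2) / (wt l a.1 * wt s a.2) ^ 2 := by
        gcongr
        exact integral_basisErr_sq_le hM hN he hj a
    _ = _ := by
        rw [mul_pow, wt_sq, wt_sq, mul_div_assoc, mul_div_mul_comm, wt_mul_invWt (by omega),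
          wt_mul_invWt (by omega)]

/-- This is the fibre constant required by `integral_sum_sq_le`. Resolved indices contribute
nothing; for the others one index is large and supplies the decay, while the sum over the remaining
index is merely finite. -/
lemma exists_sum_errClass_le {l s : ℕ} (hl : 3 ≤ l) (hs : 2 ≤ s) : ∃ C : ℝ, 0 ≤ C ∧
    ∀ {M N j k : ℕ}, 0 < M → 0 < N → Even N → j ≤ 1 → k ≤ 1 → ∀ (F : Finset (ℤ × ℤ)) β,
      ∑ a ∈ F with errClass M N j a = β,
        (∫ x, basisErr M N j k a x ^ 2 ∂fcMeasure) / (wt l a.1 * wt s a.2) ^ 2 ≤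
      C * ((((M : ℝ) ^ (l - 2 * j))⁻¹) ^ 2 + (((N : ℝ) ^ (s - k))⁻¹) ^ 2) := by
  refine ⟨32 * Real.pi ^ 2 * ((2 * 4 ^ (2 * l) + 2 * 4 ^ (2 * s)) * invWtSum.toReal ^ 2),
    by positivity, fun {M N j k} hM hN he hj hk F β => ?_⟩
  set A := (((M : ℝ) ^ (l - 2 * j))⁻¹) ^ 2 with hA
  set B := (((N : ℝ) ^ (s - k))⁻¹) ^ 2 with hB
  have hA0 : 0 ≤ A := by positivity
  have hB0 : 0 ≤ B := by positivity
  set Z := invWtSum.toReal with hZ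
  have hZ' : invWtSum = ENNReal.ofReal Z := (ENNReal.ofReal_toReal invWtSum_ne_top).symm
  have hZ0 : 0 ≤ Z := ENNReal.toReal_nonneg
  set u : ℤ → ℝ≥0∞ := fun m => ENNReal.ofReal (invWt (2 * l - 3 * j) m)
  set v : ℤ → ℝ≥0∞ := fun n => ENNReal.ofReal (invWt (2 * s - 2 * k) n)
  set S : Set ℤ := {m : ℤ | (if j = 0 then resPair (2 * M) m else ∅) = β.1}
  set T : Set ℤ := {n : ℤ | n % N = β.2}
  set S' : Set ℤ := {m : ℤ | ((2 * M : ℕ) : ℤ) ≤ 2 * |m|}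
  set T' : Set ℤ := {n : ℤ | (N : ℤ) ≤ 2 * |n|}
  set I : ℤ × ℤ → ℝ≥0∞ := {a : ℤ × ℤ | a.1 ∈ S ∧ a.2 ∈ T ∧ (a.1 ∈ S' ∨ a.2 ∈ T')}.indicator
      (fun a => u a.1 * v a.2) with hI
  refine (ENNReal.ofReal_le_ofReal_iff (by positivity)).1 ?_
  calc ENNReal.ofReal (∑ a ∈ F with errClass M N j a = β,
        (∫ x, basisErr M N j k a x ^ 2 ∂fcMeasure) / (wt l a.1 * wt s a.2) ^ 2)
      ≤ ∑ a ∈ F with errClass M N j a = β, ENNReal.ofReal (32 * Real.pi ^ 2) * I a := by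
        rw [ENNReal.ofReal_sum_of_nonneg fun a _ =>
          div_nonneg (integral_nonneg fun _ => sq_nonneg _) (sq_nonneg _)]
        refine Finset.sum_le_sum fun a ha => ?_
        have hβ := (Finset.mem_filter.1 ha).2
        by_cases hu : Unresolved M N a
        · rw [hI, Set.indicator_of_mem, ← ENNReal.ofReal_mul (invWt_pos _ _).le,
            ← ENNReal.ofReal_mul (by positivity)]
          · exact ENNReal.ofReal_le_ofReal (integral_basisErr_div_le hl hs hM hN he hj hk a)
          · refine ⟨congrArg Prod.fst hβ, congrArg Prod.snd hβ, hu.imp (fun h => ?_) id⟩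
            simp only [S', Set.mem_ofPred_eq]
            omega
        · rw [basisErr_eq_zero hM j k hu]
          simp
    _ ≤ ENNReal.ofReal (32 * Real.pi ^ 2) * ∑' a, I a := by
        rw [← Finset.mul_sum]
        exact mul_le_mul_right (ENNReal.sum_le_tsum _) _
    _ ≤ ENNReal.ofReal (32 * Real.pi ^ 2) *
        (ENNReal.ofReal (2 * 4 ^ (2 * l) * A) * invWtSum * invWtSum +
          invWtSum * (ENNReal.ofReal (2 * 4 ^ (2 * s) * B) * invWtSum)) := by
        refine mul_le_mul_right ((tsum_unresolved_le S T S' T' u v).trans ?_) _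
        exact add_le_add (mul_le_mul' (tsum_errClass_fst_le hl hM hj _) (tsum_invWt_le (by omega)))
          (mul_le_mul' (tsum_invWt_le (by omega)) (tsum_errClass_snd_le hs hN hk _))
    _ ≤ _ := by
        rw [hZ', ← ENNReal.ofReal_mul (by positivity), ← ENNReal.ofReal_mul (by positivity),
          ← ENNReal.ofReal_mul (by positivity), ← ENNReal.ofReal_mul (by positivity),
          ← ENNReal.ofReal_add (by positivity) (by positivity),
          ← ENNReal.ofReal_mul (by positivity)]
        refine ENNReal.ofReal_le_ofReal ?_
        rw [mul_assoc (32 * Real.pi ^ 2)]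
        refine mul_le_mul_of_nonneg_left ?_ (by positivity)
        have h1 : 0 ≤ 2 * 4 ^ (2 * l) * Z ^ 2 * B := by positivity
        have h2 : 0 ≤ 2 * 4 ^ (2 * s) * Z ^ 2 * A := by positivity
        nlinarith

/-- The `L²` bound for the error series. -/
lemma exists_lintegral_errSeries_le {l s : ℕ} (hl : 3 ≤ l) (hs : 2 ≤ s) : ∃ C : ℝ, 0 ≤ C ∧
    ∀ {M N j k : ℕ}, 0 < M → 0 < N → Even N → j ≤ 1 → k ≤ 1 → ∀ q : ℤ × ℤ → ℝ,
      (Summable fun a => |q a| * (wt 2 a.1 * wt 1 a.2)) →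
      ∫⁻ x, ‖errSeries M N q j k x‖ₑ ^ 2 ∂fcMeasure ≤
        ENNReal.ofReal (C * ((((M : ℝ) ^ (l - 2 * j))⁻¹) ^ 2 + (((N : ℝ) ^ (s - k))⁻¹) ^ 2)) *
          ∑' a, ENNReal.ofReal ((wt l a.1 * wt s a.2 * q a) ^ 2) := by
  obtain ⟨C, hC0, hC⟩ := exists_sum_errClass_le hl hs
  refine ⟨C, hC0, fun {M N j k} hM hN he hj hk q hq => ?_⟩
  set K := C * ((((M : ℝ) ^ (l - 2 * j))⁻¹) ^ 2 + (((N : ℝ) ^ (s - k))⁻¹) ^ 2)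
  have hK : 0 ≤ K := by positivity
  have hfin : ∀ F : Finset (ℤ × ℤ),
      ∫⁻ x, ‖∑ a ∈ F, q a * basisErr M N j k a x‖ₑ ^ 2 ∂fcMeasure ≤
      ENNReal.ofReal K * ∑' a, ENNReal.ofReal ((wt l a.1 * wt s a.2 * q a) ^ 2) := by
    intro F
    have hcont : Continuous fun x => ∑ a ∈ F, q a * basisErr M N j k a x :=
      continuous_finsetSum _ fun a _ => continuous_const.mul (continuous_basisErr M N j k a)
    have h1 := integral_sum_sq_le F (basisErr M N j k) q (fun a => wt l a.1 * wt s a.2)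
      (errClass M N j) (ν := fcMeasure) (K := K) (fun a b =>
        integrable_fcMeasure_of_continuousOn ((continuous_basisErr M N j k a).mul
          (continuous_basisErr M N j k b)).continuousOn)
      (fun a b h => integral_basisErr_mul_of_errClass_ne h)
      (fun a => mul_pos (wt_pos _ _) (wt_pos _ _)) (hC hM hN he hj hk F)
    have h2 : ∫⁻ x, ‖∑ a ∈ F, q a * basisErr M N j k a x‖ₑ ^ 2 ∂fcMeasure =
        ENNReal.ofReal (∫ x, (∑ a ∈ F, q a * basisErr M N j k a x) ^ 2 ∂fcMeasure) := by
      rw [ofReal_integral_eq_lintegral_ofReal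
        (f := fun x => (∑ a ∈ F, q a * basisErr M N j k a x) ^ 2)
        (integrable_fcMeasure_of_continuousOn (hcont.pow 2).continuousOn)
        (.of_forall fun x => sq_nonneg _)]
      refine lintegral_congr fun x => ?_
      rw [← ofReal_norm, ← ENNReal.ofReal_pow (norm_nonneg _), Real.norm_eq_abs, sq_abs]
    rw [h2]
    refine (ENNReal.ofReal_le_ofReal h1).trans ?_
    rw [ENNReal.ofReal_mul hK, ENNReal.ofReal_sum_of_nonneg fun a _ => sq_nonneg _]
    exact mul_le_mul_right (ENNReal.sum_le_tsum _) _
  have hlim : ∀ᵐ x ∂fcMeasure, Tendsto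
      (fun F : Finset (ℤ × ℤ) => ‖∑ a ∈ F, q a * basisErr M N j k a x‖ₑ ^ 2) atTop
      (𝓝 (‖errSeries M N q j k x‖ₑ ^ 2)) := by
    filter_upwards [ae_mem_Dom] with x hx
    exact ((ENNReal.continuous_pow 2).tendsto _).comp
      ((hasSum_errSeries hM hN he hj hk hq (fst_mem_Icc hx)).enorm)
  -- Fatou's lemma along the finite partial sums, all of which satisfy the bound.
  calc ∫⁻ x, ‖errSeries M N q j k x‖ₑ ^ 2 ∂fcMeasure
      = ∫⁻ x, liminf (fun F : Finset (ℤ × ℤ) =>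
          ‖∑ a ∈ F, q a * basisErr M N j k a x‖ₑ ^ 2) atTop ∂fcMeasure :=
        lintegral_congr_ae (hlim.mono fun x hx => hx.liminf_eq.symm)
    _ ≤ liminf (fun F : Finset (ℤ × ℤ) =>
          ∫⁻ x, ‖∑ a ∈ F, q a * basisErr M N j k a x‖ₑ ^ 2 ∂fcMeasure) atTop := by
        refine lintegral_liminf_le' fun F => ?_
        have hcont : Continuous fun x => ∑ a ∈ F, q a * basisErr M N j k a x :=
          continuous_finsetSum _ fun a _ => continuous_const.mul (continuous_basisErr M N j k a)
        exact (hcont.enorm.measurable.pow_const 2).aemeasurable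
    _ ≤ _ := by
        refine (liminf_le_liminf (.of_forall hfin)).trans ?_
        rw [liminf_const]

end

/-! ### The interpolation error in the Sobolev norms. -/

section

open MeasureTheory Filter Topology Polynomial.Chebyshev

lemma summable_sq_of_tsum_ne_top {A : Type*} {X : A → ℝ}
    (h : ∑' a, ENNReal.ofReal (X a ^ 2) ≠ ⊤) : Summable fun a => X a ^ 2 := by
  refine (ENNReal.summable_toReal h).congr fun a => ?_
  rw [ENNReal.toReal_ofReal (sq_nonneg _)]

lemma summable_invWt_prod : Summable fun a : ℤ × ℤ => (invWt 1 a.1 * invWt 1 a.2) ^ 2 := by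
  refine (summable_invWt_two.mul_of_nonneg summable_invWt_two (fun m => (invWt_pos 2 m).le)
    fun m => (invWt_pos 2 m).le).congr fun a => ?_
  rw [mul_pow, sq (invWt 1 a.1), sq (invWt 1 a.2), ← invWt_add, ← invWt_add]

/-- The Cauchy–Schwarz inequality for a square summable family and the inverse weights. -/
lemma summable_abs_mul_invWt {X : ℤ × ℤ → ℝ} (h : Summable fun a => X a ^ 2) :
    Summable fun a => |X a| * (invWt 1 a.1 * invWt 1 a.2) := by
  refine Summable.of_nonneg_of_le (fun a => ?_) (fun a => ?_) (h.add summable_invWt_prod)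
  · have := invWt_pos 1 a.1
    have := invWt_pos 1 a.2
    positivity
  · nlinarith [sq_abs (X a), sq_nonneg (|X a| - invWt 1 a.1 * invWt 1 a.2), sq_nonneg (X a),
      sq_nonneg (invWt 1 a.1 * invWt 1 a.2)]

lemma tsum_abs_mul_invWt_le {X : ℤ × ℤ → ℝ} (h : Summable fun a => X a ^ 2) :
    ∑' a, |X a| * (invWt 1 a.1 * invWt 1 a.2) ≤
      √(∑' a : ℤ × ℤ, (invWt 1 a.1 * invWt 1 a.2) ^ 2) * √(∑' a, X a ^ 2) := by
  refine (summable_abs_mul_invWt h).tsum_le_of_sum_le fun F => ?_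
  rw [← Real.sqrt_mul (tsum_nonneg fun a => sq_nonneg _), mul_comm (∑' a : ℤ × ℤ, _)]
  refine Real.le_sqrt_of_sq_le ((Finset.sum_mul_sq_le_sq_mul_sq F _ _).trans ?_)
  simp only [sq_abs]
  exact mul_le_mul (h.sum_le_tsum F fun a _ => sq_nonneg _)
    (summable_invWt_prod.sum_le_tsum F fun a _ => sq_nonneg _)
    (Finset.sum_nonneg fun a _ => sq_nonneg _) (tsum_nonneg fun a => sq_nonneg _)

lemma wt_eq_mul_invWt {p q : ℕ} (h : p ≤ q) (m : ℤ) : wt p m = wt q m * invWt (q - p) m := by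
  rw [← wt_mul_invWt h, mul_div_cancel₀ _ (wt_pos q m).ne']

/-- From `l ≥ 3` and `s ≥ 2` one spare power remains in each variable beyond the weights needed for
first derivatives; the spare powers are square summable and turn `ℓ²` control into absolute
convergence. -/
lemma abs_mul_wt_le {l s : ℕ} (hl : 3 ≤ l) (hs : 2 ≤ s) (q : ℤ × ℤ → ℝ) (a : ℤ × ℤ) :
    |q a| * (wt 2 a.1 * wt 1 a.2) ≤
      |wt l a.1 * wt s a.2 * q a| * (invWt 1 a.1 * invWt 1 a.2) := by
  have h1 := wt_pos l a.1
  have h2 := wt_pos s a.2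
  have h3 := invWt_pos 1 a.1
  rw [wt_eq_mul_invWt (by omega : 2 ≤ l), wt_eq_mul_invWt (by omega : 1 ≤ s), abs_mul,
    abs_of_pos (mul_pos h1 h2)]
  have h5 : invWt (l - 2) a.1 ≤ invWt 1 a.1 := invWt_anti (by omega) _
  have h6 : invWt (s - 1) a.2 ≤ invWt 1 a.2 := invWt_anti (by omega) _
  have h7 := (invWt_pos (s - 1) a.2).le
  calc _ = wt l a.1 * wt s a.2 * |q a| * (invWt (l - 2) a.1 * invWt (s - 1) a.2) := by ring
    _ ≤ _ := by gcongr

/-- The coefficients of the interpolation error in the basis errors. -/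
def errCoeff (P : ℝ × ℝ → ℝ) (a : ℤ × ℤ) : ℝ := -(fcCoeff P a / (2 * Real.pi ^ 2))

lemma exists_tsum_errCoeff_le (l s : ℕ) : ∃ C : ℝ, 0 ≤ C ∧ ∀ P : ℝ × ℝ → ℝ,
    ContinuousOn P DomBar → MemSob s l P →
      ∑' a : ℤ × ℤ, ENNReal.ofReal ((wt l a.1 * wt s a.2 * errCoeff P a) ^ 2) ≤
        ENNReal.ofReal C * sobNorm s l P ^ 2 := by
  obtain ⟨C, hC, H⟩ := exists_tsum_fcCoeff_le l s
  refine ⟨C.toReal, ENNReal.toReal_nonneg, fun P hP hm => ?_⟩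
  rw [ENNReal.ofReal_toReal hC]
  refine le_trans (ENNReal.tsum_le_tsum fun a => ENNReal.ofReal_le_ofReal ?_) (H P hP hm)
  have h1 : (1 : ℝ) ≤ 2 * Real.pi ^ 2 := by nlinarith [Real.pi_gt_three]
  have h2 : (wt l a.1 * wt s a.2 * errCoeff P a) ^ 2 =
      (wt l a.1 * wt s a.2 * fcCoeff P a) ^ 2 / (2 * Real.pi ^ 2) ^ 2 := by
    rw [errCoeff]; ring
  rw [h2]
  exact div_le_self (sq_nonneg _) (one_le_pow₀ h1)

section Expansion

variable {l s : ℕ} {P : ℝ × ℝ → ℝ}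

lemma summable_errCoeff_sq (hP : ContinuousOn P DomBar) (hm : MemSob s l P) :
    Summable fun a : ℤ × ℤ => (wt l a.1 * wt s a.2 * errCoeff P a) ^ 2 := by
  obtain ⟨C, -, H⟩ := exists_tsum_errCoeff_le l s
  refine summable_sq_of_tsum_ne_top (ne_top_of_le_ne_top ?_ (H P hP hm))
  have : sobNorm s l P ≠ ⊤ := hm.ne
  finiteness

lemma summable_errCoeff (hl : 3 ≤ l) (hs : 2 ≤ s) (hP : ContinuousOn P DomBar)
    (hm : MemSob s l P) : Summable fun a => |errCoeff P a| * (wt 2 a.1 * wt 1 a.2) := by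
  refine Summable.of_nonneg_of_le (fun a => ?_) (fun a => abs_mul_wt_le hl hs _ a)
    (summable_abs_mul_invWt (summable_errCoeff_sq hP hm))
  have := wt_pos 2 a.1
  have := wt_pos 1 a.2
  positivity

lemma hasSum_errCoeff_fcBasis (hl : 3 ≤ l) (hs : 2 ≤ s) (hP : ContinuousOn P DomBar)
    (hm : MemSob s l P) {x : ℝ × ℝ} (hx : x ∈ DomBar) :
    HasSum (fun a => -errCoeff P a * fcBasis a x) (P x) := by
  have hpi := Real.pi_pos
  have hsum : Summable fun a => |fcCoeff P a| := by
    refine Summable.of_nonneg_of_le (fun a => abs_nonneg _) (fun a => ?_)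
      ((summable_errCoeff hl hs hP hm).mul_left (2 * Real.pi ^ 2))
    have h1 : |fcCoeff P a| = 2 * Real.pi ^ 2 * |errCoeff P a| := by
      rw [errCoeff, abs_neg, abs_div, abs_of_pos (a := 2 * Real.pi ^ 2) (by positivity)]
      field_simp
    rw [h1]
    have := one_le_mul_of_one_le_of_one_le (one_le_wt 2 a.1) (one_le_wt 1 a.2)
    exact mul_le_mul_of_nonneg_left (le_mul_of_one_le_right (abs_nonneg _) this) (by positivity)
  simpa only [errCoeff, neg_neg] using hasSum_fcBasis hP hsum hx

/-- The interpolation error is the sum of the basis errors. -/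
lemma interp_sub_eq (hl : 3 ≤ l) (hs : 2 ≤ s) (hP : ContinuousOn P DomBar)
    (hm : MemSob s l P) {M N : ℕ} (hM : 0 < M) (hN : 0 < N) (he : Even N) {x : ℝ × ℝ}
    (hx : x ∈ DomBar) : interp M N P x - P x = errSeries M N (errCoeff P) 0 0 x := by
  have h1 := hasSum_interp hM hN he (fun x hx => hasSum_errCoeff_fcBasis hl hs hP hm hx) x
  -- The error is interpolant minus function, whereas `basisErr` is function minus alias; hence the
  -- sign in `errCoeff`.
  have h2 := h1.sub (hasSum_errCoeff_fcBasis hl hs hP hm hx)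
  refine (h2.congr_fun fun a => ?_).unique (hasSum_errSeries hM hN he zero_le_one zero_le_one
    (summable_errCoeff hl hs hP hm) hx.1)
  simp only [basisErr, fcBasis]
  ring

end Expansion

lemma derivSq_le {j k : ℕ} {v g : ℝ × ℝ → ℝ} (h : IsWeakDeriv j k v g) :
    derivSq j k v ≤ ∫⁻ x, ‖g x‖ₑ ^ 2 ∂fcMeasure := by
  rw [lintegral_fcMeasure]
  exact iInf₂_le g h

lemma inv_pow_le_zpow {M p : ℕ} (hM : 0 < M) {z : ℤ} (h : -(p : ℤ) ≤ z) :
    ((M : ℝ) ^ p)⁻¹ ≤ (M : ℝ) ^ z := by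
  rw [← zpow_natCast, ← zpow_neg]
  exact zpow_le_zpow_right₀ (by exact_mod_cast hM) h

/-- The interpolation error in the weighted Sobolev norms. -/
theorem exists_sobNorm_interp_sub_le {l s : ℕ} (hl : 2 < l) (hs : 1 < s) : ∃ c : ℝ, 0 < c ∧
    ∀ α β M N : ℕ, α ≤ 1 → β ≤ 1 → 1 ≤ M → 1 ≤ N → Even N → ∀ P : ℝ × ℝ → ℝ,
      ContinuousOn P DomBar → MemSob s l P →
      sobNorm β α (fun x => interp M N P x - P x) ≤
        ENNReal.ofReal c * starNorm α β l s P *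
          ENNReal.ofReal ((M : ℝ) ^ (2 * (α : ℤ) - (l : ℤ)) +
            (N : ℝ) ^ ((β : ℤ) - (s : ℤ))) := by
  obtain ⟨C₁, hC₁, H₁⟩ := exists_lintegral_errSeries_le hl hs
  obtain ⟨C₂, hC₂, H₂⟩ := exists_tsum_errCoeff_le l s
  -- At most four pairs `(j, k)` occur in the squared norm; the added one keeps the constant
  -- positive.
  refine ⟨√(4 * (C₁ * C₂)) + 1, by positivity, fun α β M N hα hβ hM hN he P hP hm => ?_⟩
  set A := (M : ℝ) ^ (2 * (α : ℤ) - (l : ℤ)) + (N : ℝ) ^ ((β : ℤ) - (s : ℤ)) with hA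
  have hA0 : 0 ≤ A := by positivity
  have hd : ∀ k ≤ β, ∀ j ≤ α, derivSq j k (fun x => interp M N P x - P x) ≤
      ENNReal.ofReal (C₁ * C₂ * A ^ 2) * sobNorm s l P ^ 2 := by
    intro k hk j hj
    have hq := summable_errCoeff hl hs hP hm
    refine (derivSq_le (isWeakDeriv_errSeries (M := M) (N := N) hM hN he (hj.trans hα)
      (hk.trans hβ) hq fun x hx =>
        interp_sub_eq hl hs hP hm hM hN he (Dom_subset_DomBar hx))).trans ?_
    refine (H₁ hM hN he (hj.trans hα) (hk.trans hβ) _ hq).trans ?_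
    refine (mul_le_mul' (ENNReal.ofReal_le_ofReal (q := C₁ * A ^ 2) ?_)
      (H₂ P hP hm)).trans (le_of_eq ?_)
    · have h1 : ((M : ℝ) ^ (l - 2 * j))⁻¹ ≤ (M : ℝ) ^ (2 * (α : ℤ) - (l : ℤ)) :=
        inv_pow_le_zpow hM (by omega)
      have h2 : ((N : ℝ) ^ (s - k))⁻¹ ≤ (N : ℝ) ^ ((β : ℤ) - (s : ℤ)) :=
        inv_pow_le_zpow hN (by omega)
      have h3 : (0 : ℝ) ≤ ((M : ℝ) ^ (l - 2 * j))⁻¹ := by positivity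
      have h4 : (0 : ℝ) ≤ ((N : ℝ) ^ (s - k))⁻¹ := by positivity
      refine mul_le_mul_of_nonneg_left ?_ hC₁
      calc _ ≤ (((M : ℝ) ^ (l - 2 * j))⁻¹ + ((N : ℝ) ^ (s - k))⁻¹) ^ 2 := by nlinarith
        _ ≤ A ^ 2 := pow_le_pow_left₀ (by positivity) (add_le_add h1 h2) 2
    · rw [← mul_assoc, ← ENNReal.ofReal_mul (by positivity)]
      congr 2
      ring
  have hsq : sobNorm β α (fun x => interp M N P x - P x) ^ 2 ≤
      (ENNReal.ofReal (√(4 * (C₁ * C₂)) + 1) * starNorm α β l s P * ENNReal.ofReal A) ^ 2 := by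
    rw [sobNorm_sq]
    calc _ ≤ ∑ k ∈ Finset.range (β + 1), ∑ j ∈ Finset.range (α + 1),
          ENNReal.ofReal (C₁ * C₂ * A ^ 2) * sobNorm s l P ^ 2 :=
          Finset.sum_le_sum fun k hk => Finset.sum_le_sum fun j hj =>
            hd k (by simpa [Nat.lt_succ_iff] using hk) j (by simpa [Nat.lt_succ_iff] using hj)
      _ = ((β + 1) * (α + 1) : ℕ) * (ENNReal.ofReal (C₁ * C₂ * A ^ 2) * sobNorm s l P ^ 2) := by
          simp only [Finset.sum_const, Finset.card_range, nsmul_eq_mul]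
          push_cast
          ring
      _ ≤ (4 : ℕ) * (ENNReal.ofReal (C₁ * C₂ * A ^ 2) * sobNorm s l P ^ 2) := by
          gcongr
          nlinarith
      _ = ENNReal.ofReal (4 * (C₁ * C₂)) * sobNorm s l P ^ 2 * ENNReal.ofReal A ^ 2 := by
          rw [← ENNReal.ofReal_pow hA0, ← mul_assoc, ← ENNReal.ofReal_natCast,
            ← ENNReal.ofReal_mul (by positivity), 
            mul_right_comm (ENNReal.ofReal (4 * (C₁ * C₂))), ← ENNReal.ofReal_mul (by positivity)]
          congr 2
          push_cast
          ring
      _ ≤ ENNReal.ofReal ((√(4 * (C₁ * C₂)) + 1) ^ 2) * starNorm α β l s P ^ 2 *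
          ENNReal.ofReal A ^ 2 := by
          gcongr
          · nlinarith [Real.sq_sqrt (by positivity : 0 ≤ 4 * (C₁ * C₂)),
              Real.sqrt_nonneg (4 * (C₁ * C₂))]
          -- Of the three norms in `starNorm` only the strongest, of order `s` in `φ` and `l` in
          -- `ρ`, is needed.
          · exact le_max_of_le_right (le_max_right _ _)
      _ = _ := by
          rw [ENNReal.ofReal_pow (by positivity)]
          ring
  exact (ENNReal.pow_le_pow_left_iff two_ne_zero).1 hsq

end

/-! ### Uniform bounds for functions, errors and first derivatives. -/

section

open MeasureTheory Filter Topology Polynomial.Chebyshev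

lemma isOpen_Dom : IsOpen Dom := isOpen_Ioo.prod isOpen_Ioo

lemma DomBar_mem_nhds {x : ℝ × ℝ} (hx : x ∈ Dom) : DomBar ∈ 𝓝 x :=
  mem_of_superset (isOpen_Dom.mem_nhds hx) Dom_subset_DomBar

lemma DomBar_subset_closure : DomBar ⊆ closure Dom := by
  rw [Dom, closure_prod_eq, closure_Ioo (by norm_num), closure_Ioo (by positivity)]
  rfl

lemma uniqueDiffOn_DomBar : UniqueDiffOn ℝ DomBar :=
  (uniqueDiffOn_Icc (by norm_num)).prod (uniqueDiffOn_Icc (by positivity))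

section Derivatives

variable {v w : ℝ × ℝ → ℝ} {x : ℝ × ℝ}

lemma differentiableAt_of_contDiffOn (hv : ContDiffOn ℝ 1 v DomBar) (hx : x ∈ Dom) :
    DifferentiableAt ℝ v x :=
  (hv.contDiffAt (DomBar_mem_nhds hx)).differentiableAt one_ne_zero

lemma hasDerivAt_dρ (hv : ContDiffOn ℝ 1 v DomBar) (hx : x ∈ Dom) :
    HasDerivAt (fun ρ => v (ρ, x.2)) (dρ v x) x.1 := by
  rw [dρ, fderivWithin_of_mem_nhds (DomBar_mem_nhds hx)]
  exact hasDerivAt_slice_fst (differentiableAt_of_contDiffOn hv hx)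

lemma hasDerivAt_dφ (hv : ContDiffOn ℝ 1 v DomBar) (hx : x ∈ Dom) :
    HasDerivAt (fun φ => v (x.1, φ)) (dφ v x) x.2 := by
  rw [dφ, fderivWithin_of_mem_nhds (DomBar_mem_nhds hx)]
  exact hasDerivAt_slice_snd (differentiableAt_of_contDiffOn hv hx)

lemma continuousOn_dρ (hv : ContDiffOn ℝ 1 v DomBar) : ContinuousOn (dρ v) DomBar :=
  (hv.continuousOn_fderivWithin uniqueDiffOn_DomBar le_rfl).clm_apply continuousOn_const

lemma continuousOn_dφ (hv : ContDiffOn ℝ 1 v DomBar) : ContinuousOn (dφ v) DomBar :=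
  (hv.continuousOn_fderivWithin uniqueDiffOn_DomBar le_rfl).clm_apply continuousOn_const

lemma dρ_sub (hv : ContDiffOn ℝ 1 v DomBar) (hw : ContDiffOn ℝ 1 w DomBar) (hx : x ∈ DomBar) :
    dρ (fun x => v x - w x) x = dρ v x - dρ w x := by
  rw [dρ, fderivWithin_fun_sub (uniqueDiffOn_DomBar x hx)
    ((hv.differentiableOn one_ne_zero) x hx) ((hw.differentiableOn one_ne_zero) x hx)]
  rfl

lemma dφ_sub (hv : ContDiffOn ℝ 1 v DomBar) (hw : ContDiffOn ℝ 1 w DomBar) (hx : x ∈ DomBar) :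
    dφ (fun x => v x - w x) x = dφ v x - dφ w x := by
  rw [dφ, fderivWithin_fun_sub (uniqueDiffOn_DomBar x hx)
    ((hv.differentiableOn one_ne_zero) x hx) ((hw.differentiableOn one_ne_zero) x hx)]
  rfl

variable {A : Type*} {q u : A → ℝ} {E E' : A → ℝ × ℝ → ℝ}

/-- Termwise differentiation in `ρ`. -/
lemma hasSum_dρ (hv : ContDiffOn ℝ 1 v DomBar) (h : ∀ y ∈ Dom, HasSum (fun a => q a * E a y) (v y))
    (hd : ∀ a ρ φ, HasDerivAt (fun ρ => E a (ρ, φ)) (E' a (ρ, φ)) ρ) (hu : Summable u)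
    (hb : ∀ a, ∀ y ∈ Dom, ‖q a * E' a y‖ ≤ u a) (hx : x ∈ Dom) :
    HasSum (fun a => q a * E' a x) (dρ v x) := by
  have hs := (Summable.of_norm_bounded hu fun a => hb a x hx).hasSum
  have h1 := hasDerivAt_tsum_of_isPreconnected (g := fun a ρ => q a * E a (ρ, x.2))
    (g' := fun a ρ => q a * E' a (ρ, x.2)) hu isOpen_Ioo isPreconnected_Ioo
    (fun a ρ _ => (hd a ρ x.2).const_mul (q a)) (fun a ρ hρ => hb a (ρ, x.2) ⟨hρ, hx.2⟩)
    hx.1 (h x hx).summable hx.1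
  have h2 : (fun ρ => v (ρ, x.2)) =ᶠ[𝓝 x.1] fun ρ => ∑' a, q a * E a (ρ, x.2) := by
    filter_upwards [isOpen_Ioo.mem_nhds hx.1] with ρ hρ using (h (ρ, x.2) ⟨hρ, hx.2⟩).tsum_eq.symm
  rw [(hasDerivAt_dρ hv hx).unique (h1.congr_of_eventuallyEq h2)]
  exact hs

/-- Termwise differentiation in `φ`. -/
lemma hasSum_dφ (hv : ContDiffOn ℝ 1 v DomBar) (h : ∀ y ∈ Dom, HasSum (fun a => q a * E a y) (v y))
    (hd : ∀ a ρ φ, HasDerivAt (fun φ => E a (ρ, φ)) (E' a (ρ, φ)) φ) (hu : Summable u)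
    (hb : ∀ a, ∀ y ∈ Dom, ‖q a * E' a y‖ ≤ u a) (hx : x ∈ Dom) :
    HasSum (fun a => q a * E' a x) (dφ v x) := by
  have hs := (Summable.of_norm_bounded hu fun a => hb a x hx).hasSum
  have h1 := hasDerivAt_tsum_of_isPreconnected (g := fun a φ => q a * E a (x.1, φ))
    (g' := fun a φ => q a * E' a (x.1, φ)) hu isOpen_Ioo isPreconnected_Ioo
    (fun a φ _ => (hd a x.1 φ).const_mul (q a)) (fun a φ hφ => hb a (x.1, φ) ⟨hx.1, hφ⟩)
    hx.2 (h x hx).summable hx.2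
  have h2 : (fun φ => v (x.1, φ)) =ᶠ[𝓝 x.2] fun φ => ∑' a, q a * E a (x.1, φ) := by
    filter_upwards [isOpen_Ioo.mem_nhds hx.2] with φ hφ using (h (x.1, φ) ⟨hx.1, hφ⟩).tsum_eq.symm
  rw [(hasDerivAt_dφ hv hx).unique (h1.congr_of_eventuallyEq h2)]
  exact hs

/-- The value and the first partial derivatives of `v` at `x` are at most `B`. -/
def C1Bound (v : ℝ × ℝ → ℝ) (x : ℝ × ℝ) (B : ℝ) : Prop := |v x| ≤ B ∧ |dρ v x| ≤ B ∧ |dφ v x| ≤ B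

lemma c1Bound_of_hasSum {E : ℕ → ℕ → A → ℝ × ℝ → ℝ} (hv : ContDiffOn ℝ 1 v DomBar)
    (h : ∀ y ∈ Dom, HasSum (fun a => q a * E 0 0 a y) (v y))
    (hd : ∀ a ρ φ, HasDerivAt (fun ρ => E 0 0 a (ρ, φ)) (E 1 0 a (ρ, φ)) ρ)
    (hd' : ∀ a ρ φ, HasDerivAt (fun φ => E 0 0 a (ρ, φ)) (E 0 1 a (ρ, φ)) φ) (hu : Summable u)
    (hb : ∀ j ≤ 1, ∀ k ≤ 1, ∀ a, ∀ y ∈ Dom, ‖q a * E j k a y‖ ≤ u a) (hx : x ∈ Dom) :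
    C1Bound v x (∑' a, u a) := by
  have key : ∀ {f : A → ℝ} {s : ℝ}, HasSum f s → (∀ a, ‖f a‖ ≤ u a) → |s| ≤ ∑' a, u a := by
    intro f s hf hfu
    rw [← hf.tsum_eq, ← Real.norm_eq_abs]
    exact tsum_of_norm_bounded hu.hasSum hfu
  exact ⟨key (h x hx) fun a => hb 0 zero_le_one 0 zero_le_one a x hx,
    key (hasSum_dρ hv h hd hu (hb 1 le_rfl 0 zero_le_one) hx)
      fun a => hb 1 le_rfl 0 zero_le_one a x hx,
    key (hasSum_dφ hv h hd' hu (hb 0 zero_le_one 1 le_rfl) hx)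
      fun a => hb 0 zero_le_one 1 le_rfl a x hx⟩

end Derivatives

lemma IsFCPoly.contDiff {M N : ℕ} {p : ℝ × ℝ → ℝ} (h : IsFCPoly M N p) : ContDiff ℝ 1 p := by
  obtain ⟨a, b, hp⟩ := h
  have : p = fun x : ℝ × ℝ => ∑ j ∈ Finset.range (M + 1),
      (∑ k ∈ Finset.range (N / 2 + 1), a k j * Real.cos (k * x.2) +
        ∑ k ∈ Finset.Ico 1 (N / 2), b k j * Real.sin (k * x.2)) *
      (Polynomial.Chebyshev.T ℝ j).eval x.1 := funext fun x => hp x.1 x.2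
  rw [this]
  have hT : ∀ j : ℕ, ContDiff ℝ 1 fun x : ℝ × ℝ => (Polynomial.Chebyshev.T ℝ j).eval x.1 :=
    fun j => (Polynomial.contDiff_aeval (Polynomial.Chebyshev.T ℝ j) 1).comp contDiff_fst
  exact ContDiff.sum fun j _ => ((ContDiff.sum fun k _ => by fun_prop).add
    (ContDiff.sum fun k _ => by fun_prop)).mul (hT j)

/-- The weighted `ℓ¹` norm of the error coefficients is controlled by the Sobolev norm. -/
lemma exists_tsum_abs_errCoeff_le (l s : ℕ) : ∃ C : ℝ, 0 ≤ C ∧ ∀ P : ℝ × ℝ → ℝ,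
    ContinuousOn P DomBar → MemSob s l P →
      ∑' a : ℤ × ℤ, |wt l a.1 * wt s a.2 * errCoeff P a| * (invWt 1 a.1 * invWt 1 a.2) ≤
        C * (sobNorm s l P).toReal := by
  obtain ⟨C, hC0, H⟩ := exists_tsum_errCoeff_le l s
  refine ⟨√(∑' a : ℤ × ℤ, (invWt 1 a.1 * invWt 1 a.2) ^ 2) * √C, by positivity,
    fun P hP hm => ?_⟩
  refine (tsum_abs_mul_invWt_le (summable_errCoeff_sq hP hm)).trans ?_
  rw [mul_assoc]
  refine mul_le_mul_of_nonneg_left ?_ (Real.sqrt_nonneg _)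
  have h1 := H P hP hm
  have hS : sobNorm s l P = ENNReal.ofReal (sobNorm s l P).toReal :=
    (ENNReal.ofReal_toReal hm.ne).symm
  have hS0 : 0 ≤ (sobNorm s l P).toReal := ENNReal.toReal_nonneg
  rw [← ENNReal.ofReal_tsum_of_nonneg (fun a => sq_nonneg _) (summable_errCoeff_sq hP hm), hS,
    ← ENNReal.ofReal_pow hS0, ← ENNReal.ofReal_mul hC0,
    ENNReal.ofReal_le_ofReal_iff (by positivity)] at h1
  calc _ ≤ √(C * (sobNorm s l P).toReal ^ 2) := Real.sqrt_le_sqrt h1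
    _ = _ := by rw [Real.sqrt_mul hC0, Real.sqrt_sq hS0]

lemma invWt_le_of_le {p m : ℕ} {n : ℤ} (hm : 0 < m) (h : (m : ℤ) ≤ |n|) :
    invWt p n ≤ ((m : ℝ) ^ p)⁻¹ := by
  have h1 : (m : ℝ) ≤ |(n : ℝ)| := by exact_mod_cast h
  have h2 : (0 : ℝ) < m := by exact_mod_cast hm
  rw [invWt, wt]
  gcongr
  linarith

/-- The decay of the weights on the indices that are not resolved. -/
lemma abs_mul_wt_le_of_unresolved {l M N : ℕ} (hl : 6 < l) (hM : 0 < M) (hN : 0 < N)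
    (he : Even N) (q : ℤ × ℤ → ℝ) {a : ℤ × ℤ} (ha : Unresolved M N a) :
    |q a| * (wt 2 a.1 * wt 1 a.2) ≤ 2 ^ l * ((M : ℝ) ^ (6 - (l : ℤ)) + (N : ℝ) ^ (3 - (l : ℤ))) *
      (|wt l a.1 * wt l a.2 * q a| * (invWt 1 a.1 * invWt 1 a.2)) := by
  have h1 := wt_pos l a.1
  have h2 := wt_pos l a.2
  have hM0 : (0 : ℝ) < (M : ℝ) ^ (6 - (l : ℤ)) := by positivity
  have hN0 : (0 : ℝ) < (N : ℝ) ^ (3 - (l : ℤ)) := by positivity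
  have hp : (1 : ℝ) ≤ 2 ^ l := one_le_pow₀ one_le_two
  set δ := (M : ℝ) ^ (6 - (l : ℤ)) + (N : ℝ) ^ (3 - (l : ℤ))
  have hi1 := invWt_pos 1 a.1
  have hi2 := invWt_pos 1 a.2
  -- One inverse power per variable is reserved for Cauchy–Schwarz. The rest gives `M^{3-l}` or
  -- `(N/2)^{2-l}`, stronger than the required rates; `2^l` absorbs the halving of `N`.
  have key : invWt (l - 3) a.1 * invWt (l - 2) a.2 ≤ 2 ^ l * δ := by
    have hle : ∀ (p : ℕ) (m : ℤ), invWt p m ≤ 1 := fun p m => inv_le_one_of_one_le₀ (one_le_wt p m)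
    rcases ha with ha | ha
    · have h3 := invWt_le_of_le (p := l - 3) hM ha.le
      have h4 := inv_pow_le_zpow (p := l - 3) hM (z := 6 - (l : ℤ)) (by omega)
      calc _ ≤ (M : ℝ) ^ (6 - (l : ℤ)) * 1 :=
            mul_le_mul (h3.trans h4) (hle _ _) (invWt_pos _ _).le hM0.le
        _ ≤ 1 * δ := by rw [mul_one, one_mul]; exact le_add_of_nonneg_right hN0.le
        _ ≤ _ := by gcongr
    · obtain ⟨r, rfl⟩ := he
      have hr : 0 < r := by omega
      have h3 := invWt_le_of_le (p := l - 2) (n := a.2) hr (by push_cast at ha; omega)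
      have h4 := inv_pow_le_zpow (p := l - 2) hN (z := 3 - (l : ℤ)) (by omega)
      have h5 : ((r : ℝ) ^ (l - 2))⁻¹ = 2 ^ (l - 2) * (((r + r : ℕ) : ℝ) ^ (l - 2))⁻¹ := by
        push_cast
        rw [← two_mul, mul_pow]
        have : (0 : ℝ) < r := by exact_mod_cast hr
        field_simp
      have h6 : (2 : ℝ) ^ (l - 2) ≤ 2 ^ l := pow_le_pow_right₀ one_le_two (by omega)
      calc _ ≤ 1 * ((r : ℝ) ^ (l - 2))⁻¹ :=
            mul_le_mul (hle _ _) h3 (invWt_pos _ _).le zero_le_one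
        _ = 2 ^ (l - 2) * (((r + r : ℕ) : ℝ) ^ (l - 2))⁻¹ := by rw [one_mul, h5]
        _ ≤ 2 ^ l * ((r + r : ℕ) : ℝ) ^ (3 - (l : ℤ)) :=
            mul_le_mul h6 h4 (by positivity) (by positivity)
        _ ≤ _ := by
            gcongr
            exact le_add_of_nonneg_left hM0.le
  have e1 : invWt (l - 2) a.1 = invWt 1 a.1 * invWt (l - 3) a.1 := by
    rw [← invWt_add]; congr 1; omega
  have e2 : invWt (l - 1) a.2 = invWt 1 a.2 * invWt (l - 2) a.2 := by
    rw [← invWt_add]; congr 1; omega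
  rw [wt_eq_mul_invWt (by omega : 2 ≤ l), wt_eq_mul_invWt (by omega : 1 ≤ l), abs_mul,
    abs_of_pos (mul_pos h1 h2), e1, e2]
  calc _ = (invWt (l - 3) a.1 * invWt (l - 2) a.2) *
        (wt l a.1 * wt l a.2 * |q a| * (invWt 1 a.1 * invWt 1 a.2)) := by ring
    _ ≤ _ := by gcongr

/-- Uniform bounds of a function and of its interpolation error, with first derivatives. -/
lemma exists_c1Bound {l : ℕ} (hl : 6 < l) : ∃ C : ℝ, 0 ≤ C ∧
    ∀ {M N : ℕ}, 0 < M → 0 < N → Even N → ∀ P : ℝ × ℝ → ℝ,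
      ContDiffOn ℝ 1 P DomBar → MemSob l l P → ∀ x ∈ Dom,
        C1Bound P x (C * (sobNorm l l P).toReal) ∧
        C1Bound (fun x => interp M N P x - P x) x (C * (sobNorm l l P).toReal *
          ((M : ℝ) ^ (6 - (l : ℤ)) + (N : ℝ) ^ (3 - (l : ℤ)))) := by
  obtain ⟨C, hC0, H⟩ := exists_tsum_abs_errCoeff_le l l
  have hl3 : 3 ≤ l := by omega
  have hl2 : 2 ≤ l := by omega
  -- The 4 comes from the pointwise bound of `basisErr`, the `2^l` from the decay on unresolved
  -- indices, and `C` from the `ℓ¹` bound.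
  refine ⟨4 * 2 ^ l * C, by positivity, fun {M N} hM hN he P hP hm x hx => ?_⟩
  have hc := hP.continuousOn
  have hS0 : 0 ≤ (sobNorm l l P).toReal := ENNReal.toReal_nonneg
  have hp : (1 : ℝ) ≤ 2 ^ l := one_le_pow₀ one_le_two
  set δ := (M : ℝ) ^ (6 - (l : ℤ)) + (N : ℝ) ^ (3 - (l : ℤ))
  have hδ : 0 < δ := by positivity
  set f : ℤ × ℤ → ℝ := fun a =>
    |wt l a.1 * wt l a.2 * errCoeff P a| * (invWt 1 a.1 * invWt 1 a.2)
  have hf : Summable f := summable_abs_mul_invWt (summable_errCoeff_sq hc hm)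
  have hfS : ∑' a, f a ≤ C * (sobNorm l l P).toReal := H P hc hm
  have mono : ∀ {v : ℝ × ℝ → ℝ} {B B' : ℝ}, C1Bound v x B → B ≤ B' → C1Bound v x B' :=
    fun h hB => ⟨h.1.trans hB, h.2.1.trans hB, h.2.2.trans hB⟩
  constructor
  · refine mono (c1Bound_of_hasSum (q := fun a => -errCoeff P a) (u := fun a => 4 * f a)
      (E := fun j k a x => chebD j a.1 x.1 * casD k a.2 x.2) hP
      (fun y hy => hasSum_errCoeff_fcBasis hl3 hl2 hc hm (Dom_subset_DomBar hy))
      (fun a ρ φ => (hasDerivAt_chebD 0 a.1 ρ).mul_const (casD 0 a.2 φ))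
      (fun a ρ φ => (hasDerivAt_casD 0 a.2 φ).const_mul (chebD 0 a.1 ρ)) (hf.mul_left 4) ?_ hx) ?_
    · intro j hj k hk a y hy
      have h1 := (abs_chebD_le hj a.1 (fst_mem_Icc hy)).trans (abs_pow_le_wt _ _)
      have h2 := (abs_casD_le k a.2 y.2).trans
        (mul_le_mul_of_nonneg_left (abs_pow_le_wt k a.2) zero_le_two)
      have h3 : wt (2 * j) a.1 ≤ wt 2 a.1 := wt_mono (by omega) _
      have h4 : wt k a.2 ≤ wt 1 a.2 := wt_mono hk _
      have h5 := wt_pos 2 a.1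
      have h6 := wt_pos 1 a.2
      have h7 := abs_mul_wt_le hl3 hl2 (errCoeff P) a
      rw [norm_mul, norm_mul, norm_neg, Real.norm_eq_abs, Real.norm_eq_abs, Real.norm_eq_abs]
      calc _ ≤ |errCoeff P a| * (wt 2 a.1 * (2 * wt 1 a.2)) := by
            gcongr
            · exact h1.trans h3
            · linarith
        _ = 2 * (|errCoeff P a| * (wt 2 a.1 * wt 1 a.2)) := by ring
        _ ≤ 4 * (|errCoeff P a| * (wt 2 a.1 * wt 1 a.2)) := by
            gcongr; norm_num
        _ ≤ _ := mul_le_mul_of_nonneg_left h7 (by norm_num)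
    · rw [tsum_mul_left]
      calc _ ≤ 4 * (C * (sobNorm l l P).toReal) := by gcongr
        _ = 4 * 1 * C * (sobNorm l l P).toReal := by ring
        _ ≤ _ := by gcongr
  · have hI : ContDiffOn ℝ 1 (interp M N P) DomBar :=
      (isInterpolant_interp hN he P).1.contDiff.contDiffOn
    have hq := summable_errCoeff hl3 hl2 hc hm
    refine mono (c1Bound_of_hasSum (q := errCoeff P) (u := fun a => 4 * (2 ^ l * δ * f a))
      (E := basisErr M N) (hI.sub hP)
      (fun y hy => ?_) (hasDerivAt_basisErr_fst M N 0 0) (hasDerivAt_basisErr_snd M N 0 0)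
      ((hf.mul_left _).mul_left 4) ?_ hx) ?_
    · rw [interp_sub_eq hl3 hl2 hc hm hM hN he (Dom_subset_DomBar hy)]
      exact hasSum_errSeries hM hN he zero_le_one zero_le_one hq (fst_mem_Icc hy)
    · intro j hj k hk a y hy
      by_cases ha : Unresolved M N a
      · exact (abs_mul_basisErr_le hM hN he hj hk _ a (fst_mem_Icc hy)).trans
          (mul_le_mul_of_nonneg_left (abs_mul_wt_le_of_unresolved hl hM hN he _ ha) (by norm_num))
      · rw [basisErr_eq_zero hM j k ha]
        have := invWt_pos 1 a.1
        have := invWt_pos 1 a.2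
        simp only [Pi.zero_apply, mul_zero, norm_zero, f]
        positivity
    · rw [tsum_mul_left, tsum_mul_left]
      calc _ ≤ 4 * (2 ^ l * δ * (C * (sobNorm l l P).toReal)) := by gcongr
        _ = _ := by ring

end

/-! ### Perturbation of the determinant. -/

section

open MeasureTheory Filter Topology

/-- The perturbation of the cubic expression in the determinant. -/
lemma abs_det_sub_le {A δ p p₁ p₂ q₁ q₂ e e₁ e₂ f₁ f₂ : ℝ} (hδ2 : δ ≤ 2) (hA : 0 ≤ A)
    (hδ : 0 ≤ δ) (hp : |p| ≤ A) (hp₁ : |p₁| ≤ A) (hp₂ : |p₂| ≤ A) (hq₁ : |q₁| ≤ A)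
    (hq₂ : |q₂| ≤ A) (he : |e| ≤ A * δ) (he₁ : |e₁| ≤ A * δ) (he₂ : |e₂| ≤ A * δ)
    (hf₁ : |f₁| ≤ A * δ) (hf₂ : |f₂| ≤ A * δ) :
    |(p + e) * ((p₁ + e₁) * (q₂ + f₂ + 1) - (p₂ + e₂) * (q₁ + f₁)) -
      p * (p₁ * (q₂ + 1) - p₂ * q₁)| ≤ 26 * δ * A * (1 + A) ^ 2 := by
  have hmul : ∀ {x y a b : ℝ}, |x| ≤ a → |y| ≤ b → |x * y| ≤ a * b := fun {x y a b} hx hy => by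
    rw [abs_mul]
    exact mul_le_mul hx hy (abs_nonneg _) ((abs_nonneg _).trans hx)
  have hadd : ∀ {x y a b : ℝ}, |x| ≤ a → |y| ≤ b → |x + y| ≤ a + b := fun {x y a b} hx hy =>
    (abs_add_le x y).trans (add_le_add hx hy)
  have hsub : ∀ {x y a b : ℝ}, |x| ≤ a → |y| ≤ b → |x - y| ≤ a + b := fun {x y a b} hx hy =>
    (abs_sub x y).trans (add_le_add hx hy)
  have hone : |(1 : ℝ)| ≤ 1 := by simp
  have h3 : ∀ {x y : ℝ}, |x| ≤ A → |y| ≤ A * δ → |x + y| ≤ 3 * A := fun {x y} hx hy =>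
    (hadd hx hy).trans (by nlinarith)
  -- Telescoping leaves one explicit error factor in every product; perturbed factors are at most
  -- `3A` because `δ ≤ 2`. The cubic terms add up to `(18 + 8) δ A³`, whence the constant 26.
  have key : (p + e) * ((p₁ + e₁) * (q₂ + f₂ + 1) - (p₂ + e₂) * (q₁ + f₁)) -
      p * (p₁ * (q₂ + 1) - p₂ * q₁) =
      e * ((p₁ + e₁) * (q₂ + f₂ + 1) - (p₂ + e₂) * (q₁ + f₁)) +
        p * ((e₁ * (q₂ + f₂ + 1) + p₁ * f₂) - (e₂ * (q₁ + f₁) + p₂ * f₁)) := by ring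
  have h4 := h3 hq₂ hf₂
  have h5 := h3 hq₁ hf₁
  have hb := hadd (hmul he (hsub (hmul (h3 hp₁ he₁) (hadd h4 hone)) (hmul (h3 hp₂ he₂) h5)))
    (hmul hp (hsub (hadd (hmul he₁ (hadd h4 hone)) (hmul hp₁ hf₂))
      (hadd (hmul he₂ h5) (hmul hp₂ hf₁))))
  rw [key]
  refine hb.trans ?_
  have h6 : 0 ≤ δ * A := by positivity
  have h7 : 0 ≤ δ * A * A := by positivity
  nlinarith

lemma continuousOn_detD {ε γ : ℝ} (hε : 0 < ε) (hγ : ε < γ) {P Q : ℝ × ℝ → ℝ}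
    (hP : ContDiffOn ℝ 1 P DomBar) (hQ : ContDiffOn ℝ 1 Q DomBar) :
    ContinuousOn (detD ε γ P Q) DomBar := by
  have h1 := continuousOn_dρ hP
  have h2 := continuousOn_dφ hP
  have h3 := continuousOn_dρ hQ
  have h4 := continuousOn_dφ hQ
  have h5 : ContinuousOn (fun x : ℝ × ℝ =>
      (2 / (γ - ε)) / ((γ + ε) / 2 + (γ - ε) / 2 * x.1)) DomBar := by
    refine continuousOn_const.div (by fun_prop) fun x hx => ?_
    nlinarith [hx.1.1]
  exact (h5.mul hP.continuousOn).mul ((h1.mul (h4.add continuousOn_const)).sub (h2.mul h3))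

/-- The termwise estimates are made in the open rectangle, where the one-sided derivatives are
ordinary ones; continuity carries the bound to the closure. -/
lemma supNorm_le_of_continuousOn {f : ℝ × ℝ → ℝ} {B : ℝ} (hf : ContinuousOn f DomBar)
    (h : ∀ x ∈ Dom, |f x| ≤ B) : supNorm f ≤ ENNReal.ofReal B := by
  refine iSup₂_le fun x hx => ?_
  have hcl : closure Dom = DomBar := Set.Subset.antisymm
    (closure_minimal Dom_subset_DomBar isCompact_DomBar.isClosed) DomBar_subset_closure
  rw [← ofReal_norm, Real.norm_eq_abs]
  refine ENNReal.ofReal_le_ofReal ?_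
  exact le_on_closure (f := fun x => |f x|) (g := fun _ => B) h (by rw [hcl]; exact hf.abs)
    continuousOn_const (DomBar_subset_closure hx)

/-- The error of the determinant. -/
theorem exists_supNorm_detD_sub_le {ε γ : ℝ} {l : ℕ} (hε : 0 < ε) (hγ : ε < γ) (hl : 6 < l) :
    ∃ c : ℝ, 0 < c ∧ ∀ M N : ℕ, 1 ≤ M → 1 ≤ N → Even N → ∀ P Q : ℝ × ℝ → ℝ,
      ContDiffOn ℝ 1 P DomBar → ContDiffOn ℝ 1 Q DomBar → MemSob l l P → MemSob l l Q →
      supNorm (fun x => detD ε γ (interp M N P) (interp M N Q) x - detD ε γ P Q x) ≤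
        ENNReal.ofReal c * (1 + sobNorm l l P + sobNorm l l Q) ^ 2 *
          (sobNorm l l P + sobNorm l l Q) *
          ENNReal.ofReal ((M : ℝ) ^ (6 - (l : ℤ)) + (N : ℝ) ^ (3 - (l : ℤ))) := by
  obtain ⟨C, hC0, H⟩ := exists_c1Bound hl
  have hγε : 0 < γ - ε := by linarith
  -- This bounds the prefactor `ρ_r / r`, since `r ≥ ε` for `ρ ≥ -1`.
  set κ := 2 / (γ - ε) / ε with hκ
  have hκ0 : 0 < κ := by positivity
  refine ⟨κ * (26 * C * (1 + C) ^ 2) + 1, by positivity, fun M N hM hN he P Q hP hQ hmP hmQ => ?_⟩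
  set δ := (M : ℝ) ^ (6 - (l : ℤ)) + (N : ℝ) ^ (3 - (l : ℤ)) with hδ
  have hδ0 : 0 < δ := by positivity
  have hδ2 : δ ≤ 2 := by
    have h1 : (M : ℝ) ^ (6 - (l : ℤ)) ≤ 1 :=
      zpow_le_one_of_nonpos₀ (by exact_mod_cast hM) (by omega)
    have h2 : (N : ℝ) ^ (3 - (l : ℤ)) ≤ 1 :=
      zpow_le_one_of_nonpos₀ (by exact_mod_cast hN) (by omega)
    linarith
  set a := (sobNorm l l P).toReal with ha
  set b := (sobNorm l l Q).toReal with hb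
  have ha0 : 0 ≤ a := ENNReal.toReal_nonneg
  have hb0 : 0 ≤ b := ENNReal.toReal_nonneg
  have hIP : ContDiffOn ℝ 1 (interp M N P) DomBar :=
    (isInterpolant_interp hN he P).1.contDiff.contDiffOn
  have hIQ : ContDiffOn ℝ 1 (interp M N Q) DomBar :=
    (isInterpolant_interp hN he Q).1.contDiff.contDiffOn
  have hbound : ∀ x ∈ Dom, |detD ε γ (interp M N P) (interp M N Q) x - detD ε γ P Q x| ≤
      κ * (26 * δ * (C * (a + b)) * (1 + C * (a + b)) ^ 2) := by
    intro x hx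
    have hx' := Dom_subset_DomBar hx
    obtain ⟨hPx, heP⟩ := H hM hN he P hP hmP x hx
    obtain ⟨hQx, heQ⟩ := H hM hN he Q hQ hmQ x hx
    simp only [C1Bound, dρ_sub hIP hP hx', dφ_sub hIP hP hx', dρ_sub hIQ hQ hx',
      dφ_sub hIQ hQ hx'] at hPx heP hQx heQ
    have hCa : C * a ≤ C * (a + b) := by gcongr; linarith
    have hCb : C * b ≤ C * (a + b) := by gcongr; linarith
    have hCa' : C * a * δ ≤ C * (a + b) * δ := by gcongr
    have hCb' : C * b * δ ≤ C * (a + b) * δ := by gcongr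
    have h1 := abs_det_sub_le hδ2 (by positivity : 0 ≤ C * (a + b)) hδ0.le
      (hPx.1.trans hCa) (hPx.2.1.trans hCa) (hPx.2.2.trans hCa) (hQx.2.1.trans hCb)
      (hQx.2.2.trans hCb) (heP.1.trans hCa') (heP.2.1.trans hCa') (heP.2.2.trans hCa')
      (heQ.2.1.trans hCb') (heQ.2.2.trans hCb')
    simp only [add_sub_cancel] at h1
    have hden : ε ≤ (γ + ε) / 2 + (γ - ε) / 2 * x.1 := by nlinarith [hx'.1.1]
    have hpre : |(2 / (γ - ε)) / ((γ + ε) / 2 + (γ - ε) / 2 * x.1)| ≤ κ := by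
      rw [abs_of_nonneg (div_nonneg (by positivity) (hε.le.trans hden))]
      exact div_le_div_of_nonneg_left (by positivity) hε hden
    rw [detD, detD, mul_assoc, mul_assoc _ (P x), ← mul_sub, abs_mul]
    exact mul_le_mul hpre h1 (abs_nonneg _) hκ0.le
  refine (supNorm_le_of_continuousOn
    ((continuousOn_detD hε hγ hIP hIQ).sub (continuousOn_detD hε hγ hP hQ)) hbound).trans ?_
  rw [← ENNReal.ofReal_toReal hmP.ne, ← ENNReal.ofReal_toReal hmQ.ne, ← ha, ← hb,
    ← ENNReal.ofReal_one, ← ENNReal.ofReal_add zero_le_one ha0,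
    ← ENNReal.ofReal_add (by positivity) hb0, ← ENNReal.ofReal_add ha0 hb0,
    ← ENNReal.ofReal_pow (by positivity), ← ENNReal.ofReal_mul (by positivity),
    ← ENNReal.ofReal_mul (by positivity), ← ENNReal.ofReal_mul (by positivity)]
  refine ENNReal.ofReal_le_ofReal ?_
  have h1 : 1 + C * (a + b) ≤ (1 + C) * (1 + a + b) := by nlinarith
  calc κ * (26 * δ * (C * (a + b)) * (1 + C * (a + b)) ^ 2)
      ≤ κ * (26 * δ * (C * (a + b)) * ((1 + C) * (1 + a + b)) ^ 2) := by gcongr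
    _ = (κ * (26 * C * (1 + C) ^ 2)) * (1 + a + b) ^ 2 * (a + b) * δ := by ring
    _ ≤ _ := by gcongr; linarith

end

end FourierChebyshev

end

theorem theorem4p2 :
    -- the interpolation operator `I^{NM} : 𝓑 → 𝓑^{NM}` is well defined
    (∀ M N : ℕ, 1 ≤ M → 1 ≤ N → Even N →
      (∀ v : ℝ × ℝ → ℝ, (∃! p, FourierChebyshev.IsInterpolant M N v p) ∧
        FourierChebyshev.IsInterpolant M N v (FourierChebyshev.interp M N v)) ∧
      ∀ (P₀ Q₀ : ℝ → ℝ) (P Q : ℝ × ℝ → ℝ), FourierChebyshev.MemB P₀ Q₀ P Q →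
        FourierChebyshev.MemBNM M N P₀ Q₀
          (FourierChebyshev.interp M N P) (FourierChebyshev.interp M N Q)) ∧
    -- interpolation error of `P` and `Q`
    (∀ l s : ℕ, 2 < l → 1 < s → ∃ c : ℝ, 0 < c ∧
      ∀ α β M N : ℕ, α ≤ 1 → β ≤ 1 → 1 ≤ M → 1 ≤ N → Even N →
      ∀ (P₀ Q₀ : ℝ → ℝ) (P Q : ℝ × ℝ → ℝ), FourierChebyshev.MemB P₀ Q₀ P Q →
        FourierChebyshev.MemSob s l P → FourierChebyshev.MemSob s l Q →
        FourierChebyshev.sobNorm β α (fun x => FourierChebyshev.interp M N P x - P x) ≤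
          ENNReal.ofReal c * FourierChebyshev.starNorm α β l s P *
            ENNReal.ofReal ((M : ℝ) ^ (2 * (α : ℤ) - (l : ℤ)) +
              (N : ℝ) ^ ((β : ℤ) - (s : ℤ))) ∧
        FourierChebyshev.sobNorm β α (fun x => FourierChebyshev.interp M N Q x - Q x) ≤
          ENNReal.ofReal c * FourierChebyshev.starNorm α β l s Q *
            ENNReal.ofReal ((M : ℝ) ^ (2 * (α : ℤ) - (l : ℤ)) +
              (N : ℝ) ^ ((β : ℤ) - (s : ℤ)))) ∧
    -- error of the determinant
    (∀ (ε γ : ℝ) (l : ℕ), 0 < ε → ε < γ → 6 < l → ∃ c : ℝ, 0 < c ∧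
      ∀ M N : ℕ, 1 ≤ M → 1 ≤ N → Even N →
      ∀ (P₀ Q₀ : ℝ → ℝ) (P Q : ℝ × ℝ → ℝ), FourierChebyshev.MemB P₀ Q₀ P Q →
        FourierChebyshev.MemSob l l P → FourierChebyshev.MemSob l l Q →
        FourierChebyshev.supNorm (fun x =>
            FourierChebyshev.detD ε γ (FourierChebyshev.interp M N P)
              (FourierChebyshev.interp M N Q) x - FourierChebyshev.detD ε γ P Q x) ≤
          ENNReal.ofReal c *
            (1 + FourierChebyshev.sobNorm l l P + FourierChebyshev.sobNorm l l Q) ^ 2 *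
            (FourierChebyshev.sobNorm l l P + FourierChebyshev.sobNorm l l Q) *
            ENNReal.ofReal ((M : ℝ) ^ (6 - (l : ℤ)) + (N : ℝ) ^ (3 - (l : ℤ)))) := by
  refine ⟨fun M N _ hN he => ⟨fun v => ⟨FourierChebyshev.existsUnique_isInterpolant hN he v,
    FourierChebyshev.isInterpolant_interp hN he v⟩, fun P₀ Q₀ P Q h =>
      FourierChebyshev.memBNM_interp hN he h⟩, fun l s hl hs => ?_, fun ε γ l hε hγ hl => ?_⟩
  · obtain ⟨c, hc, H⟩ := FourierChebyshev.exists_sobNorm_interp_sub_le hl hs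
    exact ⟨c, hc, fun α β M N hα hβ hM hN he P₀ Q₀ P Q h hP hQ =>
      ⟨H α β M N hα hβ hM hN he P h.1.continuousOn hP,
        H α β M N hα hβ hM hN he Q h.2.1.continuousOn hQ⟩⟩
  · obtain ⟨c, hc, H⟩ := FourierChebyshev.exists_supNorm_detD_sub_le hε hγ hl
    exact ⟨c, hc, fun M N hM hN he P₀ Q₀ P Q h hP hQ =>
      H M N hM hN he P Q h.1 h.2.1 hP hQ⟩
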